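/- Let $N\ge 1$ be odd and let $w:\mathbb C\to[0,\infty)$ be measurable with $w(\overline\lambda)=w(\lambda)$ for all $\lambda$. For $L+2M=N$, $\alpha\in\mathbb R^L$, $\beta\in\mathbb C^M$ put $$\rho_{L,M}(\alpha,\beta)=2^M\prod_{i=1}^L w(\alpha_i)\prod_{k=1}^M w(\beta_k)w(\overline{\beta_k})\;\bigl|\Delta(\alpha_1,\dots,\alpha_L,\beta_1,\overline{\beta_1},\dots,\beta_M,\overline{\beta_M})\bigr|,$$ where $\Delta$ is the Vandermonde determinant. Assume that every $\rho_{L,M}$ is Lebesgue integrable on $\mathbb R^L\times\mathbb C^M$ and that $$Z=\sum_{L+2M=N}\frac{1}{L!\,M!\,2^M}\int_{\mathbb R^L}\int_{\mathbb C^M}\rho_{L,M}\,d\beta\,d\alpha>0 .$$ Let $\Omega_{L,M}=\rho_{L,M}/Z$ (the partial joint densities of the real asymmetric ensemble with weight $w$), and for $\ell+2m\le N$, $\mathbf x\in\mathbb R^\ell$, $\mathbf z\in\mathbb C^m$ let $$R_{\ell,m}(\mathbf x,\mathbf z)=\sum_{\substack{L\ge\ell,\,M\ge m\\ L+2M=N}}\frac{1}{(L-\ell)!\,(M-m)!\,2^{M-m}}\int_{\mathbb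 R^{L-\ell}}\int_{\mathbb C^{M-m}}\Omega_{L,M}(\mathbf x\vee\alpha,\mathbf z\vee\beta)\,d\beta\,d\alpha .$$ Let $\mu=\mu_1+\mu_2$ be the sum of Lebesgue measure $\mu_1$ on $\mathbb R\subset\mathbb C$ and Lebesgue measure $\mu_2$ on $\mathbb C$. For $f:\mathbb C\to\mathbb C$ let $$\epsilon f(\lambda)=\tfrac12\int_{\mathbb R}f(\xi)\,\mathrm{sgn}(\lambda-\xi)\,d\xi\ \ (\lambda\in\mathbb R),\qquad \epsilon f(\lambda)=-i\,f(\overline\lambda)\,\mathrm{sgn}(\mathrm{Im}\,\lambda)\ \ (\lambda\notin\mathbb R),$$ and $\langle f|g\rangle=\int_{\mathbb C}(f\,\epsilon g-g\,\epsilon f)\,d\mu$. Let $p_0,\dots,p_{N-1}$ be monic polynomials with complex coefficients, $\deg p_n=n$, and $\tilde p_n=w\,p_n$. Let $\mathbf W$ be the antisymmetric $(N+1)\times(N+1)$ matrix, indexed by $0,\dots,N$, with $\mathbf W_{j,k}=\langle\tilde p_j|\tilde p_k\rangle$ for $j,k<N$, $\mathbf W_{j,N}=-\mathbf W_{N,j}=\int_{\mathbb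 R}\tilde p_j\,d\mu_1$ for $j<N$ and $\mathbf W_{N,N}=0$. Then the integrals $\int_{\mathbb R}\tilde p_n\,d\mu_1$ and $\langle\tilde p_j|\tilde p_k\rangle$ converge absolutely and $\mathbf W$ is invertible. Put $\mathbf C=(\mathbf W^{-1})^{\mathsf T}$, let $\chi$ be the characteristic function of $\mathbb R$ in $\mathbb C$, and define $$DS_N(y,y')=2\sum_{n,k<N}\tilde p_n(y)\mathbf C_{n,k}\tilde p_k(y'),$$ $$S_N(y,y')=2\sum_{n,k<N}\tilde p_n(y)\mathbf C_{n,k}\,\epsilon\tilde p_k(y')+\chi(y')\sum_{n<N}\tilde p_n(y)\mathbf C_{n,N},$$ $$S_NI(y,y')=2\sum_{n,k<N}\epsilon\tilde p_n(y)\mathbf C_{n,k}\,\epsilon\tilde p_k(y')+\sum_{n<N}\mathbf C_{n,N}\bigl(\chi(y')\epsilon\tilde p_n(y)-\chi(y)\epsilon\tilde p_n(y')\bigr),$$ $$K_N(y,y')=\begin{bmatrix}DS_N(y,y')&S_N(y,y')\\-S_N(y',y)&S_NI(y,y')+\tfrac12 s(y,y')\end{bmatrix},$$ where $s(y,y')=\mathrm{sgn}(y'-y)$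 if $y,y'\in\mathbb R$ and $s(y,y')=0$ otherwise. Then for all $\ell,m\ge0$ with $\ell+2m\le N$, all $\mathbf x\in\mathbb R^\ell$ and all $\mathbf z\in(\mathbb C\setminus\mathbb R)^m$, the integrals that define $R_{\ell,m}(\mathbf x,\mathbf z)$ converge absolutely and $$R_{\ell,m}(\mathbf x,\mathbf z)=\mathrm{Pf}\begin{bmatrix}K_N(x_j,x_{j'})&K_N(x_j,z_{k'})\\K_N(z_k,x_{j'})&K_N(z_k,z_{k'})\end{bmatrix}_{j,j'=1,\dots,\ell;\ k,k'=1,\dots,m},$$ the Pfaffian of the $2(\ell+m)\times2(\ell+m)$ matrix with these $2\times2$ blocks (the empty Pfaffian being $1$). -/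

import Mathlib

open MeasureTheory
open scoped ComplexConjugate Matrix Nat

noncomputable section

/-- The Pfaffian of a `2n × 2n` matrix. -/
def pfaffian {n : ℕ} (A : Matrix (Fin (n * 2)) (Fin (n * 2)) ℂ) : ℂ :=
  (1 / (2 ^ n * n ! : ℂ)) * ∑ σ : Equiv.Perm (Fin (n * 2)),
    ((Equiv.Perm.sign σ : ℤ) : ℂ) *
      ∏ i : Fin n, A (σ (finProdFinEquiv (i, 0))) (σ (finProdFinEquiv (i, 1)))

/-- The `2n × 2n` matrix whose `(j, k)` block of size `2 × 2` is `B j k`. -/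
def blockMatrix {n : ℕ} (B : Fin n → Fin n → Matrix (Fin 2) (Fin 2) ℂ) :
    Matrix (Fin (n * 2)) (Fin (n * 2)) ℂ :=
  Matrix.of fun r s =>
    B (finProdFinEquiv.symm r).1 (finProdFinEquiv.symm s).1
      (finProdFinEquiv.symm r).2 (finProdFinEquiv.symm s).2

namespace RealAsymmetric

/-- The list `α₁, …, α_L, β₁, conj β₁, …, β_M, conj β_M` of eigenvalues. -/
def eigenvalues {L M : ℕ} (α : Fin L → ℝ) (β : Fin M → ℂ) : Fin (L + M * 2) → ℂ :=
  Fin.append (fun i => (α i : ℂ)) (fun i =>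
    if (finProdFinEquiv.symm i).2 = 0 then β (finProdFinEquiv.symm i).1
    else conj (β (finProdFinEquiv.symm i).1))

/-- The unnormalized partial joint density of `L` real eigenvalues and `M` pairs of complex
conjugate eigenvalues, with weight function `w`. -/
def density (w : ℂ → ℝ) {L M : ℕ} (α : Fin L → ℝ) (β : Fin M → ℂ) : ℝ :=
  2 ^ M * ((∏ i, w (α i)) * ∏ i, w (β i) * w (conj (β i))) *
    ‖(Matrix.vandermonde (eigenvalues α β)).det‖

/-- The pairs `(L, M)` of natural numbers with `L + 2 M = N`. -/
def sectors (N : ℕ) : Finset (ℕ × ℕ) :=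
  (Finset.range (N + 1) ×ˢ Finset.range (N + 1)).filter fun s => s.1 + 2 * s.2 = N

/-- The normalizing constant, which gives the ensemble total mass `1`. -/
def partitionFunction (N : ℕ) (w : ℂ → ℝ) : ℝ :=
  ∑ s ∈ sectors N, 1 / ((s.1)! * (s.2)! * 2 ^ s.2 : ℝ) *
    ∫ α : Fin s.1 → ℝ, ∫ β : Fin s.2 → ℂ, density w α β

/-- The partial joint probability density function `Ω_{L,M}`. -/
def jpdf (N : ℕ) (w : ℂ → ℝ) {L M : ℕ} (α : Fin L → ℝ) (β : Fin M → ℂ) : ℝ :=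
  density w α β / partitionFunction N w

/-- The `(ℓ, m)`-correlation function. The sum over the sectors `(L, M)` with `L + 2 M = N`,
`L ≥ ℓ` and `M ≥ m` is parametrized by `(a, b) = (L - ℓ, M - m)`. -/
def correlation (N : ℕ) (w : ℂ → ℝ) {l m : ℕ} (x : Fin l → ℝ) (z : Fin m → ℂ) : ℝ :=
  ∑ s ∈ (Finset.range (N + 1) ×ˢ Finset.range (N + 1)).filter
      (fun s => (l + s.1) + 2 * (m + s.2) = N),
    1 / ((s.1)! * (s.2)! * 2 ^ s.2 : ℝ) *
      ∫ α : Fin s.1 → ℝ, ∫ β : Fin s.2 → ℂ, jpdf N w (Fin.append x α) (Fin.append z β)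

/-- The measure on `ℂ` that is the sum of the Lebesgue measures on `ℝ` and on `ℂ`. -/
def mu : Measure ℂ := Measure.map (fun t : ℝ => (t : ℂ)) volume + volume

/-- The operator `ε`. -/
def eps (f : ℂ → ℂ) (z : ℂ) : ℂ :=
  if z.im = 0 then (1 / 2) * ∫ ξ : ℝ, f ξ * (Real.sign (z.re - ξ) : ℂ)
  else -Complex.I * f (conj z) * (Real.sign z.im : ℂ)

/-- The skew-symmetric form `⟨f | g⟩`. -/
def skew (f g : ℂ → ℂ) : ℂ := ∫ z, (f z * eps g z - g z * eps f z) ∂mu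

/-- `w` times the polynomial `q`. -/
def wt (w : ℂ → ℝ) (q : Polynomial ℂ) (z : ℂ) : ℂ := (w z : ℂ) * q.eval z

/-- The `(N + 1) × (N + 1)` matrix `W`: the Gram matrix of the skew form, bordered by the
integrals over the real line. -/
def W {N : ℕ} (w : ℂ → ℝ) (p : Fin N → Polynomial ℂ) :
    Matrix (Fin N ⊕ Unit) (Fin N ⊕ Unit) ℂ :=
  Matrix.fromBlocks
    (Matrix.of fun j k => skew (wt w (p j)) (wt w (p k)))
    (Matrix.of fun j _ => ∫ t : ℝ, wt w (p j) t)
    (Matrix.of fun _ k => -∫ t : ℝ, wt w (p k) t)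
    0

/-- The inverse transpose of `W`. -/
def C {N : ℕ} (w : ℂ → ℝ) (p : Fin N → Polynomial ℂ) :
    Matrix (Fin N ⊕ Unit) (Fin N ⊕ Unit) ℂ := ((W w p)⁻¹)ᵀ

/-- The characteristic function of `ℝ` in `ℂ`. -/
def chi (z : ℂ) : ℂ := if z.im = 0 then 1 else 0

/-- `sgn (y' - y)` for real `y` and `y'`, and `0` if one of them is not real. -/
def sgnDiff (y y' : ℂ) : ℂ :=
  if y.im = 0 ∧ y'.im = 0 then (Real.sign (y'.re - y.re) : ℂ) else 0

def DS {N : ℕ} (w : ℂ → ℝ) (p : Fin N → Polynomial ℂ) (y y' : ℂ) : ℂ :=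
  2 * ∑ n : Fin N, ∑ k : Fin N,
    wt w (p n) y * C w p (Sum.inl n) (Sum.inl k) * wt w (p k) y'

def S {N : ℕ} (w : ℂ → ℝ) (p : Fin N → Polynomial ℂ) (y y' : ℂ) : ℂ :=
  2 * ∑ n : Fin N, ∑ k : Fin N,
    wt w (p n) y * C w p (Sum.inl n) (Sum.inl k) * eps (wt w (p k)) y' +
  chi y' * ∑ n : Fin N, wt w (p n) y * C w p (Sum.inl n) (Sum.inr ())

def SI {N : ℕ} (w : ℂ → ℝ) (p : Fin N → Polynomial ℂ) (y y' : ℂ) : ℂ :=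
  2 * ∑ n : Fin N, ∑ k : Fin N,
    eps (wt w (p n)) y * C w p (Sum.inl n) (Sum.inl k) * eps (wt w (p k)) y' +
  ∑ n : Fin N, C w p (Sum.inl n) (Sum.inr ()) *
    (chi y' * eps (wt w (p n)) y - chi y * eps (wt w (p n)) y')

/-- The `2 × 2` matrix kernel `K_N`. -/
def kernel {N : ℕ} (w : ℂ → ℝ) (p : Fin N → Polynomial ℂ) (y y' : ℂ) :
    Matrix (Fin 2) (Fin 2) ℂ :=
  !![DS w p y y', S w p y y';
     -S w p y' y, SI w p y y' + (1 / 2) * sgnDiff y y']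

end RealAsymmetric

end

/-!
The correlation functions are computed in an exterior algebra. For an alternating form `B` on a
space `E`, the functional `Wick.wick B` on the exterior algebra of `E` sends a product of vectors to
the Pfaffian of their Gram matrix (`Wick.wick_eq_pfaffian`). The space of generators `Fock.Space N`
has one generator for each row of the matrix `W`, the dual of the space of polynomials, and one
generator for each real point; the form `Fock.form` pairs polynomials with rows by evaluation, real
points with rows by `ε p̃ⱼ` and by `1` for the border, real points with each other by half the sign
of their difference, and rows with each other by `-W`, up to a scaling of rows and columns
(`Fock.gram`). Each real point and each pair of complex conjugate points gives a product of two
vectors, and `Fock.corr` is the Wick functional of the product over all points and all rows.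

Four facts about `Fock.corr` give the theorem.

* For a full set of points, `corr` is a constant multiple of the density (`Fock.corr_top`). The
  evaluations at the points exhaust the rows and give the Vandermonde determinant. The real points
  remain, together with the border; this is where `N` is odd. The signs of their differences
  restore the absolute value of the Vandermonde determinant, whose phase is otherwise due to the
  pairs `z`, `conj z` only.
* Integration over one point multiplies `corr` by the number of remaining points
  (`Fock.corr_integral`). To multiply by a pair of vectors that belong to one point is to contract
  with a decomposable alternating form. By the definition of `W`, the integral of these forms is the
  infinitesimal change of `form` under the rescaling of rows against polynomials
  (`Fock.hasIntegralSum_forms`), so that the integral of `corr` is given by an Euler identity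
  (`Wick.wick_deriv`), where the degree under this rescaling counts the remaining points. Iterating
  this identity turns `corr` of some points into the sum over all sectors of the integrals over the
  remaining points (`Fock.sum_corrIntegral`): `corr` is the correlation function times a constant,
  and without points it is the partition function times the same constant.
* If the form on the rows were singular, then `corr` without points would vanish
  (`Fock.isUnit_of_wick_top_ne_zero`). Hence `W` is invertible.
* With an invertible form on the rows, the rows can be eliminated. The value of `corr` becomes the
  Pfaffian of the Schur complement times the value without points (`Fock.corr_eq_pfaffian`), and
  the entries of the Schur complement are those of the matrix kernel (`Fock.kernel_eq`).

The integrability of all one-point functions is extracted from that of the densities. For almost all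
choices of nodes on the real line, the slices of the densities through all but one of the nodes are
integrable, and Lagrange interpolation recovers all polynomials of the needed degree from the
products of the differences to all nodes but one (`Fock.integrable_wt_real`,
`Fock.integrable_antisymm`). Conversely, these give the integrability of the densities in any part of
the points: the density is the norm of a linear functional of a product in a finite-dimensional
exterior algebra, with one integrable factor for each point (`Fock.integrable_density_append`).
-/

/-! ### The Wick functional of an alternating form -/

namespace Wick

open ExteriorAlgebra CliffordAlgebra

variable {E : Type*} [AddCommGroup E] [Module ℂ E]

/-- Contraction of an element of the exterior algebra with a linear form. -/
def ctr : Module.Dual ℂ E →ₗ[ℂ] ExteriorAlgebra ℂ E →ₗ[ℂ] ExteriorAlgebra ℂ E :=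
  contractLeft (Q := (0 : QuadraticForm ℂ E))

theorem ctr_ι_mul (d : Module.Dual ℂ E) (v : E) (x : ExteriorAlgebra ℂ E) :
    ctr d (ExteriorAlgebra.ι ℂ v * x) = d v • x - ExteriorAlgebra.ι ℂ v * ctr d x :=
  contractLeft_ι_mul d v x

theorem ctr_one (d : Module.Dual ℂ E) : ctr d 1 = 0 := contractLeft_one _ d

theorem ctr_ctr_self (d : Module.Dual ℂ E) (x : ExteriorAlgebra ℂ E) : ctr d (ctr d x) = 0 :=
  contractLeft_contractLeft d x

theorem ctr_comm (d d' : Module.Dual ℂ E) (x : ExteriorAlgebra ℂ E) :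
    ctr d (ctr d' x) = -ctr d' (ctr d x) :=
  contractLeft_comm d d' x

/-- Induction on the exterior algebra by multiplying with vectors from the left. -/
theorem left_induction {P : ExteriorAlgebra ℂ E → Prop} (one : P 1)
    (add : ∀ x y, P x → P y → P (x + y)) (smul : ∀ (r : ℂ) x, P x → P (r • x))
    (ι_mul : ∀ v x, P x → P (ExteriorAlgebra.ι ℂ v * x)) (x : ExteriorAlgebra ℂ E) : P x := by
  induction x using CliffordAlgebra.left_induction with
  | algebraMap r => rw [Algebra.algebraMap_eq_smul_one]; exact smul r 1 one
  | add x y hx hy => exact add x y hx hy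
  | ι_mul x v hx => exact ι_mul v x hx

theorem ctr_mul_of_ctr_eq_zero (d : Module.Dual ℂ E) {e : ExteriorAlgebra ℂ E}
    (he : ctr d e = 0) (x : ExteriorAlgebra ℂ E) : ctr d (x * e) = ctr d x * e := by
  induction x using Wick.left_induction with
  | one => rw [one_mul, he, ctr_one, zero_mul]
  | add x y hx hy => simp only [add_mul, map_add] at *; rw [hx, hy]
  | smul r x hx => simp only [smul_mul_assoc, map_smul] at *; rw [hx]
  | ι_mul v x hx => rw [mul_assoc, ctr_ι_mul, ctr_ι_mul, hx, sub_mul, smul_mul_assoc, mul_assoc]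

theorem ctr_list_prod_eq_zero (d : Module.Dual ℂ E) (l : List E) (h : ∀ v ∈ l, d v = 0) :
    ctr d (l.map (ExteriorAlgebra.ι ℂ)).prod = 0 := by
  induction l with
  | nil => simp [ctr_one]
  | cons v l ih =>
    rw [List.map_cons, List.prod_cons, ctr_ι_mul, h v (by simp),
      ih fun w hw => h w (by simp [hw])]
    simp

/-- Two linear forms that agree on the factors of a product have the same contraction with it. -/
theorem ctr_list_prod_congr (d d' : Module.Dual ℂ E) (l : List E) (h : ∀ v ∈ l, d v = d' v) :
    ctr d (l.map (ExteriorAlgebra.ι ℂ)).prod = ctr d' (l.map (ExteriorAlgebra.ι ℂ)).prod := by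
  have := ctr_list_prod_eq_zero (d - d') l fun v hv => by simp [h v hv]
  simpa [sub_eq_zero] using this

/-- The exponential of the contraction with the alternating form `B`, as the change of form of
Clifford algebras from `0` to `0` by `-B`; an alternating form has the quadratic form `0`. -/
def expCtr (B : LinearMap.BilinForm ℂ E) (hB : B.IsAlt) :
    ExteriorAlgebra ℂ E →ₗ[ℂ] ExteriorAlgebra ℂ E :=
  changeForm (B := -B) (Q := 0) (Q' := 0) (by ext v; simp [hB v])

theorem expCtr_one (B : LinearMap.BilinForm ℂ E) (hB : B.IsAlt) : expCtr B hB 1 = 1 :=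
  changeForm_one _

theorem expCtr_ι_mul (B : LinearMap.BilinForm ℂ E) (hB : B.IsAlt) (v : E)
    (x : ExteriorAlgebra ℂ E) :
    expCtr B hB (ExteriorAlgebra.ι ℂ v * x) =
      ExteriorAlgebra.ι ℂ v * expCtr B hB x + ctr (B v) (expCtr B hB x) := by
  refine (changeForm_ι_mul _ v x).trans ?_
  rw [LinearMap.neg_apply, map_neg, LinearMap.neg_apply, sub_neg_eq_add]
  rfl

theorem expCtr_ctr (B : LinearMap.BilinForm ℂ E) (hB : B.IsAlt) (d : Module.Dual ℂ E)
    (x : ExteriorAlgebra ℂ E) : expCtr B hB (ctr d x) = ctr d (expCtr B hB x) :=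
  changeForm_contractLeft _ d x

/-- The Wick functional (quasi-free state) of an alternating form `B`: the linear functional on the
exterior algebra whose value on a product of vectors is the Pfaffian of their Gram matrix. -/
def wick (B : LinearMap.BilinForm ℂ E) (hB : B.IsAlt) : ExteriorAlgebra ℂ E →ₗ[ℂ] ℂ :=
  algebraMapInv.toLinearMap ∘ₗ expCtr B hB

theorem algebraMapInv_ι_mul (v : E) (x : ExteriorAlgebra ℂ E) :
    algebraMapInv (ExteriorAlgebra.ι ℂ v * x) = 0 := by
  simp [algebraMapInv]

variable {B : LinearMap.BilinForm ℂ E} {hB : B.IsAlt}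

theorem wick_one : wick B hB 1 = 1 := by simp [wick, expCtr_one]

/-- Wick's theorem, in the form of the expansion of a Pfaffian along its first row. -/
theorem wick_ι_mul (v : E) (x : ExteriorAlgebra ℂ E) :
    wick B hB (ExteriorAlgebra.ι ℂ v * x) = wick B hB (ctr (B v) x) := by
  simp only [wick, LinearMap.comp_apply, expCtr_ι_mul, expCtr_ctr, map_add, AlgHom.toLinearMap_apply,
    algebraMapInv_ι_mul, zero_add]

/-- The recursion step of `Wick.deriv`. -/
def derivStep (lam : E →ₗ[ℂ] E) :
    E →ₗ[ℂ] ExteriorAlgebra ℂ E × ExteriorAlgebra ℂ E →ₗ[ℂ] ExteriorAlgebra ℂ E :=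
  ((LinearMap.mul ℂ (ExteriorAlgebra ℂ E)).comp (ExteriorAlgebra.ι ℂ ∘ₗ lam)).compl₂
      (LinearMap.fst ℂ _ _) +
    ((LinearMap.mul ℂ (ExteriorAlgebra ℂ E)).comp (ExteriorAlgebra.ι ℂ)).compl₂
      (LinearMap.snd ℂ _ _)

theorem derivStep_apply (lam : E →ₗ[ℂ] E) (v : E) (x fx : ExteriorAlgebra ℂ E) :
    derivStep lam v (x, fx) = ExteriorAlgebra.ι ℂ (lam v) * x + ExteriorAlgebra.ι ℂ v * fx := rfl

theorem derivStep_derivStep (lam : E →ₗ[ℂ] E) (v : E) (x fx : ExteriorAlgebra ℂ E) :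
    derivStep lam v (ExteriorAlgebra.ι ℂ v * x, derivStep lam v (x, fx)) =
      (0 : QuadraticForm ℂ E) v • fx := by
  have h1 := ExteriorAlgebra.ι_add_mul_swap (R := ℂ) (lam v) v
  have h2 := ExteriorAlgebra.ι_sq_zero (R := ℂ) v
  rw [derivStep_apply, derivStep_apply, mul_add, ← mul_assoc, ← mul_assoc, ← mul_assoc, h2,
    zero_mul, add_zero, ← add_mul, h1, zero_mul]
  simp

/-- The derivation of the exterior algebra that extends a linear endomorphism. -/
def deriv (lam : E →ₗ[ℂ] E) : ExteriorAlgebra ℂ E →ₗ[ℂ] ExteriorAlgebra ℂ E :=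
  foldr' (0 : QuadraticForm ℂ E) (derivStep lam) (derivStep_derivStep lam) 0

theorem deriv_one (lam : E →ₗ[ℂ] E) : deriv lam 1 = 0 := by
  have := foldr'_algebraMap (0 : QuadraticForm ℂ E) (derivStep lam) (derivStep_derivStep lam) 0 1
  simpa [deriv] using this

theorem deriv_ι_mul (lam : E →ₗ[ℂ] E) (v : E) (x : ExteriorAlgebra ℂ E) :
    deriv lam (ExteriorAlgebra.ι ℂ v * x) =
      ExteriorAlgebra.ι ℂ (lam v) * x + ExteriorAlgebra.ι ℂ v * deriv lam x :=
  foldr'_ι_mul (0 : QuadraticForm ℂ E) (derivStep lam) (derivStep_derivStep lam) 0 v x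

theorem ctr_deriv (lam : E →ₗ[ℂ] E) (d : Module.Dual ℂ E) (x : ExteriorAlgebra ℂ E) :
    ctr d (deriv lam x) = deriv lam (ctr d x) + ctr (d ∘ₗ lam) x := by
  induction x using Wick.left_induction with
  | one => simp [deriv_one, ctr_one]
  | add x y hx hy => simp only [map_add, hx, hy]; abel
  | smul r x hx => simp only [map_smul, hx, smul_add]
  | ι_mul v x hx =>
    simp only [deriv_ι_mul, map_add, ctr_ι_mul, hx, map_sub, map_smul, mul_add,
      LinearMap.comp_apply]
    abel

theorem algebraMapInv_deriv (lam : E →ₗ[ℂ] E) (x : ExteriorAlgebra ℂ E) :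
    algebraMapInv (deriv lam x) = 0 := by
  induction x using Wick.left_induction with
  | one => simp [deriv_one]
  | add x y hx hy => simp only [map_add, hx, hy, add_zero]
  | smul r x hx => simp only [map_smul, hx, smul_zero]
  | ι_mul v x hx => simp only [deriv_ι_mul, map_add, algebraMapInv_ι_mul, add_zero]

/-- The recursion step of `Wick.ctr₂`. -/
def ctr₂Step (β : LinearMap.BilinForm ℂ E) :
    E →ₗ[ℂ] ExteriorAlgebra ℂ E × ExteriorAlgebra ℂ E →ₗ[ℂ] ExteriorAlgebra ℂ E :=
  (ctr ∘ₗ β).compl₂ (LinearMap.fst ℂ _ _) +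
    ((LinearMap.mul ℂ (ExteriorAlgebra ℂ E)).comp (ExteriorAlgebra.ι ℂ)).compl₂
      (LinearMap.snd ℂ _ _)

theorem ctr₂Step_apply (β : LinearMap.BilinForm ℂ E) (v : E) (x fx : ExteriorAlgebra ℂ E) :
    ctr₂Step β v (x, fx) = ctr (β v) x + ExteriorAlgebra.ι ℂ v * fx := rfl

theorem ctr₂Step_ctr₂Step {β : LinearMap.BilinForm ℂ E} (hβ : β.IsAlt) (v : E)
    (x fx : ExteriorAlgebra ℂ E) :
    ctr₂Step β v (ExteriorAlgebra.ι ℂ v * x, ctr₂Step β v (x, fx)) =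
      (0 : QuadraticForm ℂ E) v • fx := by
  rw [ctr₂Step_apply, ctr₂Step_apply, mul_add, ← mul_assoc, ExteriorAlgebra.ι_sq_zero, ctr_ι_mul,
    hβ v]
  simp

/-- Contraction of an element of the exterior algebra with the alternating form `β`, of degree
`-2`. -/
def ctr₂ (β : LinearMap.BilinForm ℂ E) (hβ : β.IsAlt) :
    ExteriorAlgebra ℂ E →ₗ[ℂ] ExteriorAlgebra ℂ E :=
  foldr' (0 : QuadraticForm ℂ E) (ctr₂Step β) (ctr₂Step_ctr₂Step hβ) 0

theorem ctr₂_one {β : LinearMap.BilinForm ℂ E} (hβ : β.IsAlt) : ctr₂ β hβ 1 = 0 := by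
  have := foldr'_algebraMap (0 : QuadraticForm ℂ E) (ctr₂Step β) (ctr₂Step_ctr₂Step hβ) 0 1
  simpa [ctr₂] using this

theorem ctr₂_ι_mul {β : LinearMap.BilinForm ℂ E} (hβ : β.IsAlt) (v : E)
    (x : ExteriorAlgebra ℂ E) :
    ctr₂ β hβ (ExteriorAlgebra.ι ℂ v * x) = ctr (β v) x + ExteriorAlgebra.ι ℂ v * ctr₂ β hβ x :=
  foldr'_ι_mul (0 : QuadraticForm ℂ E) (ctr₂Step β) (ctr₂Step_ctr₂Step hβ) 0 v x

/-- The alternating form `d ∧ d'`. -/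
def wedge (d d' : Module.Dual ℂ E) : LinearMap.BilinForm ℂ E :=
  d.smulRight d' - d'.smulRight d

theorem wedge_apply (d d' : Module.Dual ℂ E) (v v' : E) :
    wedge d d' v v' = d v * d' v' - d' v * d v' := rfl

theorem wedge_isAlt (d d' : Module.Dual ℂ E) : (wedge d d').IsAlt := fun v => by
  rw [wedge_apply]; ring

theorem ctr₂_wedge (d d' : Module.Dual ℂ E) (x : ExteriorAlgebra ℂ E) :
    ctr₂ (wedge d d') (wedge_isAlt d d') x = -ctr d (ctr d' x) := by
  induction x using Wick.left_induction with
  | one => simp [ctr₂_one, ctr_one]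
  | add x y hx hy => simp only [map_add, hx, hy, neg_add]
  | smul r x hx => simp only [map_smul, hx, smul_neg]
  | ι_mul v x hx =>
    have : wedge d d' v = d v • d' - d' v • d := rfl
    simp only [ctr₂_ι_mul, hx, this, ctr_ι_mul, map_sub, map_smul, LinearMap.sub_apply,
      LinearMap.smul_apply, mul_neg]
    abel

/-- Euler's identity for Pfaffians: the form `B'(v, v') = B(λ v, v') + B(v, λ v')` is the
infinitesimal change of `B` along the endomorphism `λ`. -/
theorem wick_deriv (lam : E →ₗ[ℂ] E) {β : LinearMap.BilinForm ℂ E} (hβ : β.IsAlt)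
    (h : ∀ v v', β v v' = B (lam v) v' + B v (lam v')) (x : ExteriorAlgebra ℂ E) :
    wick B hB (deriv lam x) = wick B hB (ctr₂ β hβ x) := by
  have key : expCtr B hB (deriv lam x) =
      deriv lam (expCtr B hB x) + expCtr B hB (ctr₂ β hβ x) := by
    induction x using Wick.left_induction with
    | one => simp [deriv_one, ctr₂_one, expCtr_one]
    | add x y hx hy => simp only [map_add, hx, hy]; abel
    | smul r x hx => simp only [map_smul, hx, smul_add]
    | ι_mul v x hx =>
      have : β v = B (lam v) + B v ∘ₗ lam := LinearMap.ext fun v' => h v v'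
      simp only [deriv_ι_mul, map_add, expCtr_ι_mul, hx, ctr₂_ι_mul, ctr_deriv, expCtr_ctr, this,
        LinearMap.add_apply, mul_add]
      abel
  simp only [wick, LinearMap.comp_apply, key, map_add, AlgHom.toLinearMap_apply,
    algebraMapInv_deriv, zero_add]

/-- If `B` has the constant value `c` on all ordered pairs of distinct factors, then the value of
the Wick functional is a power of `c`. -/
theorem wick_list_prod_of_pairwise (c : ℂ) (n : ℕ) (l : List E) (hl : l.length = 2 * n)
    (h : l.Pairwise fun v w => B v w = c) :
    wick B hB (l.map (ExteriorAlgebra.ι ℂ)).prod = c ^ n := by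
  induction n generalizing l with
  | zero =>
    obtain rfl : l = [] := List.length_eq_zero_iff.mp (by omega)
    simp [wick_one]
  | succ n ih =>
    match l, hl with
    | v :: w :: l, hl =>
      simp only [List.pairwise_cons, List.mem_cons] at h
      have h1 : ctr (B v) (l.map (ExteriorAlgebra.ι ℂ)).prod =
          ctr (B w) (l.map (ExteriorAlgebra.ι ℂ)).prod :=
        ctr_list_prod_congr _ _ _ fun x hx => by rw [h.1 x (Or.inr hx), h.2.1 x hx]
      simp only [List.map_cons, List.prod_cons]
      -- The contractions with `v` and with `w` of the remaining factors agree, so that only the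
      -- pairing of `v` with `w` survives.
      rw [wick_ι_mul, ctr_ι_mul, map_sub, h1, wick_ι_mul, ctr_ctr_self, map_zero, sub_zero,
        map_smul, h.1 w (Or.inl rfl), ih l (by simp at hl; omega) h.2.2, smul_eq_mul, pow_succ']

end Wick

/-! ### Wick's theorem: the Pfaffian as a sum over permutations -/

namespace Wick

variable {E : Type*} [AddCommGroup E] [Module ℂ E]

/-- The product `B(v₀, v₁) B(v₂, v₃) ⋯` over consecutive pairs. -/
def pairing (B : LinearMap.BilinForm ℂ E) : (k : ℕ) → (Fin k → E) → ℂ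
  | 0, _ => 1
  | 1, _ => 1
  | k + 2, v => B (v 0) (v 1) * pairing B k fun i => v i.succ.succ

theorem pairing_eq_prod (B : LinearMap.BilinForm ℂ E) (n : ℕ) {k : ℕ} (hk : k = n * 2)
    (v : Fin k → E) :
    pairing B k v = ∏ i : Fin n, B (v ⟨2 * i, by omega⟩) (v ⟨2 * i + 1, by omega⟩) := by
  induction n generalizing k with
  | zero =>
    obtain rfl : k = 0 := by omega
    simp [pairing]
  | succ n ih =>
    obtain ⟨k, rfl⟩ : ∃ k', k = k' + 2 := ⟨n * 2, by omega⟩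
    rw [pairing, ih (by omega), Fin.prod_univ_succ]
    congr 1

theorem ctr_ιMulti (d : Module.Dual ℂ E) (k : ℕ) (v : Fin (k + 1) → E) :
    ctr d (ExteriorAlgebra.ιMulti ℂ (k + 1) v) =
      ∑ j : Fin (k + 1), ((-1 : ℂ) ^ (j : ℕ) * d (v j)) •
        ExteriorAlgebra.ιMulti ℂ k fun i => v (j.succAbove i) := by
  induction k with
  | zero =>
    have := ctr_ι_mul d (v 0) 1
    rw [mul_one, ctr_one, mul_zero, sub_zero] at this
    simp [ExteriorAlgebra.ιMulti_succ_apply, this]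
  | succ k ih =>
    rw [ExteriorAlgebra.ιMulti_succ_apply, ctr_ι_mul, Fin.sum_univ_succ]
    have := ih (Matrix.vecTail v)
    rw [this, Finset.mul_sum, sub_eq_add_neg, ← Finset.sum_neg_distrib]
    congr 1
    · simp [Matrix.vecTail, Function.comp_def]
    · refine Finset.sum_congr rfl fun j _ => ?_
      rw [ExteriorAlgebra.ιMulti_succ_apply, mul_smul_comm, ← neg_smul]
      simp [Matrix.vecTail, Function.comp_def, pow_succ]

/-- The permutation of `Fin (k + 2)` that fixes `0`, sends `1` to `j + 1` and is increasing on the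
other elements. -/
def moveToFront {k : ℕ} (j : Fin (k + 1)) : Equiv.Perm (Fin (k + 2)) :=
  Equiv.Perm.decomposeFin.symm (0, j.cycleRange.symm)

theorem moveToFront_zero {k : ℕ} (j : Fin (k + 1)) : moveToFront j 0 = 0 := by
  simp [moveToFront]

theorem moveToFront_one {k : ℕ} (j : Fin (k + 1)) : moveToFront j 1 = j.succ := by
  have := Equiv.Perm.decomposeFin_symm_apply_succ j.cycleRange.symm 0 0
  rw [Fin.cycleRange_symm_zero, Equiv.swap_self] at this
  exact this

theorem moveToFront_succ {k : ℕ} (j : Fin (k + 1)) (i : Fin k) :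
    moveToFront j i.succ.succ = (j.succAbove i).succ := by
  have := Equiv.Perm.decomposeFin_symm_apply_succ j.cycleRange.symm 0 i.succ
  rw [Fin.cycleRange_symm_succ, Equiv.swap_self] at this
  exact this

theorem sign_moveToFront {k : ℕ} (j : Fin (k + 1)) :
    Equiv.Perm.sign (moveToFront j) = (-1) ^ (j : ℕ) := by
  simp [moveToFront]

/-- A permutation of `Fin k`, acting on the last `k` elements of `Fin (k + 2)`. -/
def shift₂ {k : ℕ} (π : Equiv.Perm (Fin k)) : Equiv.Perm (Fin (k + 2)) :=
  Equiv.Perm.decomposeFin.symm (0, Equiv.Perm.decomposeFin.symm (0, π))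

theorem shift₂_zero {k : ℕ} (π : Equiv.Perm (Fin k)) : shift₂ π 0 = 0 := by
  simp [shift₂]

theorem shift₂_one {k : ℕ} (π : Equiv.Perm (Fin k)) : shift₂ π 1 = 1 := by
  have := Equiv.Perm.decomposeFin_symm_apply_succ (Equiv.Perm.decomposeFin.symm (0, π)) 0 0
  rw [Equiv.swap_self] at this
  refine this.trans ?_
  simp

theorem shift₂_succ {k : ℕ} (π : Equiv.Perm (Fin k)) (i : Fin k) :
    shift₂ π i.succ.succ = (π i).succ.succ := by
  have := Equiv.Perm.decomposeFin_symm_apply_succ (Equiv.Perm.decomposeFin.symm (0, π)) 0 i.succ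
  have h := Equiv.Perm.decomposeFin_symm_apply_succ π 0 i
  rw [Equiv.swap_self] at this h
  exact this.trans (congrArg Fin.succ h)

theorem sign_shift₂ {k : ℕ} (π : Equiv.Perm (Fin k)) :
    Equiv.Perm.sign (shift₂ π) = Equiv.Perm.sign π := by
  simp [shift₂]

theorem sum_sign_mul {k : ℕ} (τ : Equiv.Perm (Fin k)) (f : Equiv.Perm (Fin k) → ℂ) :
    ∑ σ, ((Equiv.Perm.sign σ : ℤ) : ℂ) * f (σ * τ) =
      ((Equiv.Perm.sign τ : ℤ) : ℂ) * ∑ σ, ((Equiv.Perm.sign σ : ℤ) : ℂ) * f σ := by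
  rw [← Equiv.sum_comp (Equiv.mulRight τ) fun σ => ((Equiv.Perm.sign σ : ℤ) : ℂ) * f σ,
    Finset.mul_sum]
  refine Finset.sum_congr rfl fun σ _ => ?_
  have : ((Equiv.Perm.sign τ : ℤ) : ℂ) * ((Equiv.Perm.sign τ : ℤ) : ℂ) = 1 := by
    rcases Int.units_eq_one_or (Equiv.Perm.sign τ) with h | h <;> simp [h]
  simp only [Equiv.coe_mulRight, Equiv.Perm.sign_mul, Units.val_mul, Int.cast_mul]
  linear_combination (-((Equiv.Perm.sign σ : ℤ) : ℂ) * f (σ * τ)) * this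

theorem sum_sign_alternating {k : ℕ} (f : E [⋀^Fin k]→ₗ[ℂ] ℂ) (v : Fin k → E) :
    ∑ σ : Equiv.Perm (Fin k), ((Equiv.Perm.sign σ : ℤ) : ℂ) * f (v ∘ σ) = k ! * f v := by
  have : ∀ σ : Equiv.Perm (Fin k), ((Equiv.Perm.sign σ : ℤ) : ℂ) * f (v ∘ σ) = f v := by
    intro σ
    rw [f.map_perm]
    rcases Int.units_eq_one_or (Equiv.Perm.sign σ) with h | h <;> simp [h]
  simp [this, Fintype.card_perm]

variable {B : LinearMap.BilinForm ℂ E}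

/-- A functional `ψ` that obeys the row expansion for the vectors `v i` is, on their product, the
signed sum over all permutations of the products over consecutive pairs, up to the number of
permutations that give the same term. -/
theorem factorial_mul_wick (n : ℕ) {k : ℕ} (hk : k = n * 2) (ψ : ExteriorAlgebra ℂ E →ₗ[ℂ] ℂ)
    (v : Fin k → E) (hψ : ∀ i x, ψ (ExteriorAlgebra.ι ℂ (v i) * x) = ψ (ctr (B (v i)) x)) :
    (2 ^ n * n ! : ℂ) * ψ (ExteriorAlgebra.ιMulti ℂ k v) =
      (∑ σ : Equiv.Perm (Fin k), ((Equiv.Perm.sign σ : ℤ) : ℂ) * pairing B k (v ∘ σ)) * ψ 1 := by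
  induction n generalizing k with
  | zero =>
    obtain rfl : k = 0 := by omega
    simp [pairing]
  | succ n ih =>
    obtain ⟨k, rfl⟩ : ∃ k', k = k' + 2 := ⟨n * 2, by omega⟩
    have hk' : k = n * 2 := by omega
    -- The sum over all permutations of the first pairing times the value on the other vectors.
    set T : ℂ := ∑ σ : Equiv.Perm (Fin (k + 2)), ((Equiv.Perm.sign σ : ℤ) : ℂ) *
      (B (v (σ 0)) (v (σ 1)) * ψ (ExteriorAlgebra.ιMulti ℂ k fun i => v (σ i.succ.succ))) with hT
    have h1 : ((k + 2)! : ℂ) * ψ (ExteriorAlgebra.ιMulti ℂ (k + 2) v) = (k + 1 : ℕ) * T := by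
      have := sum_sign_alternating (ψ.compAlternatingMap (ExteriorAlgebra.ιMulti ℂ (k + 2))) v
      simp only [LinearMap.compAlternatingMap_apply] at this
      rw [← this]
      have expand : ∀ σ : Equiv.Perm (Fin (k + 2)),
          ψ (ExteriorAlgebra.ιMulti ℂ (k + 2) (v ∘ σ)) = ∑ j : Fin (k + 1), (-1 : ℂ) ^ (j : ℕ) *
            (B (v ((σ * moveToFront j) 0)) (v ((σ * moveToFront j) 1)) *
              ψ (ExteriorAlgebra.ιMulti ℂ k fun i => v ((σ * moveToFront j) i.succ.succ))) := by
        intro σ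
        rw [ExteriorAlgebra.ιMulti_succ_apply, Function.comp_apply, hψ, ctr_ιMulti, map_sum]
        refine Finset.sum_congr rfl fun j _ => ?_
        rw [map_smul, smul_eq_mul]
        simp only [Equiv.Perm.mul_apply, moveToFront_zero, moveToFront_one, moveToFront_succ,
          Matrix.vecTail, Function.comp_apply, mul_assoc]
      simp only [expand, Finset.mul_sum]
      rw [Finset.sum_comm]
      have : ∀ j : Fin (k + 1), ∑ σ : Equiv.Perm (Fin (k + 2)), ((Equiv.Perm.sign σ : ℤ) : ℂ) *
          ((-1 : ℂ) ^ (j : ℕ) *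
            (B (v ((σ * moveToFront j) 0)) (v ((σ * moveToFront j) 1)) *
              ψ (ExteriorAlgebra.ιMulti ℂ k fun i => v ((σ * moveToFront j) i.succ.succ)))) = T := by
        intro j
        have h := sum_sign_mul (moveToFront j) fun σ => (-1 : ℂ) ^ (j : ℕ) *
          (B (v (σ 0)) (v (σ 1)) * ψ (ExteriorAlgebra.ιMulti ℂ k fun i => v (σ i.succ.succ)))
        rw [h, sign_moveToFront, hT, Finset.mul_sum]
        refine Finset.sum_congr rfl fun σ _ => ?_
        have h2 : ((-1 : ℂ) ^ (j : ℕ)) * (-1) ^ (j : ℕ) = 1 := by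
          rw [← mul_pow]; simp
        push_cast
        linear_combination (((Equiv.Perm.sign σ : ℤ) : ℂ) *
          (B (v (σ 0)) (v (σ 1)) * ψ (ExteriorAlgebra.ιMulti ℂ k fun i => v (σ i.succ.succ)))) * h2
      rw [Finset.sum_congr rfl fun j _ => this j]
      simp
    have h2 : (2 ^ n * n ! : ℂ) * T = (k ! : ℂ) * ((∑ σ : Equiv.Perm (Fin (k + 2)),
        ((Equiv.Perm.sign σ : ℤ) : ℂ) * pairing B (k + 2) (v ∘ σ)) * ψ 1) := by
      rw [hT, Finset.mul_sum]
      have expand : ∀ σ : Equiv.Perm (Fin (k + 2)), (2 ^ n * n ! : ℂ) *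
          (((Equiv.Perm.sign σ : ℤ) : ℂ) * (B (v (σ 0)) (v (σ 1)) *
            ψ (ExteriorAlgebra.ιMulti ℂ k fun i => v (σ i.succ.succ)))) =
          ∑ π : Equiv.Perm (Fin k), ((Equiv.Perm.sign π : ℤ) : ℂ) * ψ 1 *
            (((Equiv.Perm.sign σ : ℤ) : ℂ) * pairing B (k + 2) (v ∘ ⇑(σ * shift₂ π))) := by
        intro σ
        have := ih hk' (fun i => v (σ i.succ.succ)) fun i x => hψ _ x
        rw [mul_left_comm, mul_left_comm _ (B _ _), this, Finset.sum_mul, Finset.mul_sum,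
          Finset.mul_sum]
        refine Finset.sum_congr rfl fun π _ => ?_
        simp only [pairing, Function.comp_apply, Equiv.Perm.mul_apply, shift₂_zero, shift₂_one,
          shift₂_succ, Function.comp_def]
        ring
      simp only [expand]
      rw [Finset.sum_comm]
      have : ∀ π : Equiv.Perm (Fin k), ∑ σ : Equiv.Perm (Fin (k + 2)),
          ((Equiv.Perm.sign π : ℤ) : ℂ) * ψ 1 *
            (((Equiv.Perm.sign σ : ℤ) : ℂ) * pairing B (k + 2) (v ∘ ⇑(σ * shift₂ π))) =
          (∑ σ : Equiv.Perm (Fin (k + 2)),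
            ((Equiv.Perm.sign σ : ℤ) : ℂ) * pairing B (k + 2) (v ∘ σ)) * ψ 1 := by
        intro π
        have h := sum_sign_mul (shift₂ π) fun σ => pairing B (k + 2) (v ∘ σ)
        rw [← Finset.mul_sum, h, sign_shift₂]
        have h2 : ((Equiv.Perm.sign π : ℤ) : ℂ) * ((Equiv.Perm.sign π : ℤ) : ℂ) = 1 := by
          rcases Int.units_eq_one_or (Equiv.Perm.sign π) with h | h <;> simp [h]
        linear_combination (ψ 1 * ∑ σ : Equiv.Perm (Fin (k + 2)),
            ((Equiv.Perm.sign σ : ℤ) : ℂ) * pairing B (k + 2) (v ∘ σ)) * h2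
      rw [Finset.sum_congr rfl fun π _ => this π]
      simp [Fintype.card_perm]
    have hfac : (k ! : ℂ) ≠ 0 := by exact_mod_cast k.factorial_ne_zero
    have h3 : ((k + 2)! : ℂ) = (k + 2) * (k + 1) * k ! := by
      rw [Nat.factorial_succ, Nat.factorial_succ]; push_cast; ring
    have h4 : (k : ℂ) = n * 2 := by exact_mod_cast hk'
    have h5 : ((n + 1)! : ℂ) = (n + 1) * n ! := by
      rw [Nat.factorial_succ]; push_cast; ring
    have hk1 : ((k : ℂ) + 1) ≠ 0 := by exact_mod_cast k.succ_ne_zero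
    apply mul_left_cancel₀ (mul_ne_zero hfac hk1)
    rw [h3] at h1
    push_cast at h1
    rw [h5, pow_succ]
    linear_combination (2 ^ n * (n ! : ℂ)) * h1 + ((k : ℂ) + 1) * h2 -
      (2 ^ n * (n ! : ℂ) * (k ! : ℂ) * ((k : ℂ) + 1) *
        ψ (ExteriorAlgebra.ιMulti ℂ (k + 2) v)) * h4

/-- **Wick's theorem**: a functional that obeys the row expansion for the vectors `v i` is, on
their product, the Pfaffian of their Gram matrix. -/
theorem wick_eq_pfaffian (n : ℕ) (ψ : ExteriorAlgebra ℂ E →ₗ[ℂ] ℂ) (v : Fin (n * 2) → E)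
    (hψ : ∀ i x, ψ (ExteriorAlgebra.ι ℂ (v i) * x) = ψ (ctr (B (v i)) x)) :
    ψ (ExteriorAlgebra.ιMulti ℂ (n * 2) v) =
      pfaffian (Matrix.of fun i j => B (v i) (v j)) * ψ 1 := by
  have h := factorial_mul_wick n rfl ψ v hψ
  have h0 : (2 ^ n * n ! : ℂ) ≠ 0 :=
    mul_ne_zero (pow_ne_zero _ two_ne_zero) (by exact_mod_cast n.factorial_ne_zero)
  have h1 : ∀ σ : Equiv.Perm (Fin (n * 2)), pairing B (n * 2) (v ∘ σ) =
      ∏ i : Fin n, B (v (σ (finProdFinEquiv (i, 0)))) (v (σ (finProdFinEquiv (i, 1)))) := by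
    intro σ
    rw [pairing_eq_prod B n rfl]
    refine Finset.prod_congr rfl fun i _ => ?_
    have h2 : (⟨2 * i, by omega⟩ : Fin (n * 2)) = finProdFinEquiv (i, 0) := Fin.ext (by simp)
    have h3 : (⟨2 * i + 1, by omega⟩ : Fin (n * 2)) = finProdFinEquiv (i, 1) :=
      Fin.ext (by simp [add_comm])
    rw [Function.comp_apply, Function.comp_apply, h2, h3]
  simp only [h1] at h
  rw [pfaffian, one_div, mul_assoc, eq_inv_mul_iff_mul_eq₀ h0]
  exact h

end Wick

/-! ### The space of generators and its alternating form -/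

noncomputable section

namespace Fock

open Wick

/-- The space of generators: the row space of the matrix `W`, the dual of the space of
polynomials, and one further generator for each real point. -/
abbrev Space (N : ℕ) := (Fin N ⊕ Unit → ℂ) × (Fin N → ℂ) × (ℝ →₀ ℂ)

variable {N : ℕ}

/-- The embedding of the row space of `W`. -/
def row : (Fin N ⊕ Unit → ℂ) →ₗ[ℂ] Space N := LinearMap.inl ℂ _ _

/-- The embedding of the space of values of polynomials. -/
def val : (Fin N → ℂ) →ₗ[ℂ] Space N := LinearMap.inr ℂ _ _ ∘ₗ LinearMap.inl ℂ _ _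

/-- The generator that belongs to the real point `t`. -/
def pt (t : ℝ) : Space N := (0, 0, Finsupp.single t 1)

/-- The linear form on the row space that is given by `κ` and the value `1` on the last row. -/
def rowForm (κ : Fin N → ℂ) : (Fin N ⊕ Unit → ℂ) →ₗ[ℂ] ℂ :=
  ∑ j, κ j • LinearMap.proj (Sum.inl j) + LinearMap.proj (Sum.inr ())

theorem rowForm_apply (κ : Fin N → ℂ) (a : Fin N ⊕ Unit → ℂ) :
    rowForm κ a = ∑ j, κ j * a (Sum.inl j) + a (Sum.inr ()) := by
  simp [rowForm]

/-- The pairing of the generators of real points by the sign of their difference. -/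
def signForm : (ℝ →₀ ℂ) →ₗ[ℂ] (ℝ →₀ ℂ) →ₗ[ℂ] ℂ :=
  Finsupp.linearCombination ℂ fun x => Finsupp.linearCombination ℂ fun y : ℝ =>
    ((1 / 4 : ℂ) * (Real.sign (y - x) : ℂ))

theorem signForm_flip (s t : ℝ →₀ ℂ) : signForm s t = -signForm t s := by
  induction s using Finsupp.induction_linear with
  | zero => simp
  | add s s' hs hs' => simp only [map_add, LinearMap.add_apply, hs, hs', neg_add]
  | single x c =>
    induction t using Finsupp.induction_linear with
    | zero => simp
    | add t t' ht ht' => simp only [map_add, LinearMap.add_apply, ht, ht', neg_add]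
    | single y d =>
      have : Real.sign (y - x) = -Real.sign (x - y) := by rw [← Real.sign_neg, neg_sub]
      simp only [signForm, Finsupp.linearCombination_single, LinearMap.smul_apply, smul_eq_mul,
        this]
      push_cast
      ring

variable (A : Matrix (Fin N ⊕ Unit) (Fin N ⊕ Unit) ℂ) (κ : ℝ → Fin N → ℂ)

/-- The bilinear form whose antisymmetrization is `Fock.form`. -/
def halfForm : LinearMap.BilinForm ℂ (Space N) :=
  ((1 / 2 : ℂ) • Matrix.toLinearMap₂' ℂ A).compl₁₂ (LinearMap.fst ℂ _ _) (LinearMap.fst ℂ _ _) +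
  (∑ j : Fin N, (LinearMap.proj (Sum.inl j) : (Fin N ⊕ Unit → ℂ) →ₗ[ℂ] ℂ).smulRight
    (LinearMap.proj j : (Fin N → ℂ) →ₗ[ℂ] ℂ)).compl₁₂
    (LinearMap.fst ℂ _ _) (LinearMap.fst ℂ _ _ ∘ₗ LinearMap.snd ℂ _ _) +
  ((Finsupp.linearCombination ℂ fun x => rowForm (κ x)).compl₁₂
    (LinearMap.snd ℂ _ _ ∘ₗ LinearMap.snd ℂ _ _) (LinearMap.fst ℂ _ _)).flip +
  signForm.compl₁₂ (LinearMap.snd ℂ _ _ ∘ₗ LinearMap.snd ℂ _ _)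
    (LinearMap.snd ℂ _ _ ∘ₗ LinearMap.snd ℂ _ _)

theorem halfForm_apply (v v' : Space N) :
    halfForm A κ v v' = 1 / 2 * (v.1 ⬝ᵥ A *ᵥ v'.1) + ∑ j, v.1 (Sum.inl j) * v'.2.1 j +
      Finsupp.linearCombination ℂ (fun x => rowForm (κ x)) v'.2.2 v.1 +
      signForm v.2.2 v'.2.2 := by
  simp [halfForm, Matrix.toLinearMap₂'_apply']

/-- The alternating form on the space of generators: `A` on the row space, the evaluation pairing
between rows and values, the form `κ x` between the rows and the generator of `x`, and half the
sign of the difference on generators of real points. -/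
def form : LinearMap.BilinForm ℂ (Space N) := halfForm A κ - (halfForm A κ).flip

theorem form_isAlt : (form A κ).IsAlt := fun v => by
  simp [form]

theorem form_apply (v v' : Space N) :
    form A κ v v' = halfForm A κ v v' - halfForm A κ v' v := rfl

theorem form_val (c : Fin N → ℂ) (v : Space N) :
    form A κ (val c) v = -∑ j, c j * v.1 (Sum.inl j) := by
  simp [form_apply, halfForm_apply, val, mul_comm]

theorem form_val_val (c d : Fin N → ℂ) : form A κ (val c) (val d) = 0 := by
  rw [form_val]; simp [val]

theorem form_val_pt (c : Fin N → ℂ) (t : ℝ) : form A κ (val c) (pt t) = 0 := by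
  rw [form_val]; simp [pt]

theorem form_pt (t : ℝ) (v : Space N) :
    form A κ (pt t) v = -rowForm (κ t) v.1 +
      Finsupp.linearCombination ℂ (fun y : ℝ => (1 / 2 * Real.sign (y - t) : ℂ)) v.2.2 := by
  have h1 : signForm (Finsupp.single t 1) v.2.2 - signForm v.2.2 (Finsupp.single t 1) =
      Finsupp.linearCombination ℂ (fun y : ℝ => (1 / 2 * Real.sign (y - t) : ℂ)) v.2.2 := by
    rw [signForm_flip v.2.2, sub_neg_eq_add]
    simp only [signForm, Finsupp.linearCombination_single, one_smul]
    rw [Finsupp.linearCombination_apply, Finsupp.linearCombination_apply, ← Finsupp.sum_add]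
    refine Finsupp.sum_congr fun x _ => ?_
    simp only [smul_eq_mul]
    ring
  rw [← h1]
  simp [form_apply, halfForm_apply, pt]
  ring

theorem form_row (hA : Aᵀ = -A) (a : Fin N ⊕ Unit → ℂ) (v : Space N) :
    form A κ (row a) v = a ⬝ᵥ A *ᵥ v.1 + ∑ j, a (Sum.inl j) * v.2.1 j +
      Finsupp.linearCombination ℂ (fun x => rowForm (κ x)) v.2.2 a := by
  have : v.1 ⬝ᵥ A *ᵥ a = -(a ⬝ᵥ A *ᵥ v.1) := by
    rw [Matrix.dotProduct_mulVec, dotProduct_comm, ← Matrix.mulVec_transpose, hA, Matrix.neg_mulVec,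
      dotProduct_neg]
  simp [form_apply, halfForm_apply, row, this]
  ring

variable (P : ℂ → Fin N → ℂ)

/-- The phase of `conj z - z`. -/
def phase (z : ℂ) : ℂ := -Complex.I * (Real.sign z.im : ℂ)

/-- The element of the exterior algebra that belongs to the real point `t`. -/
def realPair (t : ℝ) : ExteriorAlgebra ℂ (Space N) :=
  ExteriorAlgebra.ι ℂ (val (P t)) * ExteriorAlgebra.ι ℂ (pt t)

/-- The element of the exterior algebra that belongs to the pair of points `z`, `conj z`. -/
def complexPair (z : ℂ) : ExteriorAlgebra ℂ (Space N) :=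
  ExteriorAlgebra.ι ℂ (val (P z)) * ExteriorAlgebra.ι ℂ (val (phase z • P (conj z)))

/-- The product of the basis vectors of the row space. -/
def top (N : ℕ) : ExteriorAlgebra ℂ (Space N) :=
  ((List.finRange N).map fun j => ExteriorAlgebra.ι ℂ (row (Pi.single (Sum.inl j) 1))).prod *
    ExteriorAlgebra.ι ℂ (row (Pi.single (Sum.inr ()) 1))

/-- The unnormalized correlation of the real points `xs` and of the complex points `zs`. -/
def corr (xs : List ℝ) (zs : List ℂ) : ℂ :=
  wick (form A κ) (form_isAlt A κ)
    ((xs.map (realPair P)).prod * (zs.map (complexPair P)).prod * top N)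

theorem ι_mul_ι_comm {E : Type*} [AddCommGroup E] [Module ℂ E] (u v : E) :
    ExteriorAlgebra.ι ℂ u * ExteriorAlgebra.ι ℂ v =
      -(ExteriorAlgebra.ι ℂ v * ExteriorAlgebra.ι ℂ u) :=
  eq_neg_of_add_eq_zero_left (ExteriorAlgebra.ι_add_mul_swap (R := ℂ) u v)

theorem ι_mul_ι_mul_comm {E : Type*} [AddCommGroup E] [Module ℂ E] (u v : E)
    (x : ExteriorAlgebra ℂ E) :
    ExteriorAlgebra.ι ℂ u * ExteriorAlgebra.ι ℂ v * x =
      x * (ExteriorAlgebra.ι ℂ u * ExteriorAlgebra.ι ℂ v) := by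
  induction x using Wick.left_induction with
  | one => simp
  | add x y hx hy => rw [mul_add, add_mul, hx, hy]
  | smul r x hx => rw [mul_smul_comm, smul_mul_assoc, hx]
  | ι_mul w x hx =>
    rw [mul_assoc (ExteriorAlgebra.ι ℂ w), ← hx]
    simp only [← mul_assoc]
    congr 1
    rw [mul_assoc, ι_mul_ι_comm v w, mul_neg, ← mul_assoc, ι_mul_ι_comm u w]
    simp

theorem realPair_comm (t : ℝ) (x : ExteriorAlgebra ℂ (Space N)) :
    realPair P t * x = x * realPair P t := ι_mul_ι_mul_comm _ _ _

theorem complexPair_comm (z : ℂ) (x : ExteriorAlgebra ℂ (Space N)) :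
    complexPair P z * x = x * complexPair P z := ι_mul_ι_mul_comm _ _ _

theorem complexPair_prod_comm (zs : List ℂ) (x : ExteriorAlgebra ℂ (Space N)) :
    (zs.map (complexPair P)).prod * x = x * (zs.map (complexPair P)).prod := by
  induction zs with
  | nil => simp
  | cons z zs ih =>
    rw [List.map_cons, List.prod_cons, mul_assoc, ih, ← mul_assoc, complexPair_comm, mul_assoc]

/-- The correlation does not depend on the order of the real points. -/
theorem corr_perm {xs xs' : List ℝ} (h : xs.Perm xs') (zs : List ℂ) :
    corr A κ P xs zs = corr A κ P xs' zs := by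
  have : (xs.map (realPair P)).prod = (xs'.map (realPair P)).prod := by
    refine (h.map _).prod_eq' ?_
    refine List.pairwise_of_forall_mem_list fun a ha b _ => ?_
    obtain ⟨t, _, rfl⟩ := List.mem_map.mp ha
    exact realPair_comm P t b
  rw [corr, corr, this]

end Fock

end

/-! ### Correlations of a full set of points -/

noncomputable section

namespace Fock

open Wick

theorem ι_mul_list_prod {E : Type*} [AddCommGroup E] [Module ℂ E] (v : E) (l : List E) :
    ExteriorAlgebra.ι ℂ v * (l.map (ExteriorAlgebra.ι ℂ)).prod =
      (-1 : ℂ) ^ l.length • ((l.map (ExteriorAlgebra.ι ℂ)).prod * ExteriorAlgebra.ι ℂ v) := by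
  induction l with
  | nil => simp
  | cons w l ih =>
    rw [List.map_cons, List.prod_cons, ← mul_assoc, ι_mul_ι_comm, neg_mul, mul_assoc, ih,
      mul_smul_comm, List.length_cons, pow_succ, mul_assoc]
    simp

/-- The sign of the reversal of `n` elements. -/
def revSign (n : ℕ) : ℂ := (-1) ^ n.choose 2

theorem revSign_succ (n : ℕ) : revSign (n + 1) = (-1) ^ n * revSign n := by
  rw [revSign, revSign, Nat.choose_succ_succ' n 1, Nat.choose_one_right, pow_add]

variable {N : ℕ} (A : Matrix (Fin N ⊕ Unit) (Fin N ⊕ Unit) ℂ) (κ : ℝ → Fin N → ℂ)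
  (P : ℂ → Fin N → ℂ)

/-- The list of the real points `xs` and of the complex points `zs` with their conjugates. -/
def points (xs : List ℝ) (zs : List ℂ) : List ℂ :=
  xs.map Complex.ofReal ++ zs.flatMap fun z => [z, conj z]

theorem length_points (xs : List ℝ) (zs : List ℂ) :
    (points xs zs).length = xs.length + 2 * zs.length := by
  simp [points, List.length_flatMap, mul_comm]

theorem realPair_prod (xs : List ℝ) :
    (xs.map (realPair P)).prod = revSign xs.length •
      ((xs.map fun x : ℝ => ExteriorAlgebra.ι ℂ (val (P x))).prod *
        (xs.map fun x => ExteriorAlgebra.ι ℂ (pt (N := N) x)).prod) := by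
  induction xs with
  | nil => simp [revSign]
  | cons x xs ih =>
    have h := ι_mul_list_prod (pt (N := N) x) (xs.map fun x : ℝ => val (P x))
    rw [List.map_map, List.length_map] at h
    change _ * (xs.map fun x : ℝ => ExteriorAlgebra.ι ℂ (val (P x))).prod =
      _ • ((xs.map fun x : ℝ => ExteriorAlgebra.ι ℂ (val (P x))).prod * _) at h
    simp only [List.map_cons, List.prod_cons, List.length_cons]
    rw [ih, realPair, mul_smul_comm, mul_assoc, ← mul_assoc (ExteriorAlgebra.ι ℂ (pt x)), h,
      revSign_succ, smul_mul_assoc, mul_smul_comm, smul_smul, mul_comm (revSign _)]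
    simp only [mul_assoc]

theorem complexPair_prod (zs : List ℂ) :
    (zs.map (complexPair P)).prod = (zs.map phase).prod •
      ((zs.flatMap fun z => [z, conj z]).map fun z => ExteriorAlgebra.ι ℂ (val (P z))).prod := by
  induction zs with
  | nil => simp
  | cons z zs ih =>
    simp only [List.map_cons, List.prod_cons, List.flatMap_cons, List.map_append, List.prod_append,
      ih, complexPair, map_smul, List.map_nil, List.prod_nil, mul_one, mul_smul_comm, smul_mul_assoc,
      smul_smul]
    rw [mul_comm]

theorem corr_eq (xs : List ℝ) (zs : List ℂ) :
    corr A κ P xs zs = revSign xs.length * (zs.map phase).prod *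
      wick (form A κ) (form_isAlt A κ)
        (((points xs zs).map fun z => ExteriorAlgebra.ι ℂ (val (P z))).prod *
          ((xs.map fun x => ExteriorAlgebra.ι ℂ (pt (N := N) x)).prod * top N)) := by
  rw [corr, realPair_prod, smul_mul_assoc, mul_assoc _ _ (zs.map (complexPair P)).prod,
    ← complexPair_prod_comm, complexPair_prod]
  simp only [smul_mul_assoc, mul_smul_comm, map_smul, smul_eq_mul, points, List.map_append,
    List.prod_append, List.map_map, Function.comp_def, mul_assoc]

/-- The value of the Wick functional on a product with `n` factors from the space of values, as an
alternating map. -/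
def valAlt (n : ℕ) (y : ExteriorAlgebra ℂ (Space N)) : (Fin N → ℂ) [⋀^Fin n]→ₗ[ℂ] ℂ :=
  ((wick (form A κ) (form_isAlt A κ) ∘ₗ LinearMap.mulRight ℂ y).compAlternatingMap
    (ExteriorAlgebra.ιMulti ℂ n)).compLinearMap val

theorem valAlt_apply (n : ℕ) (y : ExteriorAlgebra ℂ (Space N)) (v : Fin n → Fin N → ℂ) :
    valAlt A κ n y v = wick (form A κ) (form_isAlt A κ)
      ((List.ofFn fun i => ExteriorAlgebra.ι ℂ (val (v i))).prod * y) := by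
  simp [valAlt, ExteriorAlgebra.ιMulti_apply]

/-- More than `N` evaluations at points are linearly dependent. -/
theorem wick_points_eq_zero (l : List ℂ) (hl : N < l.length) (y : ExteriorAlgebra ℂ (Space N)) :
    wick (form A κ) (form_isAlt A κ)
      ((l.map fun z => ExteriorAlgebra.ι ℂ (val (P z))).prod * y) = 0 := by
  have h := (valAlt A κ l.length y).map_linearDependent (fun i => P (l.get i)) fun h => by
    have := h.fintype_card_le_finrank
    simp at this
    omega
  rw [valAlt_apply] at h
  rw [← h]
  congr 3
  rw [← List.ofFn_get l, List.map_ofFn]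
  simp [Function.comp_def]

/-- The correlation of more than `N` points vanishes. -/
theorem corr_eq_zero (xs : List ℝ) (zs : List ℂ) (h : N < xs.length + 2 * zs.length) :
    corr A κ P xs zs = 0 := by
  rw [corr_eq, wick_points_eq_zero A κ P _ (by rw [length_points]; exact h), mul_zero]

theorem wick_points_eq_det {n : ℕ} (hn : n = N) (γ : Fin n → ℂ)
    (y : ExteriorAlgebra ℂ (Space N)) :
    wick (form A κ) (form_isAlt A κ)
      (((List.ofFn γ).map fun z => ExteriorAlgebra.ι ℂ (val (P z))).prod * y) =
    (Matrix.of fun i j : Fin N => P (γ (Fin.cast hn.symm i)) j).det *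
      wick (form A κ) (form_isAlt A κ)
        (((List.finRange N).map fun j =>
          ExteriorAlgebra.ι ℂ (val (Pi.single j (1 : ℂ) : Fin N → ℂ))).prod * y) := by
  subst hn
  have h := congrArg (fun f => f fun i => P (γ i))
    ((valAlt A κ n y).eq_smul_basis_det (Pi.basisFun ℂ (Fin n)))
  simp only [AlternatingMap.smul_apply, valAlt_apply, Pi.basisFun_det_apply, smul_eq_mul,
    Pi.basisFun_apply] at h
  rw [List.map_ofFn, ← List.ofFn_eq_map]
  refine h.trans ?_
  rw [mul_comm]
  rfl

/-- Successive contraction with the values `us`. -/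
def chain : List (Fin N → ℂ) → ExteriorAlgebra ℂ (Space N) → ExteriorAlgebra ℂ (Space N)
  | [], x => x
  | u :: us, x => chain us (ctr (form A κ (val u)) x)

theorem ctr_val_mul (u : Fin N → ℂ) (us : List (Fin N → ℂ)) (x : ExteriorAlgebra ℂ (Space N)) :
    ctr (form A κ (val u)) ((us.map fun c => ExteriorAlgebra.ι ℂ (val c)).prod * x) =
      (-1 : ℂ) ^ us.length •
        ((us.map fun c => ExteriorAlgebra.ι ℂ (val c)).prod * ctr (form A κ (val u)) x) := by
  induction us with
  | nil => simp
  | cons c us ih =>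
    simp only [List.map_cons, List.prod_cons, mul_assoc, List.length_cons, pow_succ]
    rw [ctr_ι_mul, form_val_val, ih]
    simp

theorem wick_val_prod_mul (us : List (Fin N → ℂ)) (x : ExteriorAlgebra ℂ (Space N)) :
    wick (form A κ) (form_isAlt A κ) ((us.map fun c => ExteriorAlgebra.ι ℂ (val c)).prod * x) =
      revSign us.length * wick (form A κ) (form_isAlt A κ) (chain A κ us x) := by
  induction us generalizing x with
  | nil => simp [revSign, chain]
  | cons c us ih =>
    simp only [List.map_cons, List.prod_cons, mul_assoc, List.length_cons, revSign_succ]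
    rw [wick_ι_mul, ctr_val_mul, map_smul, ih, chain, smul_eq_mul]

theorem chain_smul (us : List (Fin N → ℂ)) (r : ℂ) (x : ExteriorAlgebra ℂ (Space N)) :
    chain A κ us (r • x) = r • chain A κ us x := by
  induction us generalizing x with
  | nil => rfl
  | cons c us ih => rw [chain, map_smul, ih, chain]

theorem chain_pt_mul (us : List (Fin N → ℂ)) (t : ℝ) (x : ExteriorAlgebra ℂ (Space N)) :
    chain A κ us (ExteriorAlgebra.ι ℂ (pt t) * x) =
      (-1 : ℂ) ^ us.length • (ExteriorAlgebra.ι ℂ (pt t) * chain A κ us x) := by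
  induction us generalizing x with
  | nil => simp [chain]
  | cons c us ih =>
    rw [chain, ctr_ι_mul, form_val_pt, zero_smul, zero_sub, ← neg_one_smul ℂ, chain_smul, ih, chain,
      smul_smul, List.length_cons, pow_succ']

theorem chain_pt_prod_mul (us : List (Fin N → ℂ)) (xs : List ℝ)
    (x : ExteriorAlgebra ℂ (Space N)) :
    chain A κ us ((xs.map fun t => ExteriorAlgebra.ι ℂ (pt t)).prod * x) =
      (-1 : ℂ) ^ (us.length * xs.length) •
        ((xs.map fun t => ExteriorAlgebra.ι ℂ (pt t)).prod * chain A κ us x) := by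
  induction xs with
  | nil => simp
  | cons t xs ih =>
    simp only [List.map_cons, List.prod_cons, mul_assoc]
    rw [chain_pt_mul, ih, mul_smul_comm, smul_smul, List.length_cons, Nat.mul_succ, pow_add,
      mul_comm]

/-- Contraction with all evaluations removes all rows but the border. -/
theorem chain_top (js : List (Fin N)) (hjs : js.Nodup) :
    chain A κ (js.map fun j => Pi.single j 1)
      ((js.map fun j => ExteriorAlgebra.ι ℂ (row (Pi.single (Sum.inl j) 1))).prod *
        ExteriorAlgebra.ι ℂ (row (Pi.single (Sum.inr ()) 1))) =
      (-1 : ℂ) ^ js.length • ExteriorAlgebra.ι ℂ (row (Pi.single (Sum.inr ()) 1)) := by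
  induction js with
  | nil => simp [chain]
  | cons j js ih =>
    rw [List.nodup_cons] at hjs
    simp only [List.map_cons, List.prod_cons, mul_assoc, chain]
    have h0 : ctr (form A κ (val (Pi.single j 1)))
        ((js.map fun j => ExteriorAlgebra.ι ℂ (row (Pi.single (Sum.inl j) 1))).prod *
          ExteriorAlgebra.ι ℂ (row (Pi.single (Sum.inr ()) 1))) = 0 := by
      have := ctr_list_prod_eq_zero (form A κ (val (Pi.single j 1)))
        ((js.map fun j => row (Pi.single (Sum.inl j) 1)) ++ [row (Pi.single (Sum.inr ()) 1)])
        fun v hv => by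
          rw [List.mem_append, List.mem_map, List.mem_singleton] at hv
          rcases hv with ⟨i, hi, rfl⟩ | rfl
          · have : j ≠ i := fun h => hjs.1 (h ▸ hi)
            simp [form_val, row, Pi.single_apply, Ne.symm this]
          · simp [form_val, row]
      simpa [Function.comp_def] using this
    have h1 : form A κ (val (Pi.single j 1)) (row (Pi.single (Sum.inl j) 1)) = -1 := by
      simp [form_val, row, Pi.single_apply]
    rw [ctr_ι_mul, h0, h1, mul_zero, sub_zero, chain_smul, ih hjs.2, smul_smul, List.length_cons,
      pow_succ']

/-- The pairing of ordered real points with the border of the matrix. -/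
theorem wick_pt_prod (xs : List ℝ) (hxs : xs.Pairwise (· < ·)) (r : ℕ)
    (hr : xs.length = 2 * r + 1) :
    wick (form A κ) (form_isAlt A κ)
      ((xs.map fun t => ExteriorAlgebra.ι ℂ (pt t)).prod *
        ExteriorAlgebra.ι ℂ (row (Pi.single (Sum.inr ()) 1))) = -2 * (1 / 2) ^ (r + 1) := by
  -- After the last row is divided by `-2`, all pairings of ordered factors are equal to `1 / 2`.
  have h := wick_list_prod_of_pairwise (B := form A κ) (hB := form_isAlt A κ) (1 / 2) (r + 1)
    (xs.map pt ++ [row ((-1 / 2 : ℂ) • Pi.single (Sum.inr ()) 1)]) (by simp [hr]; ring)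
    (by
      rw [List.pairwise_append, List.pairwise_map]
      refine ⟨hxs.imp fun {a b} hab => ?_, List.pairwise_singleton _ _, ?_⟩
      · rw [form_pt]
        simp [pt, rowForm_apply, Real.sign_of_pos (sub_pos.mpr hab)]
      · intro v hv v' hv'
        obtain ⟨t, _, rfl⟩ := List.mem_map.mp hv
        rw [List.mem_singleton.mp hv', form_pt]
        simp [rowForm_apply, row]
        norm_num)
  rw [← h]
  simp only [List.map_append, List.map_map, Function.comp_def, List.map_cons, List.map_nil,
    List.prod_append, List.prod_cons, List.prod_nil, mul_one, map_smul, mul_smul_comm, smul_eq_mul]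
  ring

/-- The correlation of a full set of points, with ordered real points, is a determinant. -/
theorem corr_eq_det (hN : Odd N) (xs : List ℝ) (zs : List ℂ) (hxs : xs.Pairwise (· < ·)) {n : ℕ}
    (hn : n = N) (γ : Fin n → ℂ) (hγ : points xs zs = List.ofFn γ) :
    corr A κ P xs zs = -(-1 / 2) ^ ((N - 1) / 2) * revSign N * (-2) ^ zs.length *
      (zs.map phase).prod * (Matrix.of fun i j : Fin N => P (γ (Fin.cast hn.symm i)) j).det := by
  have hlen : xs.length + 2 * zs.length = N := by
    rw [← length_points, hγ, List.length_ofFn, hn]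
  obtain ⟨r, hr⟩ : ∃ r, xs.length = 2 * r + 1 := by
    obtain ⟨k, hk⟩ := hN
    exact ⟨k - zs.length, by omega⟩
  have h1 := wick_val_prod_mul A κ ((List.finRange N).map fun j => Pi.single j 1)
    ((xs.map fun x => ExteriorAlgebra.ι ℂ (pt (N := N) x)).prod * top N)
  rw [chain_pt_prod_mul, top, chain_top A κ _ (List.nodup_finRange N)] at h1
  simp only [List.map_map, Function.comp_def, List.length_map, List.length_finRange, map_smul,
    mul_smul_comm, smul_eq_mul] at h1
  rw [wick_pt_prod A κ xs hxs r hr, ← mul_assoc ((-1 : ℂ) ^ (N * xs.length)), ← pow_add,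
    Even.neg_one_pow (by
      rw [← Nat.mul_succ, hr]
      exact Even.mul_left ⟨r + 1, by simp; ring⟩ _), one_mul] at h1
  rw [corr_eq, hγ, wick_points_eq_det A κ P hn γ]
  unfold top
  rw [h1]
  have h2 : revSign xs.length = (-1) ^ r := by
    rw [revSign, hr, Nat.choose_two_right]
    have : (2 * r + 1) * (2 * r + 1 - 1) / 2 = r + 2 * (r * r) := by
      rw [Nat.add_sub_cancel]
      apply Nat.div_eq_of_eq_mul_left two_pos
      ring
    rw [this, pow_add, pow_mul]
    simp
  have h3 : (N - 1) / 2 = r + zs.length := by omega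
  have h4 : (-2 : ℂ) ^ zs.length * (-1 / 2) ^ zs.length = 1 := by
    rw [← mul_pow]; norm_num
  have h5 : (-1 / 2 : ℂ) ^ r = (-1) ^ r * (1 / 2) ^ r := by
    rw [← mul_pow]; norm_num
  rw [h2, h3, pow_add (-1 / 2 : ℂ), pow_succ, h5]
  linear_combination (-(-1) ^ r * (1 / 2) ^ r * revSign N * (zs.map phase).prod *
    (Matrix.of fun i j : Fin N => P (γ (Fin.cast hn.symm i)) j).det) * (-h4)

end Fock

end

/-! ### The Vandermonde determinant and the density -/

noncomputable section

namespace Fock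

open Wick RealAsymmetric

/-- The product of the differences of the entries of a list. -/
def vand : List ℂ → ℂ
  | [] => 1
  | x :: l => (l.map fun y => y - x).prod * vand l

theorem det_vandermonde_eq_vand {n : ℕ} (v : Fin n → ℂ) :
    (Matrix.vandermonde v).det = vand (List.ofFn v) := by
  rw [Matrix.det_vandermonde]
  induction n with
  | zero => simp [vand]
  | succ n ih =>
    rw [Fin.prod_univ_succ, List.ofFn_succ, vand, ← ih, Fin.prod_Ioi_zero]
    simp [Fin.prod_Ioi_succ, List.prod_ofFn]

theorem norm_vand_perm {l l' : List ℂ} (h : l.Perm l') : ‖vand l‖ = ‖vand l'‖ := by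
  induction h with
  | nil => rfl
  | cons x h ih => rw [vand, vand, norm_mul, norm_mul, ih, (h.map _).prod_eq]
  | swap x y l =>
    simp only [vand, List.map_cons, List.prod_cons, norm_mul]
    rw [norm_sub_rev x y]
    ring
  | trans _ _ ih ih' => rw [ih, ih']

theorem phase_mul_abs (z : ℂ) : conj z - z = phase z * (|2 * z.im| : ℝ) := by
  rw [phase, abs_mul, abs_two]
  have : (Real.sign z.im : ℂ) * (|z.im| : ℝ) = z.im := by
    rw [← Complex.ofReal_mul]
    congr 1
    rcases lt_trichotomy z.im 0 with h | h | h
    · rw [Real.sign_of_neg h, abs_of_neg h]; ring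
    · simp [h]
    · rw [Real.sign_of_pos h, abs_of_pos h]; ring
  have h2 := Complex.sub_conj z
  push_cast at h2 ⊢
  linear_combination -h2 + (2 * Complex.I) * this

theorem prod_pairs_nonneg (z : ℂ) (zs : List ℂ) :
    ∃ r : ℝ, 0 ≤ r ∧ ((zs.flatMap fun y => [y, conj y]).map fun y => y - z).prod *
      ((zs.flatMap fun y => [y, conj y]).map fun y => y - conj z).prod = r := by
  induction zs with
  | nil => exact ⟨1, zero_le_one, by simp⟩
  | cons y zs ih =>
    obtain ⟨r, hr, h⟩ := ih
    refine ⟨Complex.normSq ((y - z) * (y - conj z)) * r, mul_nonneg (Complex.normSq_nonneg _) hr, ?_⟩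
    have h2 := Complex.mul_conj ((y - z) * (y - conj z))
    rw [map_mul (starRingEnd ℂ), map_sub, map_sub, Complex.conj_conj] at h2
    rw [Complex.ofReal_mul, ← h2, ← h]
    simp only [List.flatMap_cons, List.map_append, List.prod_append, List.map_cons, List.map_nil,
      List.prod_cons, List.prod_nil, mul_one]
    ring

theorem prod_pairs_real_nonneg (x : ℝ) (zs : List ℂ) :
    ∃ r : ℝ, 0 ≤ r ∧ ((zs.flatMap fun y => [y, conj y]).map fun y => y - (x : ℂ)).prod = r := by
  induction zs with
  | nil => exact ⟨1, zero_le_one, by simp⟩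
  | cons y zs ih =>
    obtain ⟨r, hr, h⟩ := ih
    refine ⟨Complex.normSq (y - x) * r, mul_nonneg (Complex.normSq_nonneg _) hr, ?_⟩
    have h2 := Complex.mul_conj (y - x)
    simp only [List.flatMap_cons, List.map_append, List.prod_append, List.map_cons, List.map_nil,
      List.prod_cons, List.prod_nil, mul_one, map_sub, Complex.conj_ofReal,
      Complex.ofReal_mul, h, ← h2] at *

theorem prod_sub_nonneg (x : ℝ) (xs : List ℝ) (h : ∀ y ∈ xs, x < y) :
    ∃ r : ℝ, 0 ≤ r ∧ ((xs.map Complex.ofReal).map fun y => y - (x : ℂ)).prod = r := by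
  refine ⟨(xs.map fun y => y - x).prod, List.prod_nonneg fun a ha => ?_, ?_⟩
  · obtain ⟨y, hy, rfl⟩ := List.mem_map.mp ha
    exact (sub_pos.mpr (h y hy)).le
  · have := map_list_prod Complex.ofRealHom (xs.map fun y => y - x)
    simp only [List.map_map, Function.comp_def] at this ⊢
    simpa using this.symm

/-- The phase of the product of differences: only the pairs `z`, `conj z` contribute to it if the
real points are ordered. -/
theorem exists_vand_points (xs : List ℝ) (hxs : xs.Pairwise (· < ·)) (zs : List ℂ) :
    ∃ r : ℝ, 0 ≤ r ∧ vand (points xs zs) = r * (zs.map phase).prod := by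
  induction xs with
  | nil =>
    induction zs with
    | nil => exact ⟨1, zero_le_one, by simp [points, vand]⟩
    | cons z zs ih =>
      obtain ⟨r, hr, h⟩ := ih
      obtain ⟨s, hs, h'⟩ := prod_pairs_nonneg z zs
      refine ⟨|2 * z.im| * s * r, by positivity, ?_⟩
      simp only [points, List.map_nil, List.nil_append, List.flatMap_cons, List.cons_append, vand,
        List.map_cons, List.prod_cons, Complex.ofReal_mul] at h ⊢
      rw [h, ← h', phase_mul_abs]
      ring
  | cons x xs ih =>
    rw [List.pairwise_cons] at hxs
    obtain ⟨r, hr, h⟩ := ih hxs.2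
    obtain ⟨s, hs, h'⟩ := prod_pairs_real_nonneg x zs
    obtain ⟨t, ht, h''⟩ := prod_sub_nonneg x xs hxs.1
    refine ⟨t * s * r, by positivity, ?_⟩
    simp only [points, List.map_cons, List.cons_append, vand, List.map_append, List.prod_append,
      Complex.ofReal_mul] at h ⊢
    rw [h, h', h'']
    ring

/-- The product of the phases vanishes if one of the points is real; otherwise it has the modulus `1`, and
its square is `-1` to the power of the number of points. -/
theorem norm_phase_prod (zs : List ℂ) :
    (zs.map phase).prod = 0 ∨ (zs.map phase).prod ^ 2 = (-1) ^ zs.length ∧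
      ‖(zs.map phase).prod‖ = 1 := by
  induction zs with
  | nil => right; simp
  | cons z zs ih =>
    rcases ih with ih | ih
    · left; simp [ih]
    · rcases eq_or_ne z.im 0 with hz | hz
      · left; simp [phase, hz]
      · right
        have h1 : (Real.sign z.im : ℂ) ^ 2 = 1 := by
          rcases Real.sign_apply_eq_of_ne_zero _ hz with h | h <;> simp [h]
        have h2 : ‖(Real.sign z.im : ℂ)‖ = 1 := by
          rcases Real.sign_apply_eq_of_ne_zero _ hz with h | h <;> simp [h]
        rw [List.map_cons, List.prod_cons, mul_pow, ih.1, norm_mul, ih.2, phase, mul_pow, h1,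
          norm_mul, h2, List.length_cons, pow_succ]
        simp [pow_succ]

theorem phase_prod_mul_vand (xs : List ℝ) (hxs : xs.Pairwise (· < ·)) (zs : List ℂ) :
    (zs.map phase).prod * vand (points xs zs) = (-1) ^ zs.length * ‖vand (points xs zs)‖ := by
  obtain ⟨r, hr, h⟩ := exists_vand_points xs hxs zs
  rcases norm_phase_prod zs with h' | ⟨h', h''⟩
  · rw [h, h']; simp
  · rw [h, norm_mul, h'', ← h']
    simp [abs_of_nonneg hr]
    ring

theorem vand_eq_zero_of_not_nodup (l : List ℂ) (h : ¬l.Nodup) : vand l = 0 := by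
  induction l with
  | nil => simp at h
  | cons x l ih =>
    rw [List.nodup_cons, not_and_or, not_not] at h
    rcases h with h | h
    · rw [vand, List.prod_eq_zero, zero_mul]
      exact List.mem_map.mpr ⟨x, h, sub_self x⟩
    · rw [vand, ih h, mul_zero]

theorem points_ofFn {L M : ℕ} (α : Fin L → ℝ) (β : Fin M → ℂ) :
    points (List.ofFn α) (List.ofFn β) = List.ofFn (eigenvalues α β) := by
  rw [eigenvalues, List.ofFn_fin_append, points, List.map_ofFn, List.ofFn_mul, List.flatMap,
    List.map_ofFn]
  congr 3
  funext i
  have h0 : finProdFinEquiv.symm (⟨↑i * 2 + 0, by omega⟩ : Fin (M * 2)) = (i, (0 : Fin 2)) := by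
    rw [Equiv.symm_apply_eq]; ext; simp [mul_comm]
  have h1 : finProdFinEquiv.symm (⟨↑i * 2 + 1, by omega⟩ : Fin (M * 2)) = (i, (1 : Fin 2)) := by
    rw [Equiv.symm_apply_eq]; ext; simp [mul_comm, add_comm]
  simp only [Function.comp_apply, List.ofFn_succ, List.ofFn_zero, Fin.val_zero, Fin.succ_zero_eq_one,
    Fin.val_one, h0, h1]
  simp

theorem prod_points {R : Type*} [CommMonoid R] (f : ℂ → R) (xs : List ℝ) (zs : List ℂ) :
    ((points xs zs).map f).prod =
      (xs.map fun x : ℝ => f x).prod * (zs.map fun z => f z * f (conj z)).prod := by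
  rw [points, List.map_append, List.prod_append, List.map_map]
  congr 1
  induction zs with
  | nil => simp
  | cons z zs ih => simp [ih, mul_assoc]

theorem density_eq (w : ℂ → ℝ) {L M : ℕ} (α : Fin L → ℝ) (β : Fin M → ℂ) :
    density w α β = 2 ^ M * ((points (List.ofFn α) (List.ofFn β)).map w).prod *
      ‖vand (points (List.ofFn α) (List.ofFn β))‖ := by
  rw [density, det_vandermonde_eq_vand, prod_points, points_ofFn]
  simp [List.map_ofFn, List.prod_ofFn]

/-- The factor between the density and the correlation of a full set of points. -/
def topFactor (N : ℕ) : ℂ := -(-1 / 2) ^ ((N - 1) / 2) * revSign N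

theorem topFactor_ne_zero (N : ℕ) : topFactor N ≠ 0 := by
  refine mul_ne_zero (neg_ne_zero.mpr (pow_ne_zero _ (by norm_num))) (pow_ne_zero _ (by norm_num))

variable {N : ℕ}

/-- The values of the weighted polynomials at a point. -/
def wvals (w : ℂ → ℝ) (p : Fin N → Polynomial ℂ) (y : ℂ) : Fin N → ℂ := fun j => wt w (p j) y

theorem det_wvals (w : ℂ → ℝ) (p : Fin N → Polynomial ℂ)
    (hp : ∀ n : Fin N, (p n).Monic ∧ (p n).natDegree = (n : ℕ)) {n : ℕ} (hn : n = N)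
    (γ : Fin n → ℂ) :
    (Matrix.of fun i j : Fin N => wvals w p (γ (Fin.cast hn.symm i)) j).det =
      ((List.ofFn γ).map fun z => (w z : ℂ)).prod * vand (List.ofFn γ) := by
  subst hn
  have h := Matrix.det_eval_matrixOfPolynomials_eq_det_vandermonde γ p (fun i => (hp i).2)
    fun i => (hp i).1
  rw [← det_vandermonde_eq_vand, h, List.map_ofFn, List.prod_ofFn,
    ← Matrix.det_mul_column]
  rfl

variable (A : Matrix (Fin N ⊕ Unit) (Fin N ⊕ Unit) ℂ) (κ : ℝ → Fin N → ℂ)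

/-- The correlation of a full set of points is a multiple of the density. -/
theorem corr_top (hN : Odd N) (w : ℂ → ℝ) (p : Fin N → Polynomial ℂ)
    (hp : ∀ n : Fin N, (p n).Monic ∧ (p n).natDegree = (n : ℕ)) {L M : ℕ} (hLM : L + 2 * M = N)
    (α : Fin L → ℝ) (β : Fin M → ℂ) :
    corr A κ (wvals w p) (List.ofFn α) (List.ofFn β) = topFactor N * density w α β := by
  rw [density_eq]
  -- Both sides do not depend on the order of the real points.
  set xs := (List.ofFn α).insertionSort (· ≤ ·) with hxs
  have hperm : xs.Perm (List.ofFn α) := List.perm_insertionSort _ _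
  set zs := List.ofFn β with hzs
  have hlen : zs.length = M := List.length_ofFn
  have hpp : (points xs zs).Perm (points (List.ofFn α) zs) := (hperm.map _).append_right _
  rw [← corr_perm A κ (wvals w p) hperm zs, ← norm_vand_perm hpp, ← (hpp.map w).prod_eq]
  have hn : (points xs zs).length = N := by
    rw [length_points, hperm.length_eq, List.length_ofFn, hlen, hLM]
  have hget := List.ofFn_get (points xs zs)
  have hw : (((points xs zs).map w).prod : ℂ) = ((points xs zs).map fun z => (w z : ℂ)).prod := by
    have := map_list_prod Complex.ofRealHom ((points xs zs).map w)
    simpa [Function.comp_def] using this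
  by_cases hnd : xs.Nodup
  · have hsort : xs.Pairwise (· < ·) := by
      have h1 : xs.Pairwise (· ≤ ·) := List.pairwise_insertionSort _ _
      exact (h1.and hnd).imp fun h => lt_of_le_of_ne h.1 h.2
    rw [corr_eq_det A κ (wvals w p) hN xs zs hsort hn _ hget.symm, det_wvals w p hp hn, hget,
      ← topFactor]
    have h1 := phase_prod_mul_vand xs hsort zs
    have h2 : (-2 : ℂ) ^ zs.length * (-1) ^ zs.length = 2 ^ M := by
      rw [hlen, ← mul_pow]; norm_num
    push_cast
    rw [hw]
    linear_combination (topFactor N * (-2) ^ zs.length *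
      ((points xs zs).map fun z => (w z : ℂ)).prod) * h1 +
      (topFactor N * ((points xs zs).map fun z => (w z : ℂ)).prod * ‖vand (points xs zs)‖) * h2
  · have hv : vand (points xs zs) = 0 := by
      refine vand_eq_zero_of_not_nodup _ fun h => hnd ?_
      rw [points, List.nodup_append'] at h
      exact List.Nodup.of_map _ h.1
    have hdet := wick_points_eq_det A κ (wvals w p) hn (points xs zs).get
      ((xs.map fun x => ExteriorAlgebra.ι ℂ (pt (N := N) x)).prod * top N)
    rw [det_wvals w p hp hn, hget, hv, mul_zero, zero_mul] at hdet
    rw [corr_eq, hdet, hv]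
    simp

end Fock

end

/-! ### Integration over one point -/

noncomputable section

namespace Wick

variable {X Y : Type*} [MeasurableSpace X] [MeasurableSpace Y] (μ : Measure X) (ν : Measure Y)

/-- The functions `f` and `g` are integrable, and the sum of their integrals is `a`. -/
def HasIntegralSum (f : X → ℂ) (g : Y → ℂ) (a : ℂ) : Prop :=
  Integrable f μ ∧ Integrable g ν ∧ ∫ x, f x ∂μ + ∫ y, g y ∂ν = a

variable {μ ν}

theorem HasIntegralSum.add {f f' : X → ℂ} {g g' : Y → ℂ} {a a' : ℂ}
    (h : HasIntegralSum μ ν f g a) (h' : HasIntegralSum μ ν f' g' a') :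
    HasIntegralSum μ ν (fun x => f x + f' x) (fun y => g y + g' y) (a + a') := by
  refine ⟨h.1.add h'.1, h.2.1.add h'.2.1, ?_⟩
  rw [integral_add h.1 h'.1, integral_add h.2.1 h'.2.1, ← h.2.2, ← h'.2.2]
  ring

theorem HasIntegralSum.const_mul {f : X → ℂ} {g : Y → ℂ} {a : ℂ} (h : HasIntegralSum μ ν f g a)
    (c : ℂ) : HasIntegralSum μ ν (fun x => c * f x) (fun y => c * g y) (c * a) := by
  refine ⟨h.1.const_mul c, h.2.1.const_mul c, ?_⟩
  rw [integral_const_mul, integral_const_mul, ← h.2.2, mul_add]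

theorem hasIntegralSum_zero : HasIntegralSum μ ν (fun _ => 0) (fun _ => 0) 0 :=
  ⟨integrable_zero _ _ _, integrable_zero _ _ _, by simp⟩

variable {E : Type*} [AddCommGroup E] [Module ℂ E]

theorem HasIntegralSum.ctr {d : X → Module.Dual ℂ E} {d' : Y → Module.Dual ℂ E}
    {D : Module.Dual ℂ E} (h : ∀ v, HasIntegralSum μ ν (fun x => d x v) (fun y => d' y v) (D v))
    (x : ExteriorAlgebra ℂ E) : ∀ ψ : ExteriorAlgebra ℂ E →ₗ[ℂ] ℂ,
      HasIntegralSum μ ν (fun s => ψ (ctr (d s) x)) (fun s => ψ (ctr (d' s) x)) (ψ (ctr D x)) := by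
  induction x using Wick.left_induction with
  | one => intro ψ; simpa only [ctr_one, map_zero] using hasIntegralSum_zero
  | add x y hx hy => intro ψ; simpa only [map_add] using (hx ψ).add (hy ψ)
  | smul r x hx => intro ψ; simpa only [map_smul, smul_eq_mul] using (hx ψ).const_mul r
  | ι_mul v x hx =>
    intro ψ
    have h1 := (h v).const_mul (ψ x)
    have h2 := (hx (ψ ∘ₗ LinearMap.mulLeft ℂ (ExteriorAlgebra.ι ℂ v))).const_mul (-1)
    convert h1.add h2 using 1 <;> simp [ctr_ι_mul, sub_eq_add_neg, mul_comm]

theorem HasIntegralSum.ctr₂ {β : X → LinearMap.BilinForm ℂ E} {β' : Y → LinearMap.BilinForm ℂ E}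
    {b : LinearMap.BilinForm ℂ E} (hβ : ∀ x, (β x).IsAlt) (hβ' : ∀ y, (β' y).IsAlt) (hb : b.IsAlt)
    (h : ∀ v v', HasIntegralSum μ ν (fun x => β x v v') (fun y => β' y v v') (b v v'))
    (x : ExteriorAlgebra ℂ E) : ∀ ψ : ExteriorAlgebra ℂ E →ₗ[ℂ] ℂ,
      HasIntegralSum μ ν (fun s => ψ (ctr₂ (β s) (hβ s) x)) (fun s => ψ (ctr₂ (β' s) (hβ' s) x))
        (ψ (ctr₂ b hb x)) := by
  induction x using Wick.left_induction with
  | one => intro ψ; simpa only [ctr₂_one, map_zero] using hasIntegralSum_zero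
  | add x y hx hy => intro ψ; simpa only [map_add] using (hx ψ).add (hy ψ)
  | smul r x hx => intro ψ; simpa only [map_smul, smul_eq_mul] using (hx ψ).const_mul r
  | ι_mul v x hx =>
    intro ψ
    have h1 := HasIntegralSum.ctr (h v) x ψ
    have h2 := hx (ψ ∘ₗ LinearMap.mulLeft ℂ (ExteriorAlgebra.ι ℂ v))
    convert h1.add h2 using 1 <;> simp [ctr₂_ι_mul]

/-- The element `x` has the charge `c` with respect to the endomorphism `lam`. -/
def HasCharge (lam : E →ₗ[ℂ] E) (c : ℂ) (x : ExteriorAlgebra ℂ E) : Prop :=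
  ∀ y, deriv lam (x * y) = c • (x * y) + x * deriv lam y

theorem HasCharge.mul {lam : E →ₗ[ℂ] E} {c c' : ℂ} {x x' : ExteriorAlgebra ℂ E}
    (h : HasCharge lam c x) (h' : HasCharge lam c' x') : HasCharge lam (c + c') (x * x') := by
  intro y
  rw [mul_assoc, h, h', mul_add, add_smul, mul_smul_comm, mul_assoc, add_assoc]

theorem hasCharge_ι {lam : E →ₗ[ℂ] E} {c : ℂ} {v : E} (h : lam v = c • v) :
    HasCharge lam c (ExteriorAlgebra.ι ℂ v) := by
  intro y
  rw [deriv_ι_mul, h, map_smul, smul_mul_assoc]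

theorem hasCharge_list_prod {lam : E →ₗ[ℂ] E} {c : ℂ} {l : List (ExteriorAlgebra ℂ E)}
    (h : ∀ x ∈ l, HasCharge lam c x) : HasCharge lam (l.length * c) l.prod := by
  induction l with
  | nil => intro y; simp
  | cons x l ih =>
    have := (h x (by simp)).mul (ih fun y hy => h y (by simp [hy]))
    convert this using 1
    · rw [List.length_cons]; push_cast; ring
    · rw [List.prod_cons]

theorem HasCharge.deriv_eq {lam : E →ₗ[ℂ] E} {c : ℂ} {x : ExteriorAlgebra ℂ E}
    (h : HasCharge lam c x) : deriv lam x = c • x := by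
  have := h 1
  rwa [mul_one, deriv_one, mul_zero, add_zero] at this

variable {B : LinearMap.BilinForm ℂ E} {hB : B.IsAlt}

/-- A pair of vectors in front of a product acts on it as the contraction with their wedge product. -/
theorem wick_pair_mul (u v : E) (h : B u v = 0) (x : ExteriorAlgebra ℂ E) :
    wick B hB (ExteriorAlgebra.ι ℂ u * ExteriorAlgebra.ι ℂ v * x) =
      wick B hB (ctr₂ (wedge (B v) (B u)) (wedge_isAlt _ _) x) := by
  rw [mul_assoc, wick_ι_mul, ctr_ι_mul, h, zero_smul, zero_sub, map_neg, wick_ι_mul, ctr₂_wedge,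
    map_neg]

end Wick

namespace Fock

open Wick

variable {N : ℕ}

/-- The charge of the generators: it counts rows other than the last one with the weight `1` and
values with the weight `-1`. -/
def charge : Space N →ₗ[ℂ] Space N where
  toFun v := (Sum.elim (fun j => v.1 (Sum.inl j)) 0, -v.2.1, 0)
  map_add' v v' := by
    refine Prod.ext (funext fun i => ?_) (Prod.ext (by simp [add_comm]) (by simp))
    rcases i with i | i <;> simp
  map_smul' c v := by
    refine Prod.ext (funext fun i => ?_) (Prod.ext (by simp) (by simp))
    rcases i with i | i <;> simp

theorem charge_val (c : Fin N → ℂ) : charge (val c) = (-1 : ℂ) • val c := by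
  refine Prod.ext (funext fun i => ?_) (Prod.ext ?_ ?_)
  · rcases i with i | i <;> simp [charge, val]
  · simp [charge, val]
  · simp [charge, val]

theorem charge_pt (t : ℝ) : charge (pt (N := N) t) = (0 : ℂ) • pt t := by
  refine Prod.ext (funext fun i => ?_) (Prod.ext ?_ ?_)
  · rcases i with i | i <;> simp [charge, pt]
  · simp [charge, pt]
  · simp [charge, pt]

theorem charge_row_inl (j : Fin N) : charge (row (Pi.single (Sum.inl j) 1)) =
    (1 : ℂ) • row (Pi.single (Sum.inl j) 1) := by
  refine Prod.ext (funext fun i => ?_) (Prod.ext ?_ ?_)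
  · rcases i with i | i <;> simp [charge, row]
  · simp [charge, row]
  · simp [charge, row]

theorem charge_row_inr : charge (row (N := N) (Pi.single (Sum.inr ()) 1)) =
    (0 : ℂ) • row (Pi.single (Sum.inr ()) 1) := by
  refine Prod.ext (funext fun i => ?_) (Prod.ext ?_ ?_)
  · rcases i with i | i <;> simp [charge, row]
  · simp [charge, row]
  · simp [charge, row]

theorem hasCharge_top : HasCharge (charge (N := N)) N (top N) := by
  have h1 := hasCharge_list_prod (lam := charge (N := N)) (c := 1)
    (l := (List.finRange N).map fun j => ExteriorAlgebra.ι ℂ (row (Pi.single (Sum.inl j) 1)))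
    fun x hx => by
      obtain ⟨j, _, rfl⟩ := List.mem_map.mp hx
      exact hasCharge_ι (charge_row_inl j)
  have := h1.mul (hasCharge_ι (charge_row_inr (N := N)))
  simpa [top] using this

variable (P : ℂ → Fin N → ℂ)

/-- The charge is the number of points that are missing from a full set. -/
theorem hasCharge_points (xs : List ℝ) (zs : List ℂ) : HasCharge (charge (N := N))
    (N - (xs.length + 2 * zs.length))
    ((xs.map (realPair P)).prod * (zs.map (complexPair P)).prod * top N) := by
  have h1 := hasCharge_list_prod (lam := charge (N := N)) (c := -1)
    (l := xs.map (realPair P)) fun x hx => by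
      obtain ⟨t, _, rfl⟩ := List.mem_map.mp hx
      have := (hasCharge_ι (charge_val (P t))).mul (hasCharge_ι (charge_pt (N := N) t))
      rwa [add_zero] at this
  have h2 := hasCharge_list_prod (lam := charge (N := N)) (c := -1 + -1)
    (l := zs.map (complexPair P)) fun x hx => by
      obtain ⟨z, _, rfl⟩ := List.mem_map.mp hx
      exact (hasCharge_ι (charge_val _)).mul (hasCharge_ι (charge_val _))
  have := (h1.mul h2).mul (hasCharge_top (N := N))
  convert this using 1
  simp only [List.length_map]
  ring

variable (A : Matrix (Fin N ⊕ Unit) (Fin N ⊕ Unit) ℂ) (κ : ℝ → Fin N → ℂ)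

/-- The infinitesimal change of the form along the charge. -/
def chargeForm : LinearMap.BilinForm ℂ (Space N) :=
  (form A κ).compl₁₂ charge LinearMap.id + (form A κ).compl₁₂ LinearMap.id charge

theorem chargeForm_apply (v v' : Space N) :
    chargeForm A κ v v' = form A κ (charge v) v' + form A κ v (charge v') := rfl

theorem chargeForm_isAlt : (chargeForm A κ).IsAlt := fun v => by
  rw [chargeForm_apply, ← (form_isAlt A κ).neg_eq v (charge v)]
  ring

/-- The form through which the real point `t` acts on the other points. -/
def realForm (t : ℝ) : LinearMap.BilinForm ℂ (Space N) :=
  wedge (form A κ (pt t)) (form A κ (val (P t)))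

/-- The form through which the complex point `z` acts on the other points. -/
def complexForm (z : ℂ) : LinearMap.BilinForm ℂ (Space N) :=
  wedge (form A κ (val (phase z • P (conj z)))) (form A κ (val (P z)))

/-- Integration of the correlation over one point multiplies it by the number of the remaining
points. -/
theorem corr_integral (h : ∀ v v', HasIntegralSum volume volume
      (fun t => realForm P A κ t v v') (fun z => complexForm P A κ z v v')
      (chargeForm A κ v v')) (xs : List ℝ) (zs : List ℂ) :
    HasIntegralSum volume volume (fun t => corr A κ P (t :: xs) zs)
      (fun z => corr A κ P xs (z :: zs))
      ((N - (xs.length + 2 * zs.length)) * corr A κ P xs zs) := by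
  have h1 := HasIntegralSum.ctr₂ (fun t => wedge_isAlt _ _) (fun z => wedge_isAlt _ _)
    (chargeForm_isAlt A κ) h ((xs.map (realPair P)).prod * (zs.map (complexPair P)).prod * top N)
    (wick (form A κ) (form_isAlt A κ))
  convert h1 using 1
  · funext t
    rw [corr, List.map_cons, List.prod_cons, realPair, mul_assoc (_ * _ : ExteriorAlgebra ℂ _),
      mul_assoc (_ * _ : ExteriorAlgebra ℂ _), wick_pair_mul _ _ (form_val_pt A κ _ _),
      mul_assoc (xs.map (realPair P)).prod]
  · funext z
    rw [corr, List.map_cons, List.prod_cons, ← mul_assoc, ← complexPair_comm, complexPair,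
      mul_assoc (_ * _ : ExteriorAlgebra ℂ _),
      mul_assoc (_ * _ : ExteriorAlgebra ℂ _), wick_pair_mul _ _ (form_val_val A κ _ _),
      mul_assoc (xs.map (realPair P)).prod]
  · rw [← wick_deriv charge (chargeForm_isAlt A κ) (chargeForm_apply A κ),
      (hasCharge_points P xs zs).deriv_eq, map_smul, smul_eq_mul, corr]

end Fock

end

/-! ### Integration over several points -/

noncomputable section

section Peel

theorem peel_eq {X Y : Type*} [MeasurableSpace X] [MeasurableSpace Y] (a : ℕ) :
    (fun q : X × (Fin a → X) × Y => ((Fin.cons q.1 q.2.1 : Fin (a + 1) → X), q.2.2)) =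
      Prod.map (MeasurableEquiv.piFinSuccAbove (fun _ : Fin (a + 1) => X) 0).symm id ∘
        (MeasurableEquiv.prodAssoc (α := X) (β := Fin a → X) (γ := Y)).symm := by
  funext q
  refine Prod.ext ?_ rfl
  change Fin.cons q.1 q.2.1 = Fin.insertNth (α := fun _ => X) 0 q.1 q.2.1
  simp [Fin.insertNth_zero']

theorem measurableEmbedding_peel {X Y : Type*} [MeasurableSpace X] [MeasurableSpace Y] (a : ℕ) :
    MeasurableEmbedding
      (fun q : X × (Fin a → X) × Y => ((Fin.cons q.1 q.2.1 : Fin (a + 1) → X), q.2.2)) := by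
  have h := ((MeasurableEquiv.prodAssoc (α := X) (β := Fin a → X) (γ := Y)).symm.trans
    ((MeasurableEquiv.piFinSuccAbove (fun _ : Fin (a + 1) => X) 0).symm.prodCongr
      (MeasurableEquiv.refl Y))).measurableEmbedding
  rw [peel_eq]
  exact h

variable {X Y : Type*} [MeasureSpace X] [MeasureSpace Y] [SigmaFinite (volume : Measure X)]
  [SigmaFinite (volume : Measure Y)]

/-- The first coordinate of a tuple, split off from a pair of a tuple and a further element. -/
theorem measurePreserving_peel (a : ℕ) :
    MeasurePreserving (fun q : X × (Fin a → X) × Y => ((Fin.cons q.1 q.2.1 : Fin (a + 1) → X), q.2.2))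
      volume volume := by
  have h1 : MeasurePreserving (MeasurableEquiv.piFinSuccAbove (fun _ : Fin (a + 1) => X) 0).symm
      volume volume := (volume_preserving_piFinSuccAbove (fun _ : Fin (a + 1) => X) 0).symm _
  have h2 := (h1.prod (MeasurePreserving.id (volume : Measure Y))).comp
    ((volume_preserving_prodAssoc (α₁ := X) (β₁ := Fin a → X) (γ₁ := Y)).symm _)
  rw [peel_eq]
  exact h2

theorem integrable_peel {a : ℕ} {g : (Fin (a + 1) → X) × Y → ℂ} (hg : Integrable g) :
    Integrable fun q : X × (Fin a → X) × Y => g (Fin.cons q.1 q.2.1, q.2.2) :=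
  (measurePreserving_peel a).integrable_comp_of_integrable hg

theorem integral_peel {a : ℕ} {g : (Fin (a + 1) → X) × Y → ℂ} (hg : Integrable g) :
    ∫ q, g q = ∫ t : X, ∫ q : (Fin a → X) × Y, g (Fin.cons t q.1, q.2) := by
  rw [← (measurePreserving_peel (X := X) (Y := Y) a).integral_comp (measurableEmbedding_peel a)]
  exact integral_prod _ (integrable_peel hg)

end Peel

namespace Fock

open Wick RealAsymmetric

variable {N : ℕ} (A : Matrix (Fin N ⊕ Unit) (Fin N ⊕ Unit) ℂ) (κ : ℝ → Fin N → ℂ)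
  (P : ℂ → Fin N → ℂ)

theorem corr_perm_right (xs : List ℝ) {zs zs' : List ℂ} (h : zs.Perm zs') :
    corr A κ P xs zs = corr A κ P xs zs' := by
  have : (zs.map (complexPair P)).prod = (zs'.map (complexPair P)).prod := by
    refine (h.map _).prod_eq' ?_
    refine List.pairwise_of_forall_mem_list fun a ha b _ => ?_
    obtain ⟨t, _, rfl⟩ := List.mem_map.mp ha
    exact complexPair_comm P t b
  rw [corr, corr, this]

/-- The integral of the correlation over `a` real and `b` complex points. -/
def corrIntegral (a b : ℕ) (xs : List ℝ) (zs : List ℂ) : ℂ :=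
  ∫ q : (Fin a → ℝ) × (Fin b → ℂ), corr A κ P (xs ++ List.ofFn q.1) (zs ++ List.ofFn q.2)

/-- The integrability of the correlations of full sets of points, in some of the points. -/
def IntegrableTop : Prop :=
  ∀ (xs : List ℝ) (zs : List ℂ) (a b : ℕ), xs.length + a + 2 * (zs.length + b) = N →
    Integrable fun q : (Fin a → ℝ) × (Fin b → ℂ) =>
      corr A κ P (xs ++ List.ofFn q.1) (zs ++ List.ofFn q.2)

variable {A κ P}

theorem corr_cons_left (t : ℝ) {a b : ℕ} (xs : List ℝ) (zs : List ℂ) (q : (Fin a → ℝ) × (Fin b → ℂ)) :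
    corr A κ P (xs ++ List.ofFn (Fin.cons t q.1 : Fin (a + 1) → ℝ)) (zs ++ List.ofFn q.2) =
      corr A κ P (t :: xs ++ List.ofFn q.1) (zs ++ List.ofFn q.2) := by
  refine corr_perm A κ P ?_ _
  rw [List.ofFn_cons]
  exact List.perm_middle

theorem corr_cons_right (z : ℂ) {a b : ℕ} (xs : List ℝ) (zs : List ℂ)
    (q : (Fin a → ℝ) × (Fin b → ℂ)) :
    corr A κ P (xs ++ List.ofFn q.1) (zs ++ List.ofFn (Fin.cons z q.2 : Fin (b + 1) → ℂ)) =
      corr A κ P (xs ++ List.ofFn q.1) (z :: zs ++ List.ofFn q.2) := by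
  refine corr_perm_right A κ P _ ?_
  rw [List.ofFn_cons]
  exact List.perm_middle

theorem corrIntegral_succ_left (h : IntegrableTop A κ P) {xs : List ℝ} {zs : List ℂ} {a b : ℕ}
    (hab : xs.length + (a + 1) + 2 * (zs.length + b) = N) :
    Integrable (fun t => corrIntegral A κ P a b (t :: xs) zs) ∧
      corrIntegral A κ P (a + 1) b xs zs = ∫ t, corrIntegral A κ P a b (t :: xs) zs := by
  have h1 := h xs zs (a + 1) b hab
  have h2 := (integrable_peel h1).integral_prod_left
  have h3 := integral_peel h1
  simp only [corr_cons_left] at h2 h3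
  exact ⟨h2, h3⟩

theorem corrIntegral_succ_right (h : IntegrableTop A κ P) {xs : List ℝ} {zs : List ℂ} {a b : ℕ}
    (hab : xs.length + a + 2 * (zs.length + (b + 1)) = N) :
    Integrable (fun z => corrIntegral A κ P a b xs (z :: zs)) ∧
      corrIntegral A κ P a (b + 1) xs zs = ∫ z, corrIntegral A κ P a b xs (z :: zs) := by
  have h1 := (h xs zs a (b + 1) hab).swap
  have h2 := (integrable_peel h1).integral_prod_left
  have h3 := integral_peel h1
  have h4 : ∀ z : ℂ, ∫ q : (Fin b → ℂ) × (Fin a → ℝ),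
      corr A κ P (xs ++ List.ofFn q.2) (zs ++ List.ofFn (Fin.cons z q.1 : Fin (b + 1) → ℂ)) =
      corrIntegral A κ P a b xs (z :: zs) := by
    intro z
    have h5 := integral_prod_swap (μ := (volume : Measure (Fin a → ℝ)))
      (ν := (volume : Measure (Fin b → ℂ)))
      (fun q => corr A κ P (xs ++ List.ofFn q.1) (z :: zs ++ List.ofFn q.2))
    refine Eq.trans ?_ h5
    exact integral_congr_ae (Filter.Eventually.of_forall fun q =>
      corr_cons_right z xs zs (q.2, q.1))
  have h6 := integral_prod_swap (μ := (volume : Measure (Fin a → ℝ)))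
      (ν := (volume : Measure (Fin (b + 1) → ℂ)))
      (fun q => corr A κ P (xs ++ List.ofFn q.1) (zs ++ List.ofFn q.2))
  refine ⟨h2.congr (Filter.Eventually.of_forall h4), ?_⟩
  refine h6.symm.trans (h3.trans ?_)
  exact integral_congr_ae (Filter.Eventually.of_forall h4)

/-- The weight of a sector. -/
def weight (s : ℕ × ℕ) : ℂ := 1 / ((s.1)! * (s.2)! * 2 ^ s.2)

theorem weight_succ_left (a b : ℕ) : ((a + 1 : ℕ) : ℂ) * weight (a + 1, b) = weight (a, b) := by
  have h1 : (a ! : ℂ) ≠ 0 := by exact_mod_cast a.factorial_ne_zero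
  have h2 : (b ! : ℂ) ≠ 0 := by exact_mod_cast b.factorial_ne_zero
  have h3 : ((a : ℂ) + 1) ≠ 0 := by exact_mod_cast a.succ_ne_zero
  simp only [weight, Nat.factorial_succ]
  push_cast
  field_simp

theorem weight_succ_right (a b : ℕ) :
    ((2 * (b + 1) : ℕ) : ℂ) * weight (a, b + 1) = weight (a, b) := by
  have h1 : (a ! : ℂ) ≠ 0 := by exact_mod_cast a.factorial_ne_zero
  have h2 : (b ! : ℂ) ≠ 0 := by exact_mod_cast b.factorial_ne_zero
  have h3 : ((b : ℂ) + 1) ≠ 0 := by exact_mod_cast b.succ_ne_zero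
  simp only [weight, Nat.factorial_succ]
  push_cast
  field_simp
  ring

theorem mem_sectors {n : ℕ} {s : ℕ × ℕ} : s ∈ sectors n ↔ s.1 + 2 * s.2 = n := by
  simp only [sectors, Finset.mem_filter, Finset.mem_product, Finset.mem_range]
  omega

theorem sum_sectors_left (n : ℕ) (f : ℕ → ℕ → ℂ) :
    ∑ s ∈ sectors (n + 1), (s.1 : ℂ) * (weight s * f s.1 s.2) =
      ∑ s ∈ sectors n, weight s * f (s.1 + 1) s.2 := by
  symm
  refine Finset.sum_bij_ne_zero (fun s _ _ => (s.1 + 1, s.2)) ?_ ?_ ?_ ?_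
  · intro s hs _
    rw [mem_sectors] at hs ⊢
    simp only
    omega
  · rintro ⟨a, b⟩ _ _ ⟨a', b'⟩ _ _ h
    simpa using h
  · rintro ⟨a, b⟩ hs h
    rw [mem_sectors] at hs
    rcases a with - | a
    · simp at h
    · refine ⟨(a, b), mem_sectors.mpr (by simp only at hs ⊢; omega), ?_, rfl⟩
      rwa [← mul_assoc, weight_succ_left] at h
  · rintro ⟨a, b⟩ _ _
    rw [← mul_assoc, weight_succ_left]

theorem sum_sectors_right (n : ℕ) (f : ℕ → ℕ → ℂ) :
    ∑ s ∈ sectors (n + 2), ((2 * s.2 : ℕ) : ℂ) * (weight s * f s.1 s.2) =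
      ∑ s ∈ sectors n, weight s * f s.1 (s.2 + 1) := by
  symm
  refine Finset.sum_bij_ne_zero (fun s _ _ => (s.1, s.2 + 1)) ?_ ?_ ?_ ?_
  · intro s hs _
    rw [mem_sectors] at hs ⊢
    simp only
    omega
  · rintro ⟨a, b⟩ _ _ ⟨a', b'⟩ _ _ h
    simpa using h
  · rintro ⟨a, b⟩ hs h
    rw [mem_sectors] at hs
    rcases b with - | b
    · simp at h
    · refine ⟨(a, b), mem_sectors.mpr (by simp only at hs ⊢; omega), ?_, rfl⟩
      rwa [← mul_assoc, weight_succ_right] at h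
  · rintro ⟨a, b⟩ _ _
    rw [← mul_assoc, weight_succ_right]

/-- The correlation of some points is the sum over all sectors of the integrals of the correlations
of full sets of points over the remaining points. -/
theorem sum_corrIntegral (h : ∀ v v', HasIntegralSum volume volume
      (fun t => realForm P A κ t v v') (fun z => complexForm P A κ z v v')
      (chargeForm A κ v v')) (hint : IntegrableTop A κ P) (n : ℕ) :
    ∀ (xs : List ℝ) (zs : List ℂ), xs.length + 2 * zs.length + n = N →
      ∑ s ∈ sectors n, weight s * corrIntegral A κ P s.1 s.2 xs zs = corr A κ P xs zs := by
  induction n using Nat.strong_induction_on with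
  | _ n ih =>
    intro xs zs hn
    rcases Nat.eq_zero_or_pos n with rfl | hpos
    · have : sectors 0 = {(0, 0)} := by
        ext ⟨a, b⟩
        rw [mem_sectors, Finset.mem_singleton, Prod.mk.injEq]
        omega
      have hvol : (volume : Measure ((Fin 0 → ℝ) × (Fin 0 → ℂ))).real Set.univ = 1 := by
        rw [measureReal_def, Measure.volume_eq_prod, ← Set.univ_prod_univ, Measure.prod_prod,
          volume_pi, volume_pi, Measure.pi_empty_univ, Measure.pi_empty_univ]
        simp
      rw [this, Finset.sum_singleton]
      change weight (0, 0) * corrIntegral A κ P 0 0 xs zs = _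
      let _ : Unique ((Fin 0 → ℝ) × (Fin 0 → ℂ)) := Unique.mk' _
      rw [corrIntegral, integral_unique, hvol]
      simp [weight]
    · have hc : (n : ℂ) ≠ 0 := by exact_mod_cast hpos.ne'
      apply mul_left_cancel₀ hc
      obtain ⟨-, -, hsum⟩ := corr_integral P A κ h xs zs
      have hN : ((N : ℂ) - (xs.length + 2 * zs.length)) = n := by
        rw [← hn]; push_cast; ring
      rw [hN] at hsum
      rw [← hsum]
      have hsplit : (n : ℂ) * ∑ s ∈ sectors n, weight s * corrIntegral A κ P s.1 s.2 xs zs =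
          ∑ s ∈ sectors n, (s.1 : ℂ) * (weight s * corrIntegral A κ P s.1 s.2 xs zs) +
          ∑ s ∈ sectors n, ((2 * s.2 : ℕ) : ℂ) *
            (weight s * corrIntegral A κ P s.1 s.2 xs zs) := by
        rw [← Finset.sum_add_distrib, Finset.mul_sum]
        refine Finset.sum_congr rfl fun s hs => ?_
        rw [← add_mul, ← mem_sectors.mp hs]
        push_cast
        rfl
      rw [hsplit]
      -- The first sum integrates out a real point, the second one a pair of complex points.
      congr 1
      · obtain ⟨k, rfl⟩ : ∃ k, n = k + 1 := ⟨n - 1, by omega⟩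
        rw [sum_sectors_left k fun a b => corrIntegral A κ P a b xs zs]
        have h1 : ∀ s ∈ sectors k, _ := fun s hs => corrIntegral_succ_left hint (xs := xs)
          (zs := zs) (a := s.1) (b := s.2) (by have := mem_sectors.mp hs; omega)
        rw [Finset.sum_congr rfl fun s hs => by rw [(h1 s hs).2, ← integral_const_mul],
          ← integral_finsetSum _ fun s hs => ((h1 s hs).1.const_mul _)]
        refine integral_congr_ae (Filter.Eventually.of_forall fun t => ?_)
        exact ih k (by omega) (t :: xs) zs (by rw [List.length_cons]; omega)
      · rcases Nat.lt_or_ge n 2 with h2 | h2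
        · -- A further pair of complex points does not fit.
          rw [Finset.sum_eq_zero fun s hs => ?_]
          · symm
            refine integral_eq_zero_of_ae (Filter.Eventually.of_forall fun z => ?_)
            exact corr_eq_zero A κ P xs (z :: zs) (by rw [List.length_cons]; omega)
          · have : s.2 = 0 := by have := mem_sectors.mp hs; omega
            simp [this]
        · obtain ⟨k, rfl⟩ : ∃ k, n = k + 2 := ⟨n - 2, by omega⟩
          rw [sum_sectors_right k fun a b => corrIntegral A κ P a b xs zs]
          have h1 : ∀ s ∈ sectors k, _ := fun s hs => corrIntegral_succ_right hint (xs := xs)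
            (zs := zs) (a := s.1) (b := s.2) (by have := mem_sectors.mp hs; omega)
          rw [Finset.sum_congr rfl fun s hs => by rw [(h1 s hs).2, ← integral_const_mul],
            ← integral_finsetSum _ fun s hs => ((h1 s hs).1.const_mul _)]
          refine integral_congr_ae (Filter.Eventually.of_forall fun z => ?_)
          exact ih k (by omega) xs (z :: zs) (by rw [List.length_cons]; omega)

end Fock

end

/-! ### Elimination of the rows -/

noncomputable section

namespace Fock

open Wick RealAsymmetric

variable {N : ℕ} (A : Matrix (Fin N ⊕ Unit) (Fin N ⊕ Unit) ℂ) (κ : ℝ → Fin N → ℂ)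
  (P : ℂ → Fin N → ℂ)

/-- The basis of the row space, as a list. -/
def rows (N : ℕ) : List (Space N) :=
  ((List.finRange N).map fun j => row (Pi.single (Sum.inl j) 1)) ++
    [row (Pi.single (Sum.inr ()) 1)]

theorem top_eq : top N = ((rows N).map (ExteriorAlgebra.ι ℂ)).prod := by
  simp [top, rows, Function.comp_def]

theorem mem_rows (i : Fin N ⊕ Unit) : row (Pi.single i 1) ∈ rows N := by
  rcases i with j | j
  · simp [rows]
  · simp [rows]

theorem exists_of_mem_rows {v : Space N} (hv : v ∈ rows N) : ∃ a, v = row a := by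
  rw [rows, List.mem_append, List.mem_map, List.mem_singleton] at hv
  rcases hv with ⟨j, _, rfl⟩ | rfl
  · exact ⟨_, rfl⟩
  · exact ⟨_, rfl⟩

theorem ι_mul_prod_of_mem {E : Type*} [AddCommGroup E] [Module ℂ E] {v : E} {l : List E}
    (h : v ∈ l) : ExteriorAlgebra.ι ℂ v * (l.map (ExteriorAlgebra.ι ℂ)).prod = 0 := by
  induction l with
  | nil => simp at h
  | cons w l ih =>
    rw [List.map_cons, List.prod_cons]
    rcases List.mem_cons.mp h with rfl | h
    · rw [← mul_assoc, ExteriorAlgebra.ι_sq_zero, zero_mul]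
    · rw [← mul_assoc, ι_mul_ι_comm, neg_mul, mul_assoc, ih h, mul_zero, neg_zero]

theorem row_eq_sum (a : Fin N ⊕ Unit → ℂ) : row a = ∑ i, a i • row (Pi.single i 1) := by
  conv_lhs => rw [pi_eq_sum_univ' a]
  simp only [map_sum, map_smul]

theorem ι_row_mul_top (a : Fin N ⊕ Unit → ℂ) : ExteriorAlgebra.ι ℂ (row a) * top N = 0 := by
  rw [row_eq_sum, map_sum, Finset.sum_mul]
  refine Finset.sum_eq_zero fun i _ => ?_
  rw [map_smul, smul_mul_assoc, top_eq, ι_mul_prod_of_mem (mem_rows i), smul_zero]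

variable {A κ}

theorem ctr_top_eq_zero {d : Module.Dual ℂ (Space N)} (h : ∀ a, d (row a) = 0) :
    ctr d (top N) = 0 := by
  rw [top_eq]
  refine ctr_list_prod_eq_zero _ _ fun v hv => ?_
  obtain ⟨a, rfl⟩ := exists_of_mem_rows hv
  exact h a

/-- The matrix `A` is invertible if its Pfaffian does not vanish. -/
theorem isUnit_of_wick_top_ne_zero (hA : Aᵀ = -A)
    (h : wick (form A κ) (form_isAlt A κ) (top N) ≠ 0) : IsUnit A := by
  rw [Matrix.isUnit_iff_isUnit_det, isUnit_iff_ne_zero]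
  intro hdet
  -- A vector `a` in the kernel of `A` is orthogonal to all rows. As the product of `a` with all rows
  -- vanishes, contraction with a coordinate that does not vanish on `a` shows that the value of the
  -- Wick functional on the product of the rows is, up to a nonzero factor, its value on a product
  -- with `a`, hence zero.
  obtain ⟨a, ha0, ha⟩ := Matrix.exists_mulVec_eq_zero_iff.mpr hdet
  obtain ⟨i, hi⟩ := Function.ne_iff.mp ha0
  set d : Module.Dual ℂ (Space N) := LinearMap.proj i ∘ₗ LinearMap.fst ℂ _ _ with hd
  have h0 : ctr (form A κ (row a)) (top N) = 0 := by
    refine ctr_top_eq_zero fun b => ?_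
    rw [form_row A κ hA]
    have : a ⬝ᵥ A *ᵥ b = 0 := by
      rw [Matrix.dotProduct_mulVec, ← Matrix.mulVec_transpose, hA, Matrix.neg_mulVec, ha]
      simp
    simp [row, this]
  have h1 := ctr_ι_mul d (row a) (top N)
  rw [ι_row_mul_top, map_zero, eq_comm, sub_eq_zero] at h1
  have h2 := congrArg (wick (form A κ) (form_isAlt A κ)) h1
  rw [wick_ι_mul, ctr_comm, h0, map_zero, neg_zero, map_zero, map_smul, smul_eq_mul] at h2
  exact (mul_ne_zero hi h) h2

/-- The pairings of `v` with the rows. -/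
def rowPair (A : Matrix (Fin N ⊕ Unit) (Fin N ⊕ Unit) ℂ) (κ : ℝ → Fin N → ℂ) (v : Space N) :
    Fin N ⊕ Unit → ℂ := fun i => form A κ (row (Pi.single i 1)) v

theorem form_row_eq (a : Fin N ⊕ Unit → ℂ) (v : Space N) :
    form A κ (row a) v = a ⬝ᵥ rowPair A κ v := by
  rw [row_eq_sum, map_sum, LinearMap.sum_apply]
  simp only [map_smul, LinearMap.smul_apply]
  rfl

/-- The component of `v` that is orthogonal to the rows. -/
def perp (A : Matrix (Fin N ⊕ Unit) (Fin N ⊕ Unit) ℂ) (κ : ℝ → Fin N → ℂ) (v : Space N) :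
    Space N := v - row (A⁻¹ *ᵥ rowPair A κ v)

theorem form_row_row (hA : Aᵀ = -A) (a b : Fin N ⊕ Unit → ℂ) :
    form A κ (row a) (row b) = a ⬝ᵥ A *ᵥ b := by
  rw [form_row A κ hA]
  simp [row]

theorem form_perp_row (hA : Aᵀ = -A) (hu : IsUnit A) (v : Space N) (a : Fin N ⊕ Unit → ℂ) :
    form A κ (perp A κ v) (row a) = 0 := by
  have hdet := (Matrix.isUnit_iff_isUnit_det A).mp hu
  rw [← (form_isAlt A κ).neg_eq, perp, map_sub, form_row_row hA, form_row_eq, Matrix.mulVec_mulVec,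
    Matrix.mul_nonsing_inv A hdet, Matrix.one_mulVec, sub_self, neg_zero]

theorem form_perp_perp (hA : Aᵀ = -A) (hu : IsUnit A) (v v' : Space N) :
    form A κ (perp A κ v) (perp A κ v') =
      form A κ v v' + rowPair A κ v ⬝ᵥ A⁻¹ *ᵥ rowPair A κ v' := by
  have hinv : (A⁻¹)ᵀ = -A⁻¹ := by
    have hn : (-A)⁻¹ = -A⁻¹ := by
      refine Matrix.inv_eq_left_inv ?_
      rw [neg_mul_neg, Matrix.nonsing_inv_mul A ((Matrix.isUnit_iff_isUnit_det A).mp hu)]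
    rw [Matrix.transpose_nonsing_inv, hA, hn]
  conv_lhs => rw [perp.eq_1 A κ v', map_sub, form_perp_row hA hu, sub_zero, perp, map_sub,
    LinearMap.sub_apply, form_row_eq]
  rw [Matrix.dotProduct_mulVec, ← Matrix.mulVec_transpose, hinv, Matrix.neg_mulVec, neg_dotProduct,
    sub_eq_add_neg]

/-- In a product with all rows, every vector can be replaced by its component orthogonal to the rows. -/
theorem prod_perp_mul_top (l : List (Space N)) :
    (l.map fun v => ExteriorAlgebra.ι ℂ (perp A κ v)).prod * top N =
      (l.map (ExteriorAlgebra.ι ℂ)).prod * top N := by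
  induction l with
  | nil => rfl
  | cons v l ih =>
    simp only [List.map_cons, List.prod_cons, mul_assoc]
    rw [ih, perp, map_sub, sub_mul, ← mul_assoc (ExteriorAlgebra.ι ℂ (row _)), ι_mul_list_prod,
      smul_mul_assoc, mul_assoc, ι_row_mul_top, mul_zero, smul_zero, sub_zero]

/-- The elimination of the rows: the Wick functional becomes a Pfaffian of the Schur complement. -/
theorem wick_mul_top (hA : Aᵀ = -A) (hu : IsUnit A) (n : ℕ) (v : Fin (n * 2) → Space N) :
    wick (form A κ) (form_isAlt A κ) ((List.ofFn fun i => ExteriorAlgebra.ι ℂ (v i)).prod * top N) =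
      pfaffian (Matrix.of fun i j =>
        form A κ (v i) (v j) + rowPair A κ (v i) ⬝ᵥ A⁻¹ *ᵥ rowPair A κ (v j)) *
      wick (form A κ) (form_isAlt A κ) (top N) := by
  have h := wick_eq_pfaffian (B := form A κ) n
    (wick (form A κ) (form_isAlt A κ) ∘ₗ LinearMap.mulRight ℂ (top N)) (fun i => perp A κ (v i))
    fun i x => by
      simp only [LinearMap.comp_apply, LinearMap.mulRight_apply, mul_assoc]
      rw [wick_ι_mul, ctr_mul_of_ctr_eq_zero _ (ctr_top_eq_zero (form_perp_row hA hu (v i)))]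
  simp only [form_perp_perp hA hu, LinearMap.comp_apply, LinearMap.mulRight_apply, one_mul,
    ExteriorAlgebra.ιMulti_apply] at h
  rw [← h]
  have h2 := prod_perp_mul_top (A := A) (κ := κ) (List.ofFn v)
  rw [List.map_ofFn, List.map_ofFn] at h2
  exact congrArg _ h2.symm

/-- The two vectors that belong to a point. -/
def genVec (y : ℂ) (a : Fin 2) : Space N :=
  if a = 0 then val (P y)
  else if y.im = 0 then pt y.re else val (phase y • P (conj y))

theorem genVec_one (y : ℂ) :
    genVec P y 1 = if y.im = 0 then pt y.re else val (phase y • P (conj y)) := by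
  simp [genVec]

theorem ofFn_genVec_prod {n : ℕ} (y : Fin n → ℂ) :
    (List.ofFn fun r : Fin (n * 2) => ExteriorAlgebra.ι ℂ
      (genVec P (y (finProdFinEquiv.symm r).1) (finProdFinEquiv.symm r).2)).prod =
    ((List.ofFn y).map fun y =>
      ExteriorAlgebra.ι ℂ (genVec P y 0) * ExteriorAlgebra.ι ℂ (genVec P y 1)).prod := by
  rw [List.ofFn_mul, List.prod_flatten, List.map_ofFn, List.map_ofFn]
  congr 2
  funext i
  have h0 : finProdFinEquiv.symm (⟨↑i * 2 + 0, by omega⟩ : Fin (n * 2)) = (i, (0 : Fin 2)) := by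
    rw [Equiv.symm_apply_eq]; ext; simp [mul_comm]
  have h1 : finProdFinEquiv.symm (⟨↑i * 2 + 1, by omega⟩ : Fin (n * 2)) = (i, (1 : Fin 2)) := by
    rw [Equiv.symm_apply_eq]; ext; simp [mul_comm, add_comm]
  simp only [Function.comp_apply, List.ofFn_succ, List.ofFn_zero, Fin.val_zero, Fin.succ_zero_eq_one,
    Fin.val_one, h0, h1]
  simp

/-- The correlation of `l` real points and `m` complex points is a Pfaffian. -/
theorem corr_eq_pfaffian (hA : Aᵀ = -A) (hu : IsUnit A) {l m : ℕ} (x : Fin l → ℝ) (z : Fin m → ℂ)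
    (hz : ∀ k, (z k).im ≠ 0) :
    corr A κ P (List.ofFn x) (List.ofFn z) =
      pfaffian (blockMatrix fun j k => Matrix.of fun a b =>
        form A κ (genVec P (Fin.append (fun i => (x i : ℂ)) z j) a)
          (genVec P (Fin.append (fun i => (x i : ℂ)) z k) b) +
        rowPair A κ (genVec P (Fin.append (fun i => (x i : ℂ)) z j) a) ⬝ᵥ
          A⁻¹ *ᵥ rowPair A κ (genVec P (Fin.append (fun i => (x i : ℂ)) z k) b)) *
      corr A κ P [] [] := by
  have h := wick_mul_top (A := A) (κ := κ) hA hu (l + m) fun r =>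
    genVec P (Fin.append (fun i => (x i : ℂ)) z (finProdFinEquiv.symm r).1)
      (finProdFinEquiv.symm r).2
  rw [ofFn_genVec_prod, List.ofFn_fin_append, List.map_append, List.prod_append] at h
  have h1 : ((List.ofFn fun i => (x i : ℂ)).map fun y =>
      ExteriorAlgebra.ι ℂ (genVec P y 0) * ExteriorAlgebra.ι ℂ (genVec P y 1)).prod =
      ((List.ofFn x).map (realPair P)).prod := by
    rw [List.map_ofFn, List.map_ofFn]
    congr 2
    funext i
    simp [genVec, realPair]
  have h2 : ((List.ofFn z).map fun y =>
      ExteriorAlgebra.ι ℂ (genVec P y 0) * ExteriorAlgebra.ι ℂ (genVec P y 1)).prod =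
      ((List.ofFn z).map (complexPair P)).prod := by
    rw [List.map_ofFn, List.map_ofFn]
    congr 2
    funext i
    simp [genVec, complexPair, hz i]
  rw [h1, h2] at h
  rw [corr, h, corr]
  simp only [List.map_nil, List.prod_nil, one_mul]
  rfl

theorem rowPair_apply (hA : Aᵀ = -A) (c : Fin N → ℂ) :
    rowPair A κ (val c) = Sum.elim c 0 := by
  funext i
  rw [rowPair, form_row A κ hA]
  rcases i with i | i
  · simp [val, Pi.single_apply]
  · simp [val]

theorem rowPair_pt (hA : Aᵀ = -A) (t : ℝ) : rowPair A κ (pt t) = Sum.elim (κ t) 1 := by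
  funext i
  rw [rowPair, form_row A κ hA]
  rcases i with i | i
  · simp [pt, rowForm_apply, Pi.single_apply]
  · simp [pt, rowForm_apply]

section Kernel

variable (w : ℂ → ℝ) (p : Fin N → Polynomial ℂ)

/-- The form on the row space: up to the sign and to the scaling of rows and columns, the matrix
`W`. -/
def gram : Matrix (Fin N ⊕ Unit) (Fin N ⊕ Unit) ℂ :=
  -(Matrix.diagonal (Sum.elim 1 2) * W w p * Matrix.diagonal (Sum.elim (fun _ => 1 / 2) 1))

/-- The pairing of rows with real points. -/
def epsVals (t : ℝ) : Fin N → ℂ := fun j => eps (wt w (p j)) t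

theorem W_transpose : (W w p)ᵀ = -W w p := by
  ext i j
  rcases i with i | i <;> rcases j with j | j
  · simp only [W, Matrix.transpose_apply, Matrix.fromBlocks_apply₁₁, Matrix.of_apply,
      Matrix.neg_apply, skew]
    rw [← integral_neg]
    congr 1
    funext z
    ring
  · simp [W]
  · simp [W]
  · simp [W]

theorem gram_apply (i j : Fin N ⊕ Unit) : gram w p i j =
    -((Sum.elim 1 2 : Fin N ⊕ Unit → ℂ) i * W w p i j *
      (Sum.elim (fun _ => 1 / 2) 1 : Fin N ⊕ Unit → ℂ) j) := by
  rw [gram, Matrix.neg_apply, Matrix.mul_diagonal, Matrix.diagonal_mul]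

theorem gram_transpose : (gram w p)ᵀ = -gram w p := by
  have hW : ∀ i j, W w p j i = -W w p i j := fun i j => by
    have := congrFun (congrFun (W_transpose w p) i) j
    rwa [Matrix.transpose_apply, Matrix.neg_apply] at this
  ext i j
  rw [Matrix.transpose_apply, Matrix.neg_apply, gram_apply, gram_apply, hW i j]
  rcases i with i | i <;> rcases j with j | j
  · simp
  · simp only [Sum.elim_inl, Sum.elim_inr, Pi.ofNat_apply]
    ring
  · simp only [Sum.elim_inl, Sum.elim_inr, Pi.ofNat_apply]
    ring
  · simp [W]

theorem isUnit_diagonal_one_two :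
    IsUnit (Matrix.diagonal (Sum.elim 1 2) : Matrix (Fin N ⊕ Unit) (Fin N ⊕ Unit) ℂ) := by
  rw [Matrix.isUnit_diagonal, Pi.isUnit_iff]
  rintro (i | i) <;> simp

theorem isUnit_diagonal_half_one :
    IsUnit (Matrix.diagonal (Sum.elim (fun _ => 1 / 2) 1) :
      Matrix (Fin N ⊕ Unit) (Fin N ⊕ Unit) ℂ) := by
  rw [Matrix.isUnit_diagonal, Pi.isUnit_iff]
  rintro (i | i) <;> simp

theorem isUnit_gram_iff : IsUnit (gram w p) ↔ IsUnit (W w p) := by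
  have h1 := (Matrix.isUnit_iff_isUnit_det _).mp (isUnit_diagonal_one_two (N := N))
  have h2 := (Matrix.isUnit_iff_isUnit_det _).mp (isUnit_diagonal_half_one (N := N))
  rw [gram, IsUnit.neg_iff, Matrix.isUnit_iff_isUnit_det, Matrix.det_mul, Matrix.det_mul,
    IsUnit.mul_iff, IsUnit.mul_iff, Matrix.isUnit_iff_isUnit_det]
  exact ⟨fun h => h.1.2, fun h => ⟨⟨h1, h⟩, h2⟩⟩

theorem C_transpose (hW : IsUnit (W w p)) : (C w p)ᵀ = -C w p := by
  have hn : (-W w p)⁻¹ = -(W w p)⁻¹ := by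
    refine Matrix.inv_eq_left_inv ?_
    rw [neg_mul_neg, Matrix.nonsing_inv_mul _ ((Matrix.isUnit_iff_isUnit_det _).mp hW)]
  rw [C, Matrix.transpose_nonsing_inv, W_transpose, hn, Matrix.transpose_neg,
    Matrix.transpose_nonsing_inv, W_transpose, hn]

theorem gram_inv (hW : IsUnit (W w p)) : (gram w p)⁻¹ =
    Matrix.diagonal (Sum.elim (fun _ => 2) 1) * C w p *
      Matrix.diagonal (Sum.elim 1 (fun _ => 1 / 2)) := by
  refine Matrix.inv_eq_left_inv ?_
  have hC : C w p = -(W w p)⁻¹ := by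
    have := congrArg Matrix.transpose (C_transpose w p hW)
    rw [Matrix.transpose_transpose, C, Matrix.transpose_neg, Matrix.transpose_transpose] at this
    rw [C, this]
  have h1 : (Matrix.diagonal (Sum.elim 1 (fun _ => 1 / 2)) *
      Matrix.diagonal (Sum.elim 1 2) : Matrix (Fin N ⊕ Unit) (Fin N ⊕ Unit) ℂ) = 1 := by
    rw [Matrix.diagonal_mul_diagonal, ← Matrix.diagonal_one]
    congr 1
    funext i
    rcases i with i | i <;> simp
  have h2 : (Matrix.diagonal (Sum.elim (fun _ => 2) 1) *
      Matrix.diagonal (Sum.elim (fun _ => 1 / 2) 1) :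
        Matrix (Fin N ⊕ Unit) (Fin N ⊕ Unit) ℂ) = 1 := by
    rw [Matrix.diagonal_mul_diagonal, ← Matrix.diagonal_one]
    congr 1
    funext i
    rcases i with i | i <;> simp
  rw [hC, gram]
  simp only [mul_neg, neg_mul, neg_neg, mul_assoc]
  rw [← mul_assoc (Matrix.diagonal (Sum.elim 1 fun _ => 1 / 2)), h1, one_mul,
    ← mul_assoc (W w p)⁻¹, Matrix.nonsing_inv_mul _ ((Matrix.isUnit_iff_isUnit_det _).mp hW),
    one_mul, h2]

theorem C_inr_inl (hW : IsUnit (W w p)) (k : Fin N) :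
    C w p (Sum.inr ()) (Sum.inl k) = -C w p (Sum.inl k) (Sum.inr ()) := by
  have := congrFun (congrFun (C_transpose w p hW) (Sum.inl k)) (Sum.inr ())
  simpa using this

theorem C_inl_inl (hW : IsUnit (W w p)) (j k : Fin N) :
    C w p (Sum.inl j) (Sum.inl k) = -C w p (Sum.inl k) (Sum.inl j) := by
  have := congrFun (congrFun (C_transpose w p hW) (Sum.inl k)) (Sum.inl j)
  simpa using this

theorem C_inr_inr (hW : IsUnit (W w p)) : C w p (Sum.inr ()) (Sum.inr ()) = 0 := by
  have := congrFun (congrFun (C_transpose w p hW) (Sum.inr ())) (Sum.inr ())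
  rw [Matrix.transpose_apply, Matrix.neg_apply] at this
  exact self_eq_neg.mp this

theorem dotProduct_gram_inv (hW : IsUnit (W w p)) (a b : Fin N → ℂ) (c d : ℂ) :
    Sum.elim a (fun _ => c) ⬝ᵥ (gram w p)⁻¹ *ᵥ Sum.elim b (fun _ => d) =
      2 * ∑ n : Fin N, ∑ k : Fin N, a n * C w p (Sum.inl n) (Sum.inl k) * b k +
      d * ∑ n : Fin N, a n * C w p (Sum.inl n) (Sum.inr ()) -
      c * ∑ n : Fin N, b n * C w p (Sum.inl n) (Sum.inr ()) := by
  rw [gram_inv w p hW]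
  simp only [dotProduct, Matrix.mulVec, Fintype.sum_sum_type, Matrix.mul_diagonal,
    Matrix.diagonal_mul, Sum.elim_inl, Sum.elim_inr, Finset.univ_unique, Finset.sum_singleton,
    PUnit.default_eq_unit, C_inr_inl w p hW, C_inr_inr w p hW, Pi.one_apply, Finset.mul_sum,
    mul_add, Finset.sum_add_distrib, sub_eq_add_neg, ← Finset.sum_neg_distrib]
  rw [show c * (1 * 0 * (1 / 2) * d) = 0 by ring, add_zero]
  rw [add_right_comm, add_assoc, add_assoc]
  refine congrArg₂ _ ?_ ?_
  · refine Finset.sum_congr rfl fun n _ => Finset.sum_congr rfl fun k _ => ?_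
    ring
  · refine congrArg₂ _ ?_ ?_
    · refine Finset.sum_congr rfl fun n _ => ?_
      ring
    · refine Finset.sum_congr rfl fun n _ => ?_
      ring

theorem eps_of_im_ne_zero (f : ℂ → ℂ) {y : ℂ} (hy : y.im ≠ 0) :
    eps f y = phase y * f (conj y) := by
  rw [eps, if_neg hy, phase]; ring

theorem rowPair_genVec_zero (y : ℂ) : rowPair (gram w p) (epsVals w p) (genVec (wvals w p) y 0) =
    Sum.elim (fun j => wt w (p j) y) fun _ => 0 := by
  rw [genVec, if_pos rfl, rowPair_apply (gram_transpose w p)]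
  rfl

theorem rowPair_genVec_one (y : ℂ) : rowPair (gram w p) (epsVals w p) (genVec (wvals w p) y 1) =
    Sum.elim (fun j => eps (wt w (p j)) y) fun _ => chi y := by
  rw [genVec_one]
  by_cases hy : y.im = 0
  · rw [if_pos hy, rowPair_pt (gram_transpose w p), chi, if_pos hy]
    have : ((y.re : ℝ) : ℂ) = y := Complex.ext (by simp) (by simp [hy])
    funext i
    rcases i with i | i
    · simp [epsVals, this]
    · simp
  · rw [if_neg hy, rowPair_apply (gram_transpose w p), chi, if_neg hy]
    funext i
    rcases i with i | i
    · simp [wvals, eps_of_im_ne_zero _ hy]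
    · simp

theorem form_genVec_one_one (y y' : ℂ) :
    form (gram w p) (epsVals w p) (genVec (wvals w p) y 1) (genVec (wvals w p) y' 1) =
      1 / 2 * sgnDiff y y' := by
  rw [genVec_one, genVec_one, sgnDiff]
  by_cases hy : y.im = 0
  · by_cases hy' : y'.im = 0
    · rw [if_pos hy, if_pos hy', if_pos ⟨hy, hy'⟩, form_pt]
      simp [pt]
    · rw [if_pos hy, if_neg hy', if_neg fun h => hy' h.2, form_pt]
      simp [val]
  · rw [if_neg hy, if_neg (c := y.im = 0 ∧ y'.im = 0) fun h => hy h.1, form_val]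
    split_ifs
    · simp [pt]
    · simp [val]

/-- The Schur complement of the rows is the matrix kernel. -/
theorem kernel_eq (hW : IsUnit (W w p)) (y y' : ℂ) :
    (Matrix.of fun a b => form (gram w p) (epsVals w p) (genVec (wvals w p) y a)
        (genVec (wvals w p) y' b) +
      rowPair (gram w p) (epsVals w p) (genVec (wvals w p) y a) ⬝ᵥ
        (gram w p)⁻¹ *ᵥ rowPair (gram w p) (epsVals w p) (genVec (wvals w p) y' b)) =
      kernel w p y y' := by
  ext a b
  have hz : ∀ (y y' : ℂ) (b : Fin 2), form (gram w p) (epsVals w p) (genVec (wvals w p) y 0)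
      (genVec (wvals w p) y' b) = 0 := by
    intro y y' b
    rw [genVec, if_pos rfl, genVec]
    split_ifs
    · exact form_val_val _ _ _ _
    · exact form_val_pt _ _ _ _
    · exact form_val_val _ _ _ _
  have hz' : ∀ (y y' : ℂ), form (gram w p) (epsVals w p) (genVec (wvals w p) y 1)
      (genVec (wvals w p) y' 0) = 0 := by
    intro y y'
    rw [← (form_isAlt _ _).neg_eq, hz, neg_zero]
  fin_cases a <;> fin_cases b
  · simp only [Fin.zero_eta, Matrix.of_apply, hz, rowPair_genVec_zero, dotProduct_gram_inv w p hW,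
      kernel, DS, Matrix.cons_val_zero, Matrix.cons_val', zero_mul, zero_add, add_zero, sub_zero,
      Matrix.empty_val', Matrix.cons_val_fin_one]
  · simp only [Fin.zero_eta, Fin.mk_one, Matrix.of_apply, hz, rowPair_genVec_zero,
      rowPair_genVec_one, dotProduct_gram_inv w p hW,
      kernel, S, Matrix.cons_val_zero, Matrix.cons_val_one, Matrix.cons_val', zero_mul, zero_add,
      sub_zero, Matrix.empty_val', Matrix.cons_val_fin_one]
  · simp only [Fin.zero_eta, Fin.mk_one, Matrix.of_apply, hz', rowPair_genVec_zero,
      rowPair_genVec_one, dotProduct_gram_inv w p hW,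
      kernel, S, Matrix.cons_val_zero, Matrix.cons_val_one, Matrix.cons_val', zero_mul, zero_add,
      add_zero, Matrix.empty_val', Matrix.cons_val_fin_one]
    have hs : (∑ n : Fin N, ∑ k : Fin N, eps (wt w (p n)) y * C w p (Sum.inl n) (Sum.inl k) *
        wt w (p k) y') = -∑ n : Fin N, ∑ k : Fin N, wt w (p n) y' *
          C w p (Sum.inl n) (Sum.inl k) * eps (wt w (p k)) y := by
      rw [Finset.sum_comm, ← Finset.sum_neg_distrib]
      refine Finset.sum_congr rfl fun n _ => ?_
      rw [← Finset.sum_neg_distrib]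
      refine Finset.sum_congr rfl fun k _ => ?_
      rw [C_inl_inl w p hW]
      ring
    rw [hs]
    ring
  · simp only [Fin.mk_one, Matrix.of_apply, form_genVec_one_one,
      rowPair_genVec_one, dotProduct_gram_inv w p hW,
      kernel, SI, Matrix.cons_val_one, Matrix.cons_val',
      Matrix.empty_val', Matrix.cons_val_fin_one, Finset.mul_sum, mul_sub, Finset.sum_sub_distrib]
    have h1 : ∀ n : Fin N, C w p (Sum.inl n) (Sum.inr ()) * (chi y' * eps (wt w (p n)) y) =
        chi y' * (eps (wt w (p n)) y * C w p (Sum.inl n) (Sum.inr ())) := fun n => by ring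
    have h2 : ∀ n : Fin N, C w p (Sum.inl n) (Sum.inr ()) * (chi y * eps (wt w (p n)) y') =
        chi y * (eps (wt w (p n)) y' * C w p (Sum.inl n) (Sum.inr ())) := fun n => by ring
    simp only [h1, h2]
    ring

end Kernel

end Fock

end

/-! ### Integrability of the one-point functions -/

noncomputable section

namespace Fock

open Wick RealAsymmetric

/-- Lagrange interpolation at the nodes `a`. -/
theorem exists_interpolation {n : ℕ} {a : Fin (n + 1) → ℂ} (ha : Function.Injective a)
    {q : Polynomial ℂ} (hq : q.natDegree ≤ n) :
    ∃ c : Fin (n + 1) → ℂ, ∀ z, q.eval z = ∑ i, c i * ∏ j, (z - a (i.succAbove j)) := by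
  have hdeg : q.degree < ((Finset.univ : Finset (Fin (n + 1))).card : WithBot ℕ) := by
    refine Polynomial.degree_le_natDegree.trans_lt ?_
    rw [Finset.card_univ, Fintype.card_fin]
    exact_mod_cast Nat.lt_succ_of_le hq
  have h := Lagrange.eq_interpolate (s := Finset.univ) (v := a) ha.injOn hdeg
  refine ⟨fun i => q.eval (a i) * ∏ j, (a i - a (i.succAbove j))⁻¹, fun z => ?_⟩
  conv_lhs => rw [h, Lagrange.interpolate_apply]
  rw [Polynomial.eval_finsetSum]
  refine Finset.sum_congr rfl fun i _ => ?_
  have he : Finset.univ.erase i = Finset.image i.succAbove Finset.univ := by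
    rw [Fin.image_succAbove_univ]
    ext j
    simp
  rw [Lagrange.basis, he, Finset.prod_image fun _ _ _ _ h => Fin.succAbove_right_injective h,
    Polynomial.eval_mul, Polynomial.eval_prod, Polynomial.eval_C, mul_assoc,
    ← Finset.prod_mul_distrib]
  simp [Lagrange.basisDivisor]

theorem ae_injective (n : ℕ) : ∀ᵐ a : Fin n → ℝ, Function.Injective a := by
  have h : ∀ i j : Fin n, i ≠ j → ∀ᵐ a : Fin n → ℝ, a i ≠ a j := by
    intro i j hij
    let s : Submodule ℝ (Fin n → ℝ) :=
      LinearMap.ker ((LinearMap.proj i : (Fin n → ℝ) →ₗ[ℝ] ℝ) - LinearMap.proj j)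
    have hs : s ≠ ⊤ := by
      intro h
      have : (Pi.single i 1 : Fin n → ℝ) ∈ s := h ▸ Submodule.mem_top
      simp [s, hij.symm] at this
    have h0 := Measure.addHaar_submodule volume s hs
    rw [ae_iff]
    convert h0 using 2
    ext a
    simp [s, sub_eq_zero]
  have h2 : ∀ᵐ a : Fin n → ℝ, ∀ i j, i ≠ j → a i ≠ a j := by
    simp only [Filter.eventually_all]
    exact h
  filter_upwards [h2] with a ha i j hij
  by_contra hne
  exact ha i j hne hij

/-- Distinct nodes in a set `U` of positive measure, such that a property of almost all configurations
holds for all configurations of all nodes but one. -/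
theorem exists_nodes {n : ℕ} {U : Set ℝ} (hU : volume U ≠ 0) {G : (Fin n → ℝ) → Prop}
    (hG : ∀ᵐ a, G a) : ∃ a : Fin (n + 1) → ℝ, Function.Injective a ∧
      ∀ i : Fin (n + 1), a i ∈ U ∧ G fun j => a (i.succAbove j) := by
  have h1 : ∀ᵐ a : Fin (n + 1) → ℝ, ∀ i : Fin (n + 1), G fun j => a (i.succAbove j) := by
    rw [Filter.eventually_all]
    intro i
    have h := (Measure.quasiMeasurePreserving_snd (μ := (volume : Measure ℝ))
      (ν := (volume : Measure (Fin n → ℝ)))).comp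
      (volume_preserving_piFinSuccAbove (fun _ : Fin (n + 1) => ℝ) i).quasiMeasurePreserving
    exact h.ae hG
  have h2 : volume (Set.univ.pi fun _ : Fin (n + 1) => U) ≠ 0 := by
    rw [volume_pi, Measure.pi_pi]
    exact Finset.prod_ne_zero_iff.mpr fun _ _ => hU
  obtain ⟨a, ha, h3, h4⟩ := ((frequently_ae_mem_iff.mpr h2).and_eventually
    (h1.and (ae_injective (n + 1)))).exists
  exact ⟨a, h4, fun i => ⟨ha i (Set.mem_univ i), h3 i⟩⟩

section

variable {X Y : Type*} [MeasureSpace X] [MeasureSpace Y] [SigmaFinite (volume : Measure X)]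
  [SigmaFinite (volume : Measure Y)]

theorem ae_integrable_slice {a : ℕ} {g : (Fin (a + 1) → X) × Y → ℝ} (hg : Integrable g) :
    ∀ᵐ q : (Fin a → X) × Y, Integrable fun t => g (Fin.cons t q.1, q.2) :=
  ((measurePreserving_peel a).integrable_comp_of_integrable hg).prod_left_ae

end

variable {w : ℂ → ℝ}

theorem vand_map_ofReal_ne_zero {n : ℕ} {a : Fin n → ℝ} (ha : Function.Injective a) :
    vand ((List.ofFn a).map Complex.ofReal) ≠ 0 := by
  rw [List.map_ofFn, ← det_vandermonde_eq_vand, Matrix.det_vandermonde_ne_zero_iff]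
  exact Complex.ofReal_injective.comp ha

theorem density_cons_left {n : ℕ} (t : ℝ) (a : Fin n → ℝ) (β : Fin 0 → ℂ) :
    density w (Fin.cons t a : Fin (n + 1) → ℝ) β =
      ((∏ i, w (a i)) * ‖vand ((List.ofFn a).map Complex.ofReal)‖) *
        (w t * ‖∏ j, ((t : ℂ) - a j)‖) := by
  rw [density_eq]
  simp only [points, List.ofFn_cons, List.ofFn_zero, List.flatMap_nil, List.append_nil, vand,
    List.map_cons, List.prod_cons, List.map_ofFn, List.prod_ofFn, norm_mul, norm_prod,
    norm_sub_rev, pow_zero, one_mul, Function.comp_def]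
  ring

theorem density_cons_right {n : ℕ} (a : Fin n → ℝ) (z : ℂ) (β : Fin 0 → ℂ) :
    density w a (Fin.cons z β : Fin 1 → ℂ) =
      (4 * (∏ i, w (a i)) * ‖vand ((List.ofFn a).map Complex.ofReal)‖) *
        (w z * w (conj z) * |z.im| * ‖∏ j, (z - a j)‖ ^ 2) := by
  have hperm : (points (List.ofFn a) (List.ofFn (Fin.cons z β : Fin 1 → ℂ))).Perm
      (z :: conj z :: (List.ofFn a).map Complex.ofReal) := by
    simp only [points, List.ofFn_cons, List.ofFn_zero, List.flatMap_cons, List.flatMap_nil,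
      List.append_nil]
    exact List.perm_append_comm
  have h1 : ‖conj z - z‖ = 2 * |z.im| := by
    rw [norm_sub_rev, Complex.sub_conj]
    simp
  have h2 : ∀ j, ‖(a j : ℂ) - conj z‖ = ‖z - a j‖ := fun j => by
    rw [← RCLike.norm_conj (z - a j), norm_sub_rev]
    simp
  rw [density_eq, norm_vand_perm hperm, (hperm.map w).prod_eq]
  simp only [vand, List.map_cons, List.prod_cons, List.map_ofFn, List.prod_ofFn,
    norm_mul, norm_prod, Function.comp_def, h1, h2, norm_sub_rev _ z]
  ring

variable (w) in
/-- Nodes for which the products of the differences to all nodes but one are integrable. -/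
theorem exists_nodes_real {n : ℕ}
    (hint : Integrable fun q : (Fin (n + 1) → ℝ) × (Fin 0 → ℂ) => density w q.1 q.2)
    (hU : volume {t : ℝ | w t ≠ 0} ≠ 0) :
    ∃ a : Fin (n + 1) → ℝ, Function.Injective a ∧
      ∀ i : Fin (n + 1), Integrable fun t : ℝ => w t * ‖∏ j, ((t : ℂ) - a (i.succAbove j))‖ := by
  have h1 := Measure.ae_ae_of_ae_prod (ae_integrable_slice hint)
  obtain ⟨a, ha, h⟩ := exists_nodes hU h1
  refine ⟨a, ha, fun i => ?_⟩
  obtain ⟨β, hβ⟩ := (h i).2.exists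
  simp only [density_cons_left] at hβ
  refine (integrable_const_mul_iff (IsUnit.mk0 _ ?_) _).mp hβ
  refine mul_ne_zero (Finset.prod_ne_zero_iff.mpr fun j _ => (h _).1) (norm_ne_zero_iff.mpr ?_)
  exact vand_map_ofReal_ne_zero (ha.comp Fin.succAbove_right_injective)

variable (w) in
/-- Nodes for which the squares of the products of the differences to all nodes but one are
integrable on the complex plane, with the factor `|im z|` that is due to the pair `z`, `conj z`. -/
theorem exists_nodes_complex {n : ℕ}
    (hint : Integrable fun q : (Fin n → ℝ) × (Fin 1 → ℂ) => density w q.1 q.2)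
    (hU : volume {t : ℝ | w t ≠ 0} ≠ 0) :
    ∃ a : Fin (n + 1) → ℝ, Function.Injective a ∧ ∀ i : Fin (n + 1), Integrable fun z : ℂ =>
      w z * w (conj z) * |z.im| * ‖∏ j, (z - a (i.succAbove j))‖ ^ 2 := by
  have h1 := Measure.ae_ae_of_ae_prod (ae_integrable_slice (a := 0) hint.swap)
  obtain ⟨β, h2⟩ := h1.exists
  obtain ⟨a, ha, h⟩ := exists_nodes hU h2
  refine ⟨a, ha, fun i => ?_⟩
  have hβ := (h i).2
  simp only [Function.comp_def, Prod.swap, density_cons_right] at hβ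
  refine (integrable_const_mul_iff (IsUnit.mk0 _ ?_) _).mp hβ
  refine mul_ne_zero (mul_ne_zero (by norm_num) (Finset.prod_ne_zero_iff.mpr fun j _ => (h _).1))
    (norm_ne_zero_iff.mpr ?_)
  exact vand_map_ofReal_ne_zero (ha.comp Fin.succAbove_right_injective)

/-- As `N` is odd, there is a real point in every sector, so that the weight does not vanish almost
everywhere on the real line. -/
theorem volume_ne_zero_of_partitionFunction_pos {N : ℕ} (hN : Odd N)
    (hpos : 0 < partitionFunction N w) : volume {t : ℝ | w t ≠ 0} ≠ 0 := by
  intro h0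
  refine hpos.ne' (Finset.sum_eq_zero fun s hs => ?_)
  rw [mem_sectors] at hs
  obtain ⟨k, hk⟩ := hN
  have hL : 0 < s.1 := by omega
  rw [mul_eq_zero]
  right
  refine integral_eq_zero_of_ae ?_
  have h1 : ∀ᵐ α : Fin s.1 → ℝ, w (α ⟨0, hL⟩) = 0 := by
    have h2 : ∀ᵐ t : ℝ, w t = 0 := h0
    exact (Measure.quasiMeasurePreserving_eval (fun _ : Fin s.1 => (volume : Measure ℝ))
      ⟨0, hL⟩).ae h2
  filter_upwards [h1] with α hα
  have : ∀ β : Fin s.2 → ℂ, density w α β = 0 := fun β => by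
    rw [density, Finset.prod_eq_zero (Finset.mem_univ (⟨0, hL⟩ : Fin s.1)) hα]
    simp
  simp [this]

/-- The hypotheses on the weight of the ensemble. -/
structure IsWeight (N : ℕ) (w : ℂ → ℝ) : Prop where
  odd : Odd N
  measurable : Measurable w
  nonneg : ∀ z, 0 ≤ w z
  integrable : ∀ L M : ℕ, L + 2 * M = N →
    Integrable (fun q : (Fin L → ℝ) × (Fin M → ℂ) => density w q.1 q.2)
  pos : 0 < partitionFunction N w

variable {N : ℕ}

theorem integrable_wt_real (hw : IsWeight N w) {q : Polynomial ℂ} (hq : q.natDegree < N) :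
    Integrable fun t : ℝ => wt w q t := by
  obtain ⟨n, rfl⟩ : ∃ n, N = n + 1 := ⟨N - 1, by omega⟩
  obtain ⟨a, ha, h⟩ := exists_nodes_real w (hw.integrable (n + 1) 0 rfl)
    (volume_ne_zero_of_partitionFunction_pos hw.odd hw.pos)
  obtain ⟨c, hc⟩ := exists_interpolation (Complex.ofReal_injective.comp ha)
    (Nat.le_of_lt_succ hq)
  have h1 : ∀ t : ℝ, wt w q t = ∑ i, c i * ((w t : ℂ) * ∏ j, ((t : ℂ) - a (i.succAbove j))) := by
    intro t
    rw [wt, hc, Finset.mul_sum]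
    refine Finset.sum_congr rfl fun i _ => ?_
    simp only [Function.comp_apply]
    ring
  simp only [h1]
  refine integrable_finsetSum _ fun i _ => Integrable.const_mul ?_ _
  refine (integrable_norm_iff ?_).mp ?_
  · have := hw.measurable
    refine Measurable.aestronglyMeasurable ?_
    fun_prop
  · refine (h i).congr (Filter.Eventually.of_forall fun t => ?_)
    simp [abs_of_nonneg (hw.nonneg _)]

theorem integrable_im_mul_norm_sq (hw : IsWeight N w) {q : Polynomial ℂ} (hq : q.natDegree + 2 ≤ N) :
    Integrable fun z : ℂ => w z * w (conj z) * |z.im| * ‖q.eval z‖ ^ 2 := by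
  obtain ⟨n, rfl⟩ : ∃ n, N = n + 2 := ⟨N - 2, by omega⟩
  obtain ⟨a, ha, h⟩ := exists_nodes_complex w (hw.integrable n 1 rfl)
    (volume_ne_zero_of_partitionFunction_pos hw.odd hw.pos)
  obtain ⟨c, hc⟩ := exists_interpolation (Complex.ofReal_injective.comp ha)
    (show q.natDegree ≤ n by omega)
  have h1 : Integrable fun z : ℂ => ∑ i, ((n + 1 : ℕ) * ‖c i‖ ^ 2) *
      (w z * w (conj z) * |z.im| * ‖∏ j, (z - a (i.succAbove j))‖ ^ 2) :=
    integrable_finsetSum _ fun i _ => (h i).const_mul _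
  refine h1.mono ?_ (Filter.Eventually.of_forall fun z => ?_)
  · refine Measurable.aestronglyMeasurable ?_
    have h2 : Measurable fun z : ℂ => q.eval z := q.continuous.measurable
    have h3 : Measurable fun z : ℂ => w (conj z) := hw.measurable.comp Complex.continuous_conj.measurable
    have h4 : Measurable fun z : ℂ => |z.im| := Complex.measurable_im.norm
    exact ((hw.measurable.mul h3).mul h4).mul (h2.norm.pow_const 2)
  · have h0 : 0 ≤ w z * w (conj z) * |z.im| :=
      mul_nonneg (mul_nonneg (hw.nonneg _) (hw.nonneg _)) (abs_nonneg _)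
    rw [Real.norm_of_nonneg (mul_nonneg h0 (sq_nonneg _)), Real.norm_of_nonneg
      (Finset.sum_nonneg fun i _ => mul_nonneg (by positivity) (mul_nonneg h0 (sq_nonneg _)))]
    have h5 : ‖q.eval z‖ ^ 2 ≤
        ((n + 1 : ℕ) : ℝ) * ∑ i, (‖c i‖ * ‖∏ j, (z - a (i.succAbove j))‖) ^ 2 := by
      have h6 : ‖q.eval z‖ ≤ ∑ i, ‖c i‖ * ‖∏ j, (z - a (i.succAbove j))‖ := by
        rw [hc]
        refine (norm_sum_le _ _).trans (le_of_eq (Finset.sum_congr rfl fun i _ => ?_))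
        rw [norm_mul]
        rfl
      refine (pow_le_pow_left₀ (norm_nonneg _) h6 2).trans ?_
      have := sq_sum_le_card_mul_sum_sq (s := Finset.univ)
        (f := fun i => ‖c i‖ * ‖∏ j, (z - a (i.succAbove j))‖)
      simpa using this
    refine (mul_le_mul_of_nonneg_left h5 h0).trans (le_of_eq ?_)
    rw [Finset.mul_sum, Finset.mul_sum]
    refine Finset.sum_congr rfl fun i _ => ?_
    ring

end Fock

end

/-! ### The skew form and the integration hypothesis -/

noncomputable section

namespace Fock

open Wick RealAsymmetric

theorem pow_le_one_add_pow {r : ℝ} (hr : 0 ≤ r) {k m : ℕ} (h : k ≤ m) : r ^ k ≤ 1 + r ^ m := by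
  rcases le_total r 1 with h1 | h1
  · exact (pow_le_one₀ hr h1).trans (le_add_of_nonneg_right (pow_nonneg hr m))
  · exact (pow_le_pow_right₀ h1 h).trans (le_add_of_nonneg_left zero_le_one)

theorem norm_antisymm_pow_le_of_lt {a b n : ℕ} (hb : b < a) (ha : a < n + 2) (z : ℂ) :
    ‖z ^ a * conj z ^ b - z ^ b * conj z ^ a‖ ≤
      2 * (n + 2 : ℕ) * (|z.im| * (1 + (‖z‖ ^ n) ^ 2)) := by
  obtain ⟨d, rfl⟩ := Nat.exists_eq_add_of_lt hb
  have h1 : z ^ (b + d + 1) * conj z ^ b - z ^ b * conj z ^ (b + d + 1) =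
      (z * conj z) ^ b * ((∑ i ∈ Finset.range (d + 1), z ^ i * conj z ^ (d + 1 - 1 - i)) *
        (z - conj z)) := by
    rw [geom_sum₂_mul]
    ring
  have h2 : ‖∑ i ∈ Finset.range (d + 1), z ^ i * conj z ^ (d + 1 - 1 - i)‖ ≤
      ((n + 2 : ℕ) : ℝ) * ‖z‖ ^ d := by
    refine (norm_sum_le_of_le _ (f := fun i => z ^ i * conj z ^ (d + 1 - 1 - i))
      (n := fun _ => ‖z‖ ^ d) fun i hi => ?_).trans ?_
    · rw [norm_mul, norm_pow, norm_pow, RCLike.norm_conj, ← pow_add]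
      refine le_of_eq (congrArg _ ?_)
      rw [Finset.mem_range] at hi
      omega
    · rw [Finset.sum_const, Finset.card_range, nsmul_eq_mul]
      refine mul_le_mul_of_nonneg_right ?_ (by positivity)
      exact_mod_cast (by omega : d + 1 ≤ n + 2)
  have h3 : ‖z - conj z‖ = 2 * |z.im| := by
    rw [Complex.sub_conj]
    simp
  have h4 : ‖(z * conj z) ^ b‖ = ‖z‖ ^ (2 * b) := by
    rw [norm_pow, norm_mul, RCLike.norm_conj, ← sq, ← pow_mul]
  rw [h1, norm_mul, norm_mul, h3, h4]
  have h5 : ‖z‖ ^ (2 * b + d) ≤ 1 + (‖z‖ ^ n) ^ 2 := by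
    rw [← pow_mul]
    exact pow_le_one_add_pow (norm_nonneg _) (by omega)
  calc ‖z‖ ^ (2 * b) * (‖∑ i ∈ Finset.range (d + 1), z ^ i * conj z ^ (d + 1 - 1 - i)‖ *
        (2 * |z.im|))
      ≤ ‖z‖ ^ (2 * b) * ((((n + 2 : ℕ) : ℝ) * ‖z‖ ^ d) * (2 * |z.im|)) := by gcongr
    _ = 2 * (n + 2 : ℕ) * (|z.im| * ‖z‖ ^ (2 * b + d)) := by rw [pow_add]; ring
    _ ≤ _ := by gcongr

/-- Antisymmetric combinations of powers of `z` and `conj z` are divisible by `z - conj z`. -/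
theorem norm_antisymm_pow_le {a b n : ℕ} (ha : a < n + 2) (hb : b < n + 2) (z : ℂ) :
    ‖z ^ a * conj z ^ b - z ^ b * conj z ^ a‖ ≤
      2 * (n + 2 : ℕ) * (|z.im| * (1 + (‖z‖ ^ n) ^ 2)) := by
  rcases lt_trichotomy a b with h | rfl | h
  · rw [norm_sub_rev]
    exact norm_antisymm_pow_le_of_lt h hb z
  · rw [sub_self, norm_zero]
    positivity
  · exact norm_antisymm_pow_le_of_lt h ha z

variable {N : ℕ} {w : ℂ → ℝ}

theorem measurable_conj : Measurable fun z : ℂ => conj z := Complex.continuous_conj.measurable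

theorem integrable_antisymm_pow (hw : IsWeight N w) {a b : ℕ} (ha : a < N) (hb : b < N) :
    Integrable fun z : ℂ =>
      (w z : ℂ) * w (conj z) * (z ^ a * conj z ^ b - z ^ b * conj z ^ a) := by
  rcases eq_or_ne a b with rfl | hab
  · simp
  obtain ⟨n, rfl⟩ : ∃ n, N = n + 2 := ⟨N - 2, by omega⟩
  have h1 := integrable_im_mul_norm_sq hw (q := 1) (by simp)
  have h2 := integrable_im_mul_norm_sq hw (q := Polynomial.X ^ n) (by simp)
  refine ((h1.add h2).const_mul (2 * (n + 2 : ℕ))).mono ?_ (Filter.Eventually.of_forall fun z => ?_)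
  · have := hw.measurable
    have := measurable_conj
    refine Measurable.aestronglyMeasurable ?_
    fun_prop
  · have h0 : 0 ≤ w z * w (conj z) := mul_nonneg (hw.nonneg _) (hw.nonneg _)
    have h3 := mul_le_mul_of_nonneg_left (norm_antisymm_pow_le ha hb z) h0
    rw [norm_mul, norm_mul, Complex.norm_real, Complex.norm_real, Real.norm_of_nonneg (hw.nonneg _),
      Real.norm_of_nonneg (hw.nonneg _)]
    refine h3.trans ((le_of_eq ?_).trans (le_abs_self _))
    simp only [Pi.add_apply, Polynomial.eval_one, norm_one, Polynomial.eval_pow, Polynomial.eval_X,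
      norm_pow]
    ring

/-- The two products are not integrable separately in general: their difference vanishes on the real
line, where the density does. -/
theorem integrable_antisymm (hw : IsWeight N w) {q q' : Polynomial ℂ} (hq : q.natDegree < N)
    (hq' : q'.natDegree < N) :
    Integrable fun z : ℂ => wt w q z * wt w q' (conj z) - wt w q' z * wt w q (conj z) := by
  have h : ∀ z : ℂ, wt w q z * wt w q' (conj z) - wt w q' z * wt w q (conj z) =
      ∑ a ∈ Finset.range N, ∑ b ∈ Finset.range N, (q.coeff a * q'.coeff b) *
        ((w z : ℂ) * w (conj z) * (z ^ a * conj z ^ b - z ^ b * conj z ^ a)) := by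
    intro z
    simp only [wt, Polynomial.eval_eq_sum_range' hq, Polynomial.eval_eq_sum_range' hq',
      mul_sub, Finset.sum_sub_distrib]
    congr 1
    · rw [mul_mul_mul_comm, Finset.sum_mul_sum, Finset.mul_sum]
      refine Finset.sum_congr rfl fun a _ => ?_
      rw [Finset.mul_sum]
      refine Finset.sum_congr rfl fun b _ => ?_
      ring
    · rw [mul_mul_mul_comm, Finset.sum_mul_sum, Finset.sum_comm, Finset.mul_sum]
      refine Finset.sum_congr rfl fun a _ => ?_
      rw [Finset.mul_sum]
      refine Finset.sum_congr rfl fun b _ => ?_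
      ring
  simp only [h]
  refine integrable_finsetSum _ fun a ha => integrable_finsetSum _ fun b hb => ?_
  exact (integrable_antisymm_pow hw (Finset.mem_range.mp ha) (Finset.mem_range.mp hb)).const_mul _

theorem measurable_sign : Measurable Real.sign :=
  Measurable.ite (measurableSet_lt measurable_id measurable_const) measurable_const
    (Measurable.ite (measurableSet_lt measurable_const measurable_id) measurable_const
      measurable_const)

theorem norm_sign_le (x : ℝ) : ‖(Real.sign x : ℂ)‖ ≤ 1 := by
  rcases Real.sign_apply_eq x with h | h | h <;> simp [h]

theorem integrable_mul_sign {f : ℝ → ℂ} (hf : Integrable f) {g : ℝ → ℝ} (hg : Measurable g) :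
    Integrable fun t => f t * (Real.sign (g t) : ℂ) := by
  refine hf.mul_bdd (c := 1) ?_ (Filter.Eventually.of_forall fun t => norm_sign_le _)
  exact (Complex.measurable_ofReal.comp (measurable_sign.comp hg)).aestronglyMeasurable

theorem measurable_eps {f : ℂ → ℂ} (hf : Measurable f) : Measurable fun t : ℝ => eps f t := by
  have h : ∀ t : ℝ, eps f t = 1 / 2 * ∫ ξ : ℝ, f ξ * (Real.sign (t - ξ) : ℂ) := fun t => by
    simp [eps]
  simp only [h]
  refine Measurable.const_mul (StronglyMeasurable.measurable ?_) _
  refine StronglyMeasurable.integral_prod_right (f := fun (t ξ : ℝ) =>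
    f ξ * (Real.sign (t - ξ) : ℂ)) ?_
  refine Measurable.stronglyMeasurable ?_
  refine Measurable.mul (hf.comp (Complex.measurable_ofReal.comp measurable_snd)) ?_
  exact Complex.measurable_ofReal.comp (measurable_sign.comp (measurable_fst.sub measurable_snd))

theorem norm_eps_le {f : ℂ → ℂ} (hf : Integrable fun t : ℝ => f t) (t : ℝ) :
    ‖eps f t‖ ≤ 1 / 2 * ∫ ξ : ℝ, ‖f ξ‖ := by
  have h : eps f t = 1 / 2 * ∫ ξ : ℝ, f ξ * (Real.sign (t - ξ) : ℂ) := by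
    simp [eps]
  rw [h, norm_mul]
  have h1 : ‖(1 / 2 : ℂ)‖ = 1 / 2 := by simp
  rw [h1]
  refine mul_le_mul_of_nonneg_left ((norm_integral_le_integral_norm _).trans ?_) (by norm_num)
  refine integral_mono (integrable_mul_sign hf (measurable_const.sub measurable_id)).norm hf.norm
    fun ξ => ?_
  rw [norm_mul]
  exact mul_le_of_le_one_right (norm_nonneg _) (norm_sign_le _)

/-- The function `ε f` is bounded on the real line. -/
theorem integrable_eps_mul {f g : ℂ → ℂ} (hf : Measurable f) (hfi : Integrable fun t : ℝ => f t)
    (hgi : Integrable fun t : ℝ => g t) : Integrable fun t : ℝ => eps f t * g t :=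
  hgi.bdd_mul (measurable_eps hf).aestronglyMeasurable
    (Filter.Eventually.of_forall (norm_eps_le hfi))

theorem measurable_wt (hw : IsWeight N w) (q : Polynomial ℂ) : Measurable (wt w q) :=
  (Complex.measurable_ofReal.comp hw.measurable).mul q.continuous.measurable

theorem ae_im_ne_zero : ∀ᵐ z : ℂ, z.im ≠ 0 := by
  have hs : LinearMap.ker Complex.imLm ≠ ⊤ := by
    intro h
    have : Complex.I ∈ LinearMap.ker Complex.imLm := h ▸ Submodule.mem_top
    simp at this
  have h0 := Measure.addHaar_submodule volume _ hs
  rw [ae_iff]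
  convert h0 using 2
  ext z
  simp

theorem measurable_phase : Measurable phase :=
  measurable_const.mul (Complex.measurable_ofReal.comp (measurable_sign.comp Complex.measurable_im))

theorem norm_phase_le (z : ℂ) : ‖phase z‖ ≤ 1 := by
  rw [phase, norm_mul]
  simpa using norm_sign_le z.im

theorem integrable_phase_mul {f : ℂ → ℂ} (hf : Integrable f) :
    Integrable fun z => phase z * f z :=
  hf.bdd_mul measurable_phase.aestronglyMeasurable (Filter.Eventually.of_forall norm_phase_le)

/-- The real line is a null set in the complex plane. -/
theorem skew_integrand_ae (f g : ℂ → ℂ) : (fun z => f z * eps g z - g z * eps f z) =ᵐ[volume]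
    fun z => phase z * (f z * g (conj z) - g z * f (conj z)) := by
  filter_upwards [ae_im_ne_zero] with z hz
  rw [eps_of_im_ne_zero _ hz, eps_of_im_ne_zero _ hz]
  ring

theorem measurableEmbedding_ofReal : MeasurableEmbedding (fun t : ℝ => (t : ℂ)) :=
  Complex.isometry_ofReal.isClosedEmbedding.measurableEmbedding

section Skew

variable {f g : ℂ → ℂ}

theorem integrable_skew_real (hf : Measurable f) (hg : Measurable g)
    (hfi : Integrable fun t : ℝ => f t) (hgi : Integrable fun t : ℝ => g t) :
    Integrable fun t : ℝ => f t * eps g t - g t * eps f t := by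
  have h1 := integrable_eps_mul hg hgi hfi
  have h2 := integrable_eps_mul hf hfi hgi
  refine (h1.sub h2).congr (Filter.Eventually.of_forall fun t => ?_)
  simp only [Pi.sub_apply, mul_comm]

theorem integrable_skew (hf : Measurable f) (hg : Measurable g)
    (hfi : Integrable fun t : ℝ => f t) (hgi : Integrable fun t : ℝ => g t)
    (hfg : Integrable fun z : ℂ => f z * g (conj z) - g z * f (conj z)) :
    Integrable (fun z => f z * eps g z - g z * eps f z) mu := by
  rw [mu, integrable_add_measure, measurableEmbedding_ofReal.integrable_map_iff]
  exact ⟨integrable_skew_real hf hg hfi hgi,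
    (integrable_phase_mul hfg).congr (skew_integrand_ae f g).symm⟩

theorem skew_eq (hf : Measurable f) (hg : Measurable g)
    (hfi : Integrable fun t : ℝ => f t) (hgi : Integrable fun t : ℝ => g t)
    (hfg : Integrable fun z : ℂ => f z * g (conj z) - g z * f (conj z)) :
    skew f g = (∫ t : ℝ, (f t * eps g t - g t * eps f t)) +
      ∫ z : ℂ, phase z * (f z * g (conj z) - g z * f (conj z)) := by
  have h := integrable_skew hf hg hfi hgi hfg
  rw [mu, integrable_add_measure] at h
  rw [skew, mu, integral_add_measure h.1 h.2, measurableEmbedding_ofReal.integral_map,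
    integral_congr_ae (skew_integrand_ae f g)]

end Skew

/-- The generators of the three kinds span the space. -/
theorem space_induction {Q : Space N → Prop} (add : ∀ v v', Q v → Q v' → Q (v + v'))
    (smul : ∀ (c : ℂ) v, Q v → Q (c • v)) (hrow : ∀ i, Q (row (Pi.single i 1)))
    (hval : ∀ c, Q (val c)) (hpt : ∀ t, Q (pt t)) (v : Space N) : Q v := by
  have h0 : Q 0 := by simpa using hval 0
  have h1 : ∀ a, Q (row a) := fun a => by
    rw [row_eq_sum]
    exact Finset.sum_induction _ Q add h0 fun i _ => smul _ _ (hrow i)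
  have h2 : ∀ s : ℝ →₀ ℂ, Q (0, 0, s) := fun s => by
    induction s using Finsupp.induction_linear with
    | zero => exact h0
    | add s s' hs hs' => simpa using add _ _ hs hs'
    | single t c => simpa [pt] using smul c _ (hpt t)
  have := add _ _ (add _ _ (h1 v.1) (hval v.2.1)) (h2 v.2.2)
  simpa [row, val] using this

theorem HasIntegralSum.swap_neg {X Y E : Type*} [MeasurableSpace X] [MeasurableSpace Y]
    [AddCommGroup E] [Module ℂ E] {μ : Measure X} {ν : Measure Y}
    {β : X → LinearMap.BilinForm ℂ E} {β' : Y → LinearMap.BilinForm ℂ E}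
    {b : LinearMap.BilinForm ℂ E} (hβ : ∀ x, (β x).IsAlt) (hβ' : ∀ y, (β' y).IsAlt) (hb : b.IsAlt)
    {v v' : E} (h : HasIntegralSum μ ν (fun x => β x v v') (fun y => β' y v v') (b v v')) :
    HasIntegralSum μ ν (fun x => β x v' v) (fun y => β' y v' v) (b v' v) := by
  have := h.const_mul (-1)
  simp only [neg_one_mul, (hβ _).neg_eq, (hβ' _).neg_eq, hb.neg_eq] at this
  exact this

section Kernel

variable {N : ℕ} {w : ℂ → ℝ} (p : Fin N → Polynomial ℂ)

theorem form_val_row_inl (A : Matrix (Fin N ⊕ Unit) (Fin N ⊕ Unit) ℂ) (κ : ℝ → Fin N → ℂ)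
    (c : Fin N → ℂ) (j : Fin N) : form A κ (val c) (row (Pi.single (Sum.inl j) 1)) = -c j := by
  rw [form_val]
  simp [row, Pi.single_apply]

theorem form_val_row_inr (A : Matrix (Fin N ⊕ Unit) (Fin N ⊕ Unit) ℂ) (κ : ℝ → Fin N → ℂ)
    (c : Fin N → ℂ) : form A κ (val c) (row (Pi.single (Sum.inr ()) 1)) = 0 := by
  rw [form_val]
  simp [row]

theorem form_pt_row_inl (A : Matrix (Fin N ⊕ Unit) (Fin N ⊕ Unit) ℂ) (κ : ℝ → Fin N → ℂ)
    (t : ℝ) (j : Fin N) : form A κ (pt t) (row (Pi.single (Sum.inl j) 1)) = -κ t j := by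
  rw [form_pt]
  simp [row, rowForm_apply, Pi.single_apply]

theorem form_pt_row_inr (A : Matrix (Fin N ⊕ Unit) (Fin N ⊕ Unit) ℂ) (κ : ℝ → Fin N → ℂ)
    (t : ℝ) : form A κ (pt t) (row (Pi.single (Sum.inr ()) 1)) = -1 := by
  rw [form_pt]
  simp [row, rowForm_apply]

theorem form_pt_pt (A : Matrix (Fin N ⊕ Unit) (Fin N ⊕ Unit) ℂ) (κ : ℝ → Fin N → ℂ)
    (t s : ℝ) : form A κ (pt t) (pt s) = 1 / 2 * (Real.sign (s - t) : ℂ) := by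
  rw [form_pt]
  simp [pt]

theorem form_row_row_single {A : Matrix (Fin N ⊕ Unit) (Fin N ⊕ Unit) ℂ} (hA : Aᵀ = -A)
    (κ : ℝ → Fin N → ℂ) (i j : Fin N ⊕ Unit) :
    form A κ (row (Pi.single i 1)) (row (Pi.single j 1)) = A i j := by
  rw [form_row_row hA]
  simp

theorem chargeForm_val (A : Matrix (Fin N ⊕ Unit) (Fin N ⊕ Unit) ℂ) (κ : ℝ → Fin N → ℂ)
    (c : Fin N → ℂ) (v : Space N) : chargeForm A κ (val c) v = 0 := by
  rw [chargeForm_apply, charge_val, map_smul, LinearMap.smul_apply, form_val, form_val]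
  simp [charge]

variable (w) in
/-- The integration over one point produces the infinitesimal change of the form along the
charge. -/
theorem hasIntegralSum_forms (hw : IsWeight N w) (hp : ∀ n : Fin N, (p n).natDegree < N)
    (v v' : Space N) : HasIntegralSum volume volume
      (fun t : ℝ => realForm (wvals w p) (gram w p) (epsVals w p) t v v')
      (fun z : ℂ => complexForm (wvals w p) (gram w p) (epsVals w p) z v v')
      (chargeForm (gram w p) (epsVals w p) v v') := by
  set A := gram w p with hA_def
  set κ := epsVals w p with hκ
  have hA : Aᵀ = -A := gram_transpose w p
  have hneg : ∀ {v v' : Space N}, _ → _ := fun {v v'} => HasIntegralSum.swap_neg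
    (μ := (volume : Measure ℝ)) (ν := (volume : Measure ℂ))
    (β := realForm (wvals w p) A κ) (β' := complexForm (wvals w p) A κ) (b := chargeForm A κ)
    (fun _ => wedge_isAlt _ _) (fun _ => wedge_isAlt _ _) (chargeForm_isAlt A κ)
    (v := v) (v' := v')
  have hm := fun j => measurable_wt hw (p j)
  have hi := fun j => integrable_wt_real hw (hp j)
  -- Values of polynomials do not contribute.
  have hval : ∀ c v, HasIntegralSum volume volume
      (fun t : ℝ => realForm (wvals w p) A κ t (val c) v)
      (fun z : ℂ => complexForm (wvals w p) A κ z (val c) v) (chargeForm A κ (val c) v) := by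
    intro c v
    have h1 : ∀ t, form A κ (pt t) (val c) = 0 := fun t => by
      rw [← (form_isAlt A κ).neg_eq, form_val_pt, neg_zero]
    simpa only [realForm, complexForm, wedge_apply, h1, form_val_val, chargeForm_val, zero_mul,
      mul_zero, sub_zero] using hasIntegralSum_zero
  have hint_row : ∀ j k : Fin N, HasIntegralSum volume volume
      (fun t : ℝ => realForm (wvals w p) A κ t (row (Pi.single (Sum.inl j) 1))
        (row (Pi.single (Sum.inl k) 1)))
      (fun z : ℂ => complexForm (wvals w p) A κ z (row (Pi.single (Sum.inl j) 1))
        (row (Pi.single (Sum.inl k) 1)))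
      (chargeForm A κ (row (Pi.single (Sum.inl j) 1)) (row (Pi.single (Sum.inl k) 1))) := by
    intro j k
    have h1 := integrable_skew_real (hm j) (hm k) (hi j) (hi k)
    have h2 := integrable_phase_mul (integrable_antisymm hw (hp j) (hp k))
    have h3 := skew_eq (hm j) (hm k) (hi j) (hi k) (integrable_antisymm hw (hp j) (hp k))
    have h4 : chargeForm A κ (row (Pi.single (Sum.inl j) 1)) (row (Pi.single (Sum.inl k) 1)) =
        -skew (wt w (p j)) (wt w (p k)) := by
      rw [chargeForm_apply, charge_row_inl, charge_row_inl, one_smul, one_smul,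
        form_row_row_single hA, hA_def, gram_apply]
      simp [W]
      ring
    rw [h4, h3]
    have h5 := HasIntegralSum.const_mul (⟨h1, h2, rfl⟩ : HasIntegralSum volume volume _ _ _) (-1)
    rw [neg_one_mul] at h5
    convert h5 using 2
    · rw [realForm, wedge_apply, form_pt_row_inl, form_val_row_inl, form_pt_row_inl,
        form_val_row_inl]
      simp only [hκ, epsVals, wvals]
      ring
    · rw [complexForm, wedge_apply, form_val_row_inl, form_val_row_inl, form_val_row_inl,
        form_val_row_inl]
      simp only [wvals, Pi.smul_apply, smul_eq_mul]
      ring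
  have hint_border : ∀ j : Fin N, HasIntegralSum volume volume
      (fun t : ℝ => realForm (wvals w p) A κ t (row (Pi.single (Sum.inl j) 1))
        (row (Pi.single (Sum.inr ()) 1)))
      (fun z : ℂ => complexForm (wvals w p) A κ z (row (Pi.single (Sum.inl j) 1))
        (row (Pi.single (Sum.inr ()) 1)))
      (chargeForm A κ (row (Pi.single (Sum.inl j) 1)) (row (Pi.single (Sum.inr ()) 1))) := by
    intro j
    have h5 := HasIntegralSum.const_mul (⟨hi j, integrable_zero ℂ ℂ volume, rfl⟩ :
      HasIntegralSum volume volume _ _ _) (-1)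
    convert h5 using 2
    · rw [realForm, wedge_apply, form_pt_row_inl, form_val_row_inl, form_pt_row_inr,
        form_val_row_inr]
      simp only [wvals]
      ring
    · rw [complexForm, wedge_apply, form_val_row_inl, form_val_row_inl, form_val_row_inr,
        form_val_row_inr]
      simp
    · rw [chargeForm_apply, charge_row_inl, charge_row_inr, one_smul, zero_smul, map_zero,
        form_row_row_single hA, hA_def, gram_apply]
      simp [W]
  have hint_sign : ∀ (j : Fin N) (s : ℝ), HasIntegralSum volume volume
      (fun t : ℝ => realForm (wvals w p) A κ t (row (Pi.single (Sum.inl j) 1)) (pt s))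
      (fun z : ℂ => complexForm (wvals w p) A κ z (row (Pi.single (Sum.inl j) 1)) (pt s))
      (chargeForm A κ (row (Pi.single (Sum.inl j) 1)) (pt s)) := by
    intro j s
    have hs : Measurable fun t : ℝ => s - t := measurable_const.sub measurable_id
    have h5 := HasIntegralSum.const_mul (⟨integrable_mul_sign (hi j) hs, integrable_zero ℂ ℂ volume, rfl⟩ :
      HasIntegralSum volume volume _ _ _) (1 / 2)
    convert h5 using 2
    · rw [realForm, wedge_apply, form_pt_row_inl, form_val_row_inl, form_pt_pt, form_val_pt]
      simp only [wvals]
      ring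
    · rw [complexForm, wedge_apply, form_val_pt, form_val_pt]
      simp
    · rw [chargeForm_apply, charge_row_inl, charge_pt, one_smul, zero_smul, map_zero,
        ← (form_isAlt A κ).neg_eq, form_pt_row_inl]
      simp [hκ, epsVals, eps]
  -- The pairings among the last row and the generators of real points vanish on both sides.
  have hzero : ∀ v v' : Space N, charge v = 0 → charge v' = 0 →
      (∀ c, form A κ (val c) v = 0) → (∀ c, form A κ (val c) v' = 0) →
      HasIntegralSum volume volume
        (fun t : ℝ => realForm (wvals w p) A κ t v v')
        (fun z : ℂ => complexForm (wvals w p) A κ z v v') (chargeForm A κ v v') := by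
    intro v v' h h' hc hc'
    simpa only [realForm, complexForm, wedge_apply, hc, hc', chargeForm_apply, h, h', map_zero,
      LinearMap.zero_apply, add_zero, zero_mul, mul_zero, sub_zero] using hasIntegralSum_zero
  have h0r : charge (row (N := N) (Pi.single (Sum.inr ()) 1)) = 0 := by
    rw [charge_row_inr, zero_smul]
  have h0p : ∀ t, charge (pt (N := N) t) = 0 := fun t => by rw [charge_pt, zero_smul]
  have hcr := form_val_row_inr A κ
  have hcp := fun t c => form_val_pt A κ c t
  induction v using space_induction with
  | add v₁ v₂ h₁ h₂ => simpa only [map_add, LinearMap.add_apply] using h₁.add h₂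
  | smul c v h => simpa only [map_smul, LinearMap.smul_apply, smul_eq_mul] using h.const_mul c
  | hval c => exact hval c v'
  | hrow i =>
    induction v' using space_induction with
    | add v₁ v₂ h₁ h₂ => simpa only [map_add] using h₁.add h₂
    | smul c v h => simpa only [map_smul, smul_eq_mul] using h.const_mul c
    | hval c => exact hneg (hval c _)
    | hrow k =>
      rcases i with j | j <;> rcases k with k | k
      · exact hint_row j k
      · exact hint_border j
      · exact hneg (hint_border k)
      · exact hzero _ _ h0r h0r hcr hcr
    | hpt s =>
      rcases i with j | j
      · exact hint_sign j s
      · exact hzero _ _ h0r (h0p s) hcr (hcp s)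
  | hpt t =>
    induction v' using space_induction with
    | add v₁ v₂ h₁ h₂ => simpa only [map_add] using h₁.add h₂
    | smul c v h => simpa only [map_smul, smul_eq_mul] using h.const_mul c
    | hval c => exact hneg (hval c _)
    | hrow k =>
      rcases k with k | k
      · exact hneg (hint_sign k t)
      · exact hzero _ _ (h0p t) h0r (hcp t) hcr
    | hpt s => exact hzero _ _ (h0p t) (h0p s) (hcp t) (hcp s)

end Kernel

end Fock

end

/-! ### Integrability of the density in a part of the points -/

noncomputable section

namespace Fock

open Wick RealAsymmetric

section FiniteRank

variable {X Y : Type*} [MeasurableSpace X] [MeasurableSpace Y] {μ : Measure X} {ν : Measure Y}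
  {V : Type*} [Ring V] [Algebra ℂ V]

/-- The functions with values in the algebra `V` that are finite sums of products of an integrable
function and of a vector. -/
def finiteRank (μ : Measure X) (V : Type*) [Ring V] [Algebra ℂ V] : Submodule ℂ (X → V) :=
  Submodule.span ℂ {g | ∃ (h : X → ℂ) (a : V), Integrable h μ ∧ g = fun x => h x • a}

theorem smul_mem_finiteRank {h : X → ℂ} (hh : Integrable h μ) (a : V) :
    (fun x => h x • a) ∈ finiteRank μ V :=
  Submodule.subset_span ⟨h, a, hh, rfl⟩

theorem integrable_of_mem_finiteRank {g : X → V} (hg : g ∈ finiteRank μ V) (ψ : V →ₗ[ℂ] ℂ) :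
    Integrable (fun x => ψ (g x)) μ := by
  induction hg using Submodule.span_induction with
  | mem g h =>
    obtain ⟨h, a, hh, rfl⟩ := h
    simpa only [map_smul, smul_eq_mul] using hh.mul_const _
  | zero => simp
  | add g g' _ _ h h' =>
    simp only [Pi.add_apply, map_add]
    exact h.add h'
  | smul c g _ h => simpa only [Pi.smul_apply, map_smul, smul_eq_mul] using h.const_mul c

theorem mem_finiteRank_comp {g : X → V} (hg : g ∈ finiteRank μ V) {e : Y → X}
    (he : MeasurePreserving e ν μ) : (fun y => g (e y)) ∈ finiteRank ν V := by
  induction hg using Submodule.span_induction with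
  | mem g h =>
    obtain ⟨h, a, hh, rfl⟩ := h
    exact smul_mem_finiteRank (he.integrable_comp_of_integrable hh) a
  | zero => exact zero_mem _
  | add g g' _ _ h h' => exact add_mem h h'
  | smul c g _ h => exact Submodule.smul_mem _ c h

theorem const_mul_mem_finiteRank {g : X → V} (hg : g ∈ finiteRank μ V) (b : V) :
    (fun x => b * g x) ∈ finiteRank μ V := by
  induction hg using Submodule.span_induction with
  | mem g h =>
    obtain ⟨h, a, hh, rfl⟩ := h
    simpa only [mul_smul_comm] using smul_mem_finiteRank hh (b * a)
  | zero =>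
    simp only [Pi.zero_apply, mul_zero]
    exact zero_mem _
  | add g g' _ _ h h' =>
    simp only [Pi.add_apply, mul_add]
    exact add_mem h h'
  | smul c g _ h =>
    simp only [Pi.smul_apply, mul_smul_comm]
    exact Submodule.smul_mem _ c h

/-- Products of integrable functions of separate variables are integrable. -/
theorem mul_mem_finiteRank [SFinite μ] [SFinite ν] {g : X → V} {g' : Y → V}
    (hg : g ∈ finiteRank μ V) (hg' : g' ∈ finiteRank ν V) :
    (fun q : X × Y => g q.1 * g' q.2) ∈ finiteRank (μ.prod ν) V := by
  induction hg using Submodule.span_induction with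
  | mem g h =>
    obtain ⟨h, a, hh, rfl⟩ := h
    induction hg' using Submodule.span_induction with
    | mem g' h' =>
      obtain ⟨h', a', hh', rfl⟩ := h'
      simpa only [smul_mul_smul_comm] using smul_mem_finiteRank (hh.mul_prod hh') (a * a')
    | zero =>
      simp only [Pi.zero_apply, mul_zero]
      exact zero_mem _
    | add g g' _ _ h h' =>
      simp only [Pi.add_apply, mul_add]
      exact add_mem h h'
    | smul c g _ h =>
      simp only [Pi.smul_apply, mul_smul_comm]
      exact Submodule.smul_mem _ c h
  | zero =>
    simp only [Pi.zero_apply, zero_mul]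
    exact zero_mem _
  | add g g' _ _ h h' =>
    simp only [Pi.add_apply, add_mul]
    exact add_mem h h'
  | smul c g _ h =>
    simp only [Pi.smul_apply, smul_mul_assoc]
    exact Submodule.smul_mem _ c h

end FiniteRank

theorem prod_ofFn_mem_finiteRank {X V : Type*} [MeasureSpace X] [SigmaFinite (volume : Measure X)]
    [Ring V] [Algebra ℂ V] {u : X → V} (hu : u ∈ finiteRank volume V) (a : ℕ) :
    (fun x : Fin a → X => ((List.ofFn x).map u).prod) ∈ finiteRank volume V := by
  induction a with
  | zero =>
    have h : Integrable (fun _ : Fin 0 → X => (1 : ℂ)) := by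
      rw [volume_pi, Measure.pi_of_empty]
      exact integrable_const _
    simpa using smul_mem_finiteRank h (1 : V)
  | succ a ih =>
    have h1 := mem_finiteRank_comp (mul_mem_finiteRank hu ih)
      (volume_preserving_piFinSuccAbove (fun _ : Fin (a + 1) => X) 0)
    convert h1 using 1
    funext x
    rw [List.ofFn_succ, List.map_cons, List.prod_cons]
    rfl

variable {N : ℕ} {w : ℂ → ℝ} (p : Fin N → Polynomial ℂ)

theorem ι_eq_sum (c : Fin N → ℂ) : ExteriorAlgebra.ι ℂ c =
    ∑ j, c j • ExteriorAlgebra.ι ℂ (Pi.single j (1 : ℂ) : Fin N → ℂ) := by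
  conv_lhs => rw [pi_eq_sum_univ' c, map_sum]
  simp only [map_smul]

theorem ι_wvals_mem_finiteRank (hw : IsWeight N w) (hp : ∀ n : Fin N, (p n).natDegree < N) :
    (fun t : ℝ => ExteriorAlgebra.ι ℂ (wvals w p t)) ∈
      finiteRank volume (ExteriorAlgebra ℂ (Fin N → ℂ)) := by
  have h : (fun t : ℝ => ExteriorAlgebra.ι ℂ (wvals w p t)) = ∑ j, fun t : ℝ =>
      wt w (p j) t • ExteriorAlgebra.ι ℂ (Pi.single j (1 : ℂ) : Fin N → ℂ) := by
    funext t
    rw [ι_eq_sum, Finset.sum_apply]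
    rfl
  rw [h]
  exact Submodule.sum_mem _ fun j _ => smul_mem_finiteRank (integrable_wt_real hw (hp j)) _

/-- In the product for a pair of complex points only the antisymmetric combinations of values occur. -/
theorem ι_wvals_mul_mem_finiteRank (hw : IsWeight N w) (hp : ∀ n : Fin N, (p n).natDegree < N) :
    (fun z : ℂ => ExteriorAlgebra.ι ℂ (wvals w p z) * ExteriorAlgebra.ι ℂ (wvals w p (conj z))) ∈
      finiteRank volume (ExteriorAlgebra ℂ (Fin N → ℂ)) := by
  set e : Fin N → ExteriorAlgebra ℂ (Fin N → ℂ) := fun j => ExteriorAlgebra.ι ℂ (Pi.single j 1)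
    with he
  have h : (fun z : ℂ => ExteriorAlgebra.ι ℂ (wvals w p z) *
      ExteriorAlgebra.ι ℂ (wvals w p (conj z))) = ∑ j, ∑ k, fun z : ℂ =>
      (wt w (p j) z * wt w (p k) (conj z) - wt w (p k) z * wt w (p j) (conj z)) •
        ((1 / 2 : ℂ) • (e j * e k)) := by
    funext z
    have h1 : ExteriorAlgebra.ι ℂ (wvals w p z) * ExteriorAlgebra.ι ℂ (wvals w p (conj z)) =
        ∑ j, ∑ k, (wt w (p j) z * wt w (p k) (conj z)) • (e j * e k) := by
      rw [ι_eq_sum, ι_eq_sum (wvals w p (conj z)), Finset.sum_mul_sum]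
      simp only [smul_mul_smul_comm]
      rfl
    have h2 : ExteriorAlgebra.ι ℂ (wvals w p z) * ExteriorAlgebra.ι ℂ (wvals w p (conj z)) =
        ∑ j, ∑ k, -((wt w (p k) z * wt w (p j) (conj z)) • (e j * e k)) := by
      rw [h1, Finset.sum_comm]
      refine Finset.sum_congr rfl fun j _ => Finset.sum_congr rfl fun k _ => ?_
      rw [he]
      simp only
      rw [ι_mul_ι_comm, smul_neg]
    simp only [Finset.sum_apply]
    have h3 : ∀ x : ExteriorAlgebra ℂ (Fin N → ℂ), x = (1 / 2 : ℂ) • (x + x) := fun x => by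
      rw [← two_smul ℂ x, smul_smul]
      norm_num
    rw [h3 (_ * _)]
    conv_lhs => enter [2, 1]; rw [h1]
    rw [h2, ← Finset.sum_add_distrib, Finset.smul_sum]
    refine Finset.sum_congr rfl fun j _ => ?_
    rw [← Finset.sum_add_distrib, Finset.smul_sum]
    refine Finset.sum_congr rfl fun k _ => ?_
    rw [← sub_eq_add_neg, ← sub_smul, smul_comm]
  rw [h]
  exact Submodule.sum_mem _ fun j _ => Submodule.sum_mem _ fun k _ =>
    smul_mem_finiteRank (integrable_antisymm hw (hp j) (hp k)) _

/-- The determinant as a functional on the exterior algebra. -/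
def detFunctional (N : ℕ) : ExteriorAlgebra ℂ (Fin N → ℂ) →ₗ[ℂ] ℂ :=
  ExteriorAlgebra.liftAlternating
    (Pi.single N (Matrix.detRowAlternating : (Fin N → ℂ) [⋀^Fin N]→ₗ[ℂ] ℂ))

theorem detFunctional_prod (hp : ∀ n : Fin N, (p n).Monic ∧ (p n).natDegree = (n : ℕ))
    (l : List ℂ) (hl : l.length = N) :
    detFunctional N (l.map fun y => ExteriorAlgebra.ι ℂ (wvals w p y)).prod =
      (l.map fun z => (w z : ℂ)).prod * vand l := by
  have h1 := det_wvals w p hp hl l.get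
  rw [List.ofFn_get] at h1
  have h2 : (l.map fun y => ExteriorAlgebra.ι ℂ (wvals w p y)).prod =
      ExteriorAlgebra.ιMulti ℂ N fun i => wvals w p (l.get (Fin.cast hl.symm i)) := by
    subst hl
    rw [ExteriorAlgebra.ιMulti_apply]
    refine congrArg List.prod ?_
    refine List.ext_get (by simp) fun i h h' => ?_
    simp
  rw [← h1, h2, detFunctional, ExteriorAlgebra.liftAlternating_apply_ιMulti, Pi.single_eq_same]
  rfl

/-- The density as the norm of a linear functional of a product with one factor for each point. -/
theorem density_eq_norm (hw : IsWeight N w)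
    (hp : ∀ n : Fin N, (p n).Monic ∧ (p n).natDegree = (n : ℕ)) {L M : ℕ} (hLM : L + 2 * M = N)
    (α : Fin L → ℝ) (β : Fin M → ℂ) : density w α β =
      2 ^ M * ‖detFunctional N (((List.ofFn α).map fun t : ℝ => ExteriorAlgebra.ι ℂ (wvals w p t)).prod *
        ((List.ofFn β).map fun z =>
          ExteriorAlgebra.ι ℂ (wvals w p z) * ExteriorAlgebra.ι ℂ (wvals w p (conj z))).prod)‖ := by
  have h1 : (points (List.ofFn α) (List.ofFn β)).length = N := by
    rw [length_points, List.length_ofFn, List.length_ofFn, hLM]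
  have h2 := detFunctional_prod (w := w) p hp _ h1
  have h3 : ∀ zs : List ℂ, ((zs.flatMap fun z => [z, conj z]).map fun y =>
      ExteriorAlgebra.ι ℂ (wvals w p y)).prod = (zs.map fun z =>
        ExteriorAlgebra.ι ℂ (wvals w p z) * ExteriorAlgebra.ι ℂ (wvals w p (conj z))).prod := by
    intro zs
    induction zs with
    | nil => rfl
    | cons z zs ih => simp [ih, mul_assoc]
  rw [points, List.map_append, List.prod_append, h3, List.map_map] at h2
  have h4 : ‖((points (List.ofFn α) (List.ofFn β)).map fun z => (w z : ℂ)).prod‖ =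
      ((points (List.ofFn α) (List.ofFn β)).map w).prod := by
    generalize points (List.ofFn α) (List.ofFn β) = l
    induction l with
    | nil => simp
    | cons y l ih => simp [ih, abs_of_nonneg (hw.nonneg y)]
  rw [density_eq, mul_assoc, ← h4, ← norm_mul]
  congr 2
  exact h2.symm

theorem integrable_density_append (hw : IsWeight N w)
    (hp : ∀ n : Fin N, (p n).Monic ∧ (p n).natDegree = (n : ℕ)) {l m a b : ℕ}
    (h : (l + a) + 2 * (m + b) = N) (x : Fin l → ℝ) (z : Fin m → ℂ) :
    Integrable fun q : (Fin a → ℝ) × (Fin b → ℂ) =>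
      density w (Fin.append x q.1) (Fin.append z q.2) := by
  have hp' : ∀ n : Fin N, (p n).natDegree < N := fun n => by
    rw [(hp n).2]; exact n.isLt
  have h1 := prod_ofFn_mem_finiteRank (ι_wvals_mem_finiteRank p hw hp') a
  have h2 := prod_ofFn_mem_finiteRank (ι_wvals_mul_mem_finiteRank p hw hp') b
  have h3 := mul_mem_finiteRank (const_mul_mem_finiteRank h1
    ((List.ofFn x).map fun t : ℝ => ExteriorAlgebra.ι ℂ (wvals w p t)).prod)
    (const_mul_mem_finiteRank h2 ((List.ofFn z).map fun z =>
      ExteriorAlgebra.ι ℂ (wvals w p z) * ExteriorAlgebra.ι ℂ (wvals w p (conj z))).prod)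
  refine ((integrable_of_mem_finiteRank h3 (detFunctional N)).norm.const_mul (2 ^ (m + b))).congr
    (Filter.Eventually.of_forall fun q => ?_)
  simp only [density_eq_norm p hw hp h, List.ofFn_fin_append, List.map_append, List.prod_append]

end Fock

end

/-! ### The correlation functions -/

noncomputable section

namespace Fock

open Wick RealAsymmetric

variable {N : ℕ} {w : ℂ → ℝ} {p : Fin N → Polynomial ℂ}

theorem corr_append_eq (A : Matrix (Fin N ⊕ Unit) (Fin N ⊕ Unit) ℂ) (κ : ℝ → Fin N → ℂ)
    (hw : IsWeight N w) (hp : ∀ n : Fin N, (p n).Monic ∧ (p n).natDegree = (n : ℕ))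
    {l m a b : ℕ} (h : (l + a) + 2 * (m + b) = N) (x : Fin l → ℝ) (z : Fin m → ℂ)
    (α : Fin a → ℝ) (β : Fin b → ℂ) :
    corr A κ (wvals w p) (List.ofFn x ++ List.ofFn α) (List.ofFn z ++ List.ofFn β) =
      topFactor N * density w (Fin.append x α) (Fin.append z β) := by
  rw [← corr_top A κ hw.odd w p hp h, List.ofFn_fin_append, List.ofFn_fin_append]

theorem integrableTop (A : Matrix (Fin N ⊕ Unit) (Fin N ⊕ Unit) ℂ) (κ : ℝ → Fin N → ℂ)
    (hw : IsWeight N w) (hp : ∀ n : Fin N, (p n).Monic ∧ (p n).natDegree = (n : ℕ)) :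
    IntegrableTop A κ (wvals w p) := by
  intro xs zs a b h
  have h1 := ((integrable_density_append p hw hp h xs.get zs.get).ofReal (𝕜 := ℂ)).const_mul
    (topFactor N)
  refine h1.congr (Filter.Eventually.of_forall fun q => ?_)
  have h2 := corr_append_eq A κ hw hp h xs.get zs.get q.1 q.2
  rw [List.ofFn_get, List.ofFn_get] at h2
  exact h2.symm

theorem corrIntegral_eq (A : Matrix (Fin N ⊕ Unit) (Fin N ⊕ Unit) ℂ) (κ : ℝ → Fin N → ℂ)
    (hw : IsWeight N w) (hp : ∀ n : Fin N, (p n).Monic ∧ (p n).natDegree = (n : ℕ))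
    {l m a b : ℕ} (h : (l + a) + 2 * (m + b) = N) (x : Fin l → ℝ) (z : Fin m → ℂ) :
    corrIntegral A κ (wvals w p) a b (List.ofFn x) (List.ofFn z) =
      topFactor N * (∫ α : Fin a → ℝ, ∫ β : Fin b → ℂ,
        density w (Fin.append x α) (Fin.append z β) : ℝ) := by
  have h1 := integral_prod _ (integrable_density_append p hw hp h x z)
  simp only [corrIntegral, corr_append_eq A κ hw hp h]
  rw [integral_const_mul, ← h1]
  exact congrArg _ integral_ofReal

/-- The correlation of the empty set of points is a multiple of the partition function. -/
theorem corr_nil (hw : IsWeight N w)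
    (hp : ∀ n : Fin N, (p n).Monic ∧ (p n).natDegree = (n : ℕ)) :
    corr (gram w p) (epsVals w p) (wvals w p) [] [] = topFactor N * partitionFunction N w := by
  have hp' : ∀ n : Fin N, (p n).natDegree < N := fun n => by
    rw [(hp n).2]; exact n.isLt
  rw [← sum_corrIntegral (hasIntegralSum_forms w p hw hp') (integrableTop _ _ hw hp) N [] []
    (by simp), partitionFunction, Complex.ofReal_sum, Finset.mul_sum]
  refine Finset.sum_congr rfl fun s hs => ?_
  rw [mem_sectors] at hs
  have h1 := integral_prod _ (hw.integrable s.1 s.2 hs)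
  have h2 : corrIntegral (gram w p) (epsVals w p) (wvals w p) s.1 s.2 [] [] =
      topFactor N * (∫ α : Fin s.1 → ℝ, ∫ β : Fin s.2 → ℂ, density w α β : ℝ) := by
    simp only [corrIntegral, List.nil_append, corr_top _ _ hw.odd w p hp hs]
    rw [integral_const_mul, ← h1]
    exact congrArg _ integral_ofReal
  rw [h2, weight]
  push_cast
  ring

theorem isUnit_gram (hw : IsWeight N w)
    (hp : ∀ n : Fin N, (p n).Monic ∧ (p n).natDegree = (n : ℕ)) : IsUnit (gram w p) := by
  refine isUnit_of_wick_top_ne_zero (κ := epsVals w p) (gram_transpose w p) ?_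
  have h := corr_nil hw hp
  simp only [corr, List.map_nil, List.prod_nil, one_mul] at h
  rw [h]
  exact mul_ne_zero (topFactor_ne_zero N) (Complex.ofReal_ne_zero.mpr hw.pos.ne')

/-- The correlation of some points is a multiple of the correlation function. -/
theorem corr_eq_correlation (hw : IsWeight N w)
    (hp : ∀ n : Fin N, (p n).Monic ∧ (p n).natDegree = (n : ℕ)) {l m : ℕ} (hlm : l + 2 * m ≤ N)
    (x : Fin l → ℝ) (z : Fin m → ℂ) :
    corr (gram w p) (epsVals w p) (wvals w p) (List.ofFn x) (List.ofFn z) =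
      topFactor N * partitionFunction N w * correlation N w x z := by
  have hp' : ∀ n : Fin N, (p n).natDegree < N := fun n => by
    rw [(hp n).2]; exact n.isLt
  have hZ : (partitionFunction N w : ℂ) ≠ 0 := Complex.ofReal_ne_zero.mpr hw.pos.ne'
  have hsec : (Finset.range (N + 1) ×ˢ Finset.range (N + 1)).filter
      (fun s => (l + s.1) + 2 * (m + s.2) = N) = sectors (N - (l + 2 * m)) := by
    ext s
    rw [mem_sectors, Finset.mem_filter, Finset.mem_product, Finset.mem_range, Finset.mem_range]
    omega
  rw [← sum_corrIntegral (hasIntegralSum_forms w p hw hp') (integrableTop _ _ hw hp)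
    (N - (l + 2 * m)) _ _ (by simp; omega), correlation, hsec, Complex.ofReal_sum, Finset.mul_sum]
  refine Finset.sum_congr rfl fun s hs => ?_
  rw [mem_sectors] at hs
  simp only [jpdf, integral_div]
  rw [corrIntegral_eq _ _ hw hp (by omega), weight]
  push_cast
  field_simp

theorem correlation_eq_pfaffian (hw : IsWeight N w)
    (hp : ∀ n : Fin N, (p n).Monic ∧ (p n).natDegree = (n : ℕ)) {l m : ℕ} (hlm : l + 2 * m ≤ N)
    (x : Fin l → ℝ) (z : Fin m → ℂ) (hz : ∀ k, (z k).im ≠ 0) :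
    (correlation N w x z : ℂ) = pfaffian (blockMatrix fun j k =>
      kernel w p (Fin.append (fun i => (x i : ℂ)) z j) (Fin.append (fun i => (x i : ℂ)) z k)) := by
  have hu := isUnit_gram hw hp
  have hne : topFactor N * (partitionFunction N w : ℂ) ≠ 0 :=
    mul_ne_zero (topFactor_ne_zero N) (Complex.ofReal_ne_zero.mpr hw.pos.ne')
  have h1 := corr_eq_correlation hw hp hlm x z
  rw [corr_eq_pfaffian _ (gram_transpose w p) hu x z hz, corr_nil hw hp, mul_comm] at h1
  simp only [kernel_eq w p ((isUnit_gram_iff w p).mp hu)] at h1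
  exact (mul_left_cancel₀ hne h1).symm

end Fock

end

theorem mainTheorem2 (N : ℕ) (hN : Odd N) (w : ℂ → ℝ)
    (hw_meas : Measurable w) (hw_nonneg : ∀ z, 0 ≤ w z)
    (hw_conj : ∀ z, w (conj z) = w z)
    (h_int : ∀ L M : ℕ, L + 2 * M = N →
      Integrable (fun q : (Fin L → ℝ) × (Fin M → ℂ) => RealAsymmetric.density w q.1 q.2))
    (h_pos : 0 < RealAsymmetric.partitionFunction N w)
    (p : Fin N → Polynomial ℂ)
    (hp : ∀ n : Fin N, (p n).Monic ∧ (p n).natDegree = (n : ℕ)) :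
    (∀ n : Fin N, Integrable (fun t : ℝ => RealAsymmetric.wt w (p n) t)) ∧
    (∀ j k : Fin N, Integrable (fun y =>
      RealAsymmetric.wt w (p j) y * RealAsymmetric.eps (RealAsymmetric.wt w (p k)) y -
        RealAsymmetric.wt w (p k) y * RealAsymmetric.eps (RealAsymmetric.wt w (p j)) y)
      RealAsymmetric.mu) ∧
    IsUnit (RealAsymmetric.W w p) ∧
    ∀ l m : ℕ, l + 2 * m ≤ N → ∀ (x : Fin l → ℝ) (z : Fin m → ℂ), (∀ k, (z k).im ≠ 0) →
      (∀ a b : ℕ, (l + a) + 2 * (m + b) = N →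
        Integrable (fun q : (Fin a → ℝ) × (Fin b → ℂ) =>
          RealAsymmetric.jpdf N w (Fin.append x q.1) (Fin.append z q.2))) ∧
      (RealAsymmetric.correlation N w x z : ℂ) =
        pfaffian (blockMatrix fun j k =>
          RealAsymmetric.kernel w p (Fin.append (fun i => (x i : ℂ)) z j)
            (Fin.append (fun i => (x i : ℂ)) z k)) := by
  have hw : Fock.IsWeight N w := ⟨hN, hw_meas, hw_nonneg, h_int, h_pos⟩
  have hp' : ∀ n : Fin N, (p n).natDegree < N := fun n => by
    rw [(hp n).2]; exact n.isLt
  have hi := fun n => Fock.integrable_wt_real hw (hp' n)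
  have hm := fun n => Fock.measurable_wt hw (p n)
  refine ⟨hi, fun j k => Fock.integrable_skew (hm j) (hm k) (hi j) (hi k)
    (Fock.integrable_antisymm hw (hp' j) (hp' k)),
    (Fock.isUnit_gram_iff w p).mp (Fock.isUnit_gram hw hp), fun l m hlm x z hz =>
    ⟨fun a b hab => (Fock.integrable_density_append p hw hp hab x z).div_const _,
      Fock.correlation_eq_pfaffian hw hp hlm x z hz⟩⟩
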